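/- Work over $\mathbb{C}$. Let $V_{14}=E\oplus F$ with $E=\langle e_1,\dots,e_7\rangle$ and $F=\langle f_1,\dots,f_7\rangle$ isotropic and $q(e_i,f_j)=\delta_{ij}$. The Clifford algebra of $(V_{14},v\mapsto q(v,v))$ acts on $\wedge^*E$: $E$ acts by wedge product and $F$ by twice the contraction. Let $\Delta_{14}=\wedge^+E$ be the resulting half-spin representation of $\mathrm{Spin}_{14}$; its dual is $\wedge^-E$ through the invariant pairing $\langle s,t\rangle=$ coefficient of $e_1\wedge\dots\wedge e_7$ in $s^{t}\wedge t$, where $s^t=(-1)^{p(p-1)/2}s$ for $s\in\wedge^pE$. Let $(v_i)=(e_1,\dots,e_7,f_1,\dots,f_7)$, with $q$-dual basis $(w_i)=(f_1,\dots,f_7,e_1,\dots,e_7)$. For $z\in\Delta_{14}$ put $$\Omega_z=\sum_{i<j<k}\langle z,v_iv_jv_kz\rangle\, w_i\wedge w_j\wedge w_k\in\wedge^3V_{14},\qquad M_z=\Theta(\Omega_z)\in \mathrm{End}(V_{14}).$$ Here $\Theta$ is the quadratic map defined as follows: embed $\wedge^3V_{14}$ in $V_{14}\otimes\wedge^2V_{14}$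 by $a\wedge b\wedge c\mapsto a\otimes (b\wedge c)+b\otimes (c\wedge a)+c\otimes (a\wedge b)$; if $\omega\mapsto\sum_i a_i\otimes\alpha_i$, then $\Theta(\omega)(x)=\sum_{i,j}q_2(\alpha_i,\alpha_j)\,q(a_i,x)\,a_j$, with $q_2(u_1\wedge u_2,u_1'\wedge u_2')=\det(q(u_i,u_j'))$. A three-form on a seven-dimensional space $V$ is called generic if its $GL(V)$-orbit is Zariski open in $\wedge^3V$. **Proposition.** There is a nonzero $\mathrm{Spin}_{14}$-invariant homogeneous polynomial $J_8$ of degree eight on $\Delta_{14}$, of which every $\mathrm{Spin}_{14}$-invariant homogeneous polynomial of degree eight is a scalar multiple, and which can be normalized so that the following hold. 1. Let $[z]$ belong to the (Zariski) open orbit of $\mathrm{Spin}_{14}$ in $\mathbb{P}(\Delta_{14})$. There is a unique unordered pair $(V_7,V_7')$ of seven-dimensional subspaces giving an orthogonal decomposition $V_{14}=V_7\oplus V_7'$ (so that both are non-degenerate) that is preserved, as an unordered pair, by the stabilizer of $[z]$ in $\mathrm{Spin}_{14}$. Then $\Omega_z=\Omega+\Omega'$ with $\Omega\in\wedge^3V_7$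 and $\Omega'\in\wedge^3V_7'$ generic three-forms, and $$M_z=m_z(\pi_{V_7'}-\pi_{V_7})\quad\text{for some } m_z\in\mathbb{C}\text{ with } J_8(z)=m_z^2,$$ where $\pi_{V_7},\pi_{V_7'}$ are the orthogonal projections to $V_7$ and $V_7'$. (Exchanging $V_7$ and $V_7'$ changes the sign of $m_z$.) 2. Let $[z]$ belong to the open orbit of $\mathrm{Spin}_{14}$ in the hypersurface $(J_8=0)\subset\mathbb{P}(\Delta_{14})$. The differential of $J_8$ at $z$, viewed in $\Delta_{14}^\vee\simeq\wedge^-E$, is a nonzero pure spinor, that is, it is annihilated by a unique seven-dimensional isotropic subspace $V_7$ of $V_{14}$. For this $V_7$, $\Omega_z$ belongs to $\wedge^2V_7\wedge V_{14}$, and $M_z$ satisfies $M_z^2=0$, with image and kernel both equal to $V_7$. -/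

import Mathlib

open scoped TensorProduct

noncomputable section

namespace Spin14

/-! ### The quadratic space `V₁₄ = E ⊕ F` -/

/-- The seven-dimensional space `E = ℂ⁷`. -/
abbrev E7 : Type := Fin 7 → ℂ

/-- `V₁₄ = E ⊕ F`, where `F = ℂ⁷` is put in duality with `E` by the dot product. -/
abbrev V14 : Type := E7 × E7

/-- The linear form on `E` given by an element of `F`. -/
def dualForm : E7 →ₗ[ℂ] Module.Dual ℂ E7 := dotProductBilin ℂ ℂ

/-- The symmetric bilinear form `q` on `V₁₄`: `E` and `F` are isotropic and `q(e_i, f_j) = δ_ij`. -/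
def q : V14 →ₗ[ℂ] Module.Dual ℂ V14 :=
  LinearMap.compl₁₂ dualForm (LinearMap.fst ℂ E7 E7) (LinearMap.snd ℂ E7 E7) +
    LinearMap.compl₁₂ dualForm (LinearMap.snd ℂ E7 E7) (LinearMap.fst ℂ E7 E7)

/-- The quadratic form `v ↦ q(v, v)`. -/
def Q : QuadraticForm ℂ V14 := LinearMap.BilinMap.toQuadraticMap q

/-- The basis `e_1, …, e_7` of `E`, in `V₁₄`. -/
def eVec (i : Fin 7) : V14 := (Pi.single i 1, 0)

/-- The dual basis `f_1, …, f_7` of `F`, in `V₁₄`. -/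
def fVec (i : Fin 7) : V14 := (0, Pi.single i 1)

/-- The basis `(e_1, …, e_7, f_1, …, f_7)` of `V₁₄`. -/
def vBasis : Fin 14 → V14 := Fin.append eVec fVec

/-- The `q`-dual basis `(f_1, …, f_7, e_1, …, e_7)`. -/
def wBasis : Fin 14 → V14 := Fin.append fVec eVec

/-! ### Spinors -/

/-- The full spin representation `∧E`. -/
abbrev Spinors : Type := ExteriorAlgebra ℂ E7

/-- Clifford action of a vector of `V₁₄ = E ⊕ F` on `∧E`: `E` acts by wedge product on the left,
`F` by twice the contraction. -/
def cliff : V14 →ₗ[ℂ] Module.End ℂ Spinors :=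
  (LinearMap.mul ℂ Spinors ∘ₗ ExteriorAlgebra.ι ℂ) ∘ₗ LinearMap.fst ℂ E7 E7 +
    (2 : ℂ) • ((CliffordAlgebra.contractLeft (Q := (0 : QuadraticForm ℂ E7)) ∘ₗ dualForm) ∘ₗ
      LinearMap.snd ℂ E7 E7)

theorem cliff_apply (v : V14) (s : Spinors) :
    cliff v s = ExteriorAlgebra.ι ℂ v.1 * s +
      (2 : ℂ) • CliffordAlgebra.contractLeft (Q := (0 : QuadraticForm ℂ E7)) (dualForm v.2) s :=
  rfl

theorem Q_apply (v : V14) : Q v = 2 * dualForm v.2 v.1 := by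
  simp only [Q, q, LinearMap.BilinMap.toQuadraticMap_apply, LinearMap.add_apply,
    LinearMap.compl₁₂_apply, LinearMap.fst_apply, LinearMap.snd_apply, dualForm,
    dotProductBilin_apply_apply]
  rw [dotProduct_comm v.1 v.2]; ring

theorem cliff_cliff (v : V14) : cliff v * cliff v = algebraMap ℂ _ (Q v) := by
  refine LinearMap.ext fun s => ?_
  have h1 : ExteriorAlgebra.ι ℂ v.1 * (ExteriorAlgebra.ι ℂ v.1 * s) = 0 := by
    rw [← mul_assoc, ExteriorAlgebra.ι_sq_zero, zero_mul]
  have h2 : CliffordAlgebra.contractLeft (Q := (0 : QuadraticForm ℂ E7)) (dualForm v.2)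
      (ExteriorAlgebra.ι ℂ v.1 * s) = dualForm v.2 v.1 • s - ExteriorAlgebra.ι ℂ v.1 *
      CliffordAlgebra.contractLeft (Q := (0 : QuadraticForm ℂ E7)) (dualForm v.2) s :=
    CliffordAlgebra.contractLeft_ι_mul _ _ _
  rw [Module.End.mul_apply, cliff_apply, cliff_apply, map_add, map_smul, h2,
    CliffordAlgebra.contractLeft_contractLeft, mul_add, h1, Algebra.mul_smul_comm, Q_apply,
    Module.algebraMap_end_apply]
  module

/-- The action of the Clifford algebra of `(V₁₄, q)` on `∧E`. -/
def cliffordRep : CliffordAlgebra Q →ₐ[ℂ] Module.End ℂ Spinors :=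
  CliffordAlgebra.lift Q ⟨cliff, cliff_cliff⟩

/-- The even (`i = 0`) and the odd (`i = 1`) part of `∧E`. -/
abbrev halfSpin (i : ZMod 2) : Submodule ℂ Spinors :=
  CliffordAlgebra.evenOdd (0 : QuadraticForm ℂ E7) i

/-- The half-spin representation `Δ₁₄ = ∧⁺E`. -/
abbrev Delta14 : Type := halfSpin 0

theorem ι_mul_mem (e : E7) {i : ZMod 2} {s : Spinors} (hs : s ∈ halfSpin i) :
    ExteriorAlgebra.ι ℂ e * s ∈ halfSpin (i + 1) := by
  rw [add_comm]
  exact CliffordAlgebra.evenOdd_mul_le _ _ _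
    (Submodule.mul_mem_mul (CliffordAlgebra.ι_mem_evenOdd_one _ e) hs)

theorem contract_mem (d : Module.Dual ℂ E7) {i : ZMod 2} {s : Spinors} (hs : s ∈ halfSpin i) :
    CliffordAlgebra.contractLeft (Q := (0 : QuadraticForm ℂ E7)) d s ∈ halfSpin (i + 1) := by
  have two : ∀ j : ZMod 2, j + 1 + 1 = j := by decide
  have ind : ∀ (s : Spinors) (j : ZMod 2),
      CliffordAlgebra.contractLeft (Q := (0 : QuadraticForm ℂ E7)) d s ∈ halfSpin (j + 1) →
      s ∈ halfSpin j → ∀ m m' : E7,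
      CliffordAlgebra.contractLeft (Q := (0 : QuadraticForm ℂ E7)) d
        (ExteriorAlgebra.ι ℂ m * ExteriorAlgebra.ι ℂ m' * s) ∈ halfSpin (j + 1) := by
    intro s j h hs m m'
    have e1 : CliffordAlgebra.contractLeft (Q := (0 : QuadraticForm ℂ E7)) d
        (ExteriorAlgebra.ι ℂ m * ExteriorAlgebra.ι ℂ m' * s) =
        d m • (ExteriorAlgebra.ι ℂ m' * s) - ExteriorAlgebra.ι ℂ m * (d m' • s -
          ExteriorAlgebra.ι ℂ m' *
            CliffordAlgebra.contractLeft (Q := (0 : QuadraticForm ℂ E7)) d s) := by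
      rw [mul_assoc]
      exact (CliffordAlgebra.contractLeft_ι_mul _ _ _).trans
        (congrArg (fun t => d m • (ExteriorAlgebra.ι ℂ m' * s) - ExteriorAlgebra.ι ℂ m * t)
          (CliffordAlgebra.contractLeft_ι_mul _ _ _))
    rw [e1]
    refine sub_mem (Submodule.smul_mem _ _ (ι_mul_mem _ hs)) (ι_mul_mem _ (sub_mem
      (Submodule.smul_mem _ _ hs) ?_))
    have := ι_mul_mem m' h
    rwa [two] at this
  have hi : i = 0 ∨ i = 1 := (by decide : ∀ j : ZMod 2, j = 0 ∨ j = 1) i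
  rcases hi with rfl | rfl
  · induction s, hs using CliffordAlgebra.even_induction with
    | algebraMap r => rw [CliffordAlgebra.contractLeft_algebraMap]; exact zero_mem _
    | add x y hx hy h1 h2 => rw [map_add]; exact add_mem h1 h2
    | ι_mul_ι_mul m m' x hx h => exact ind x 0 h hx m m'
  · induction s, hs using CliffordAlgebra.odd_induction with
    | ι v =>
      rw [CliffordAlgebra.contractLeft_ι]
      exact SetLike.algebraMap_mem_graded (CliffordAlgebra.evenOdd (0 : QuadraticForm ℂ E7)) _
    | add x y hx hy h1 h2 => rw [map_add]; exact add_mem h1 h2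
    | ι_mul_ι_mul m m' x hx h => exact ind x 1 h hx m m'

theorem cliff_mem (v : V14) {i : ZMod 2} {s : Spinors} (hs : s ∈ halfSpin i) :
    cliff v s ∈ halfSpin (i + 1) := by
  rw [cliff_apply]
  exact add_mem (ι_mul_mem _ hs) (Submodule.smul_mem _ _ (contract_mem _ hs))

theorem cliffordRep_mem {x : CliffordAlgebra Q} (hx : x ∈ CliffordAlgebra.even Q)
    {s : Spinors} (hs : s ∈ halfSpin 0) : cliffordRep x s ∈ halfSpin 0 := by
  have two : (0 : ZMod 2) + 1 + 1 = 0 := by decide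
  replace hx : x ∈ CliffordAlgebra.evenOdd Q 0 := hx
  induction x, hx using CliffordAlgebra.even_induction with
  | algebraMap r =>
    rw [AlgHom.commutes, Module.algebraMap_end_apply]
    exact Submodule.smul_mem _ _ hs
  | add x y hx hy h1 h2 =>
    rw [map_add, LinearMap.add_apply]
    exact add_mem h1 h2
  | ι_mul_ι_mul m m' x hx h =>
    rw [map_mul, map_mul, Module.End.mul_apply, Module.End.mul_apply, cliffordRep,
      CliffordAlgebra.lift_ι_apply, CliffordAlgebra.lift_ι_apply]
    have := cliff_mem m (cliff_mem m' h)
    rwa [two] at this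

/-- The group `Spin₁₄`: products of an even number of vectors in the Clifford algebra, of
spinor norm one. -/
abbrev Spin14Group : Type := spinGroup Q

/-- The half-spin representation of `Spin₁₄` on `Δ₁₄`. -/
def spinRep : Representation ℂ Spin14Group Delta14 where
  toFun g := (cliffordRep (g : CliffordAlgebra Q)).restrict
    fun _ hs => cliffordRep_mem (spinGroup.mem_even g.2) hs
  map_one' := by
    ext s
    simp
  map_mul' g h := by
    ext s
    simp

/-- The image `g · W` of a subspace `W` of `V₁₄` under the vector representation
`v ↦ g v g⁻¹` of `Spin₁₄`. -/
def moveSubspace (g : Spin14Group) (W : Submodule ℂ V14) : Submodule ℂ V14 :=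
  ((W.map (CliffordAlgebra.ι Q)).map
    (LinearMap.mulLeftRight ℂ ((g : CliffordAlgebra Q), ((g⁻¹ : Spin14Group) : CliffordAlgebra Q)))).comap
      (CliffordAlgebra.ι Q)

/-! ### Zariski open sets, orbits and invariants -/

/-- The polynomial functions on a complex vector space: the algebra generated by the linear
forms. -/
def polyFun (W : Type) [AddCommGroup W] [Module ℂ W] : Subalgebra ℂ (W → ℂ) :=
  Algebra.adjoin ℂ (Set.range fun (l : Module.Dual ℂ W) (x : W) => l x)

/-- Zariski open subsets of a complex vector space: complements of common zero sets of
polynomial functions. -/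
def IsZariskiOpen {W : Type} [AddCommGroup W] [Module ℂ W] (U : Set W) : Prop :=
  ∃ I : Set (W → ℂ), (∀ f ∈ I, f ∈ polyFun W) ∧ U = {x | ∃ f ∈ I, f x ≠ 0}

/-- The cone in `Δ₁₄` over the `Spin₁₄`-orbit of `[z]` in `ℙ(Δ₁₄)` (with its vertex removed). -/
def orbitCone (z : Delta14) : Set Delta14 :=
  {w | ∃ c : ℂ, c ≠ 0 ∧ ∃ g : Spin14Group, w = c • spinRep g z}

/-- `[z]` belongs to the open orbit of `Spin₁₄` in `ℙ(Δ₁₄)`: a subset of `ℙ(Δ₁₄)` is Zariski open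
if and only if its cone is. -/
def InOpenOrbit (z : Delta14) : Prop :=
  z ≠ 0 ∧ IsZariskiOpen (orbitCone z)

/-- `[z]` belongs to the open orbit of `Spin₁₄` in the hypersurface `(J = 0)` of `ℙ(Δ₁₄)`. -/
def InOpenOrbitOfHypersurface (J : Delta14 → ℂ) (z : Delta14) : Prop :=
  z ≠ 0 ∧ J z = 0 ∧ ∃ U : Set Delta14, IsZariskiOpen U ∧ orbitCone z = U ∩ {w | J w = 0}

/-- `Spin₁₄`-invariant homogeneous polynomials of degree eight on `Δ₁₄`. -/
structure IsInvariantOctic (J : Delta14 → ℂ) : Prop where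
  polynomial : J ∈ polyFun Delta14
  homogeneous : ∀ (c : ℂ) (z : Delta14), J (c • z) = c ^ 8 * J z
  invariant : ∀ (g : Spin14Group) (z : Delta14), J (spinRep g z) = J z

/-! ### The three-form `Ω_z` -/

/-- The coefficient of `e_1 ∧ ⋯ ∧ e_7`. -/
def topCoeff : Spinors →ₗ[ℂ] ℂ :=
  ExteriorAlgebra.liftAlternating
    (Pi.single (M := fun i : ℕ => E7 [⋀^Fin i]→ₗ[ℂ] ℂ) 7 Matrix.detRowAlternating)

/-- The invariant pairing of spinors: the top degree coefficient of `sᵗ ∧ t`, where `sᵗ` is the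
reversal, acting by `(-1)^(p(p-1)/2)` in degree `p`. It makes `∧⁻E` the dual of `Δ₁₄`. -/
def pairing (s t : Spinors) : ℂ :=
  topCoeff (CliffordAlgebra.reverse (Q := (0 : QuadraticForm ℂ E7)) s * t)

/-- `Ω_z = ∑_{i<j<k} ⟨z, v_i v_j v_k z⟩ w_i ∧ w_j ∧ w_k`. -/
def Omega (z : Delta14) : ⋀[ℂ]^3 V14 :=
  ∑ i, ∑ j ∈ Finset.Ioi i, ∑ k ∈ Finset.Ioi j,
    pairing z (cliff (vBasis i) (cliff (vBasis j) (cliff (vBasis k) z))) •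
      exteriorPower.ιMulti ℂ 3 ![wBasis i, wBasis j, wBasis k]

/-- A three-form on `V` is generic if its orbit under `GL(V)` is Zariski open. -/
def IsGeneric {V : Type} [AddCommGroup V] [Module ℂ V] (ω : ⋀[ℂ]^3 V) : Prop :=
  IsZariskiOpen {η : ⋀[ℂ]^3 V | ∃ g : V ≃ₗ[ℂ] V, η = exteriorPower.map 3 (g : V →ₗ[ℂ] V) ω}

/-- `∧²V ∧ V₁₄` inside `∧³V₁₄`. -/
def wedgeTwoWedge (V : Submodule ℂ V14) : Submodule ℂ (⋀[ℂ]^3 V14) :=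
  Submodule.span ℂ {ω | ∃ a ∈ V, ∃ b ∈ V, ∃ c : V14, ω = exteriorPower.ιMulti ℂ 3 ![a, b, c]}

/-! ### The endomorphism `M_z` -/

/-- The form induced by `q` on `∧²V₁₄`:
`q₂(u₁ ∧ u₂, v₁ ∧ v₂) = det (q(u_i, v_j))`. -/
def q2 : ⋀[ℂ]^2 V14 →ₗ[ℂ] Module.Dual ℂ (⋀[ℂ]^2 V14) :=
  exteriorPower.pairingDual ℂ V14 2 ∘ₗ exteriorPower.map 2 q

/-- The wedge product of two vectors. -/
def wedge2 (a b : V14) : ⋀[ℂ]^2 V14 := exteriorPower.ιMulti ℂ 2 ![a, b]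

theorem update_zero (x b a : V14) : Function.update ![x, b] 0 a = ![a, b] := by
  ext i : 1
  fin_cases i <;> simp

theorem update_one (x b a : V14) : Function.update ![a, x] 1 b = ![a, b] := by
  ext i : 1
  fin_cases i <;> simp

theorem wedge2_add_left (a a' b : V14) : wedge2 (a + a') b = wedge2 a b + wedge2 a' b := by
  have h := (exteriorPower.ιMulti ℂ 2).map_update_add ![0, b] 0 a a'
  rwa [update_zero, update_zero, update_zero] at h

theorem wedge2_smul_left (c : ℂ) (a b : V14) : wedge2 (c • a) b = c • wedge2 a b := by
  have h := (exteriorPower.ιMulti ℂ 2).map_update_smul ![0, b] 0 c a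
  rwa [update_zero, update_zero] at h

theorem wedge2_self (a : V14) : wedge2 a a = 0 :=
  (exteriorPower.ιMulti ℂ 2).map_eq_zero_of_eq ![a, a] (i := 0) (j := 1) rfl (by decide)

theorem wedge2_add_right (a b b' : V14) : wedge2 a (b + b') = wedge2 a b + wedge2 a b' := by
  have h := (exteriorPower.ιMulti ℂ 2).map_update_add ![a, 0] 1 b b'
  rwa [update_one, update_one, update_one] at h

theorem wedge2_smul_right (c : ℂ) (a b : V14) : wedge2 a (c • b) = c • wedge2 a b := by
  have h := (exteriorPower.ιMulti ℂ 2).map_update_smul ![a, 0] 1 c b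
  rwa [update_one, update_one] at h

theorem wedge2_swap (a b : V14) : wedge2 b a = -wedge2 a b := by
  have h := wedge2_self (a + b)
  rw [wedge2_add_left, wedge2_add_right, wedge2_add_right, wedge2_self, wedge2_self, zero_add,
    add_zero] at h
  exact eq_neg_of_add_eq_zero_right h

/-- The trilinear map `(a, b, c) ↦ a ⊗ (b ∧ c) + b ⊗ (c ∧ a) + c ⊗ (a ∧ b)`. -/
def polarAlt : V14 [⋀^Fin 3]→ₗ[ℂ] V14 ⊗[ℂ] ⋀[ℂ]^2 V14 where
  toFun v := v 0 ⊗ₜ wedge2 (v 1) (v 2) + v 1 ⊗ₜ wedge2 (v 2) (v 0) + v 2 ⊗ₜ wedge2 (v 0) (v 1)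
  map_update_add' := by
    intro inst v i x y
    obtain rfl : inst = instDecidableEqFin 3 := Subsingleton.elim _ _
    fin_cases i <;>
      simp [wedge2_add_left, wedge2_add_right, TensorProduct.add_tmul, TensorProduct.tmul_add] <;>
      abel
  map_update_smul' := by
    intro inst v i c x
    obtain rfl : inst = instDecidableEqFin 3 := Subsingleton.elim _ _
    fin_cases i <;>
      simp [wedge2_smul_left, wedge2_smul_right, TensorProduct.smul_tmul']
  map_eq_zero_of_eq' := by
    intro v i j h hij
    have h01 : v 0 = v 1 ∨ v 1 = v 2 ∨ v 2 = v 0 := by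
      fin_cases i <;> fin_cases j <;> simp_all
    rcases h01 with h | h | h
    · rw [h, wedge2_self, TensorProduct.tmul_zero, add_zero, wedge2_swap (v 1) (v 2),
        TensorProduct.tmul_neg, add_neg_cancel]
    · rw [h, wedge2_self, TensorProduct.tmul_zero, zero_add, wedge2_swap (v 0) (v 2),
        TensorProduct.tmul_neg, neg_add_cancel]
    · rw [h, wedge2_self, TensorProduct.tmul_zero, add_zero, wedge2_swap (v 0) (v 1),
        TensorProduct.tmul_neg, neg_add_cancel]

/-- The embedding `∧³V₁₄ → V₁₄ ⊗ ∧²V₁₄`,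
`a ∧ b ∧ c ↦ a ⊗ (b ∧ c) + b ⊗ (c ∧ a) + c ⊗ (a ∧ b)`. -/
def polar : ⋀[ℂ]^3 V14 →ₗ[ℂ] V14 ⊗[ℂ] ⋀[ℂ]^2 V14 :=
  exteriorPower.alternatingMapLinearEquiv polarAlt

/-- `V₁₄ ⊗ V₁₄ → End(V₁₄)`: the tensor `a ⊗ b` is the endomorphism `x ↦ q(a, x) b`. -/
def toEnd : V14 ⊗[ℂ] V14 →ₗ[ℂ] Module.End ℂ V14 :=
  dualTensorHom ℂ V14 V14 ∘ₗ TensorProduct.map q LinearMap.id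

/-- The contraction `(V₁₄ ⊗ ∧²V₁₄) ⊗ (V₁₄ ⊗ ∧²V₁₄) → V₁₄ ⊗ V₁₄`,
`(a ⊗ α) ⊗ (b ⊗ β) ↦ q₂(α, β) a ⊗ b`. -/
def contract :
    (V14 ⊗[ℂ] ⋀[ℂ]^2 V14) ⊗[ℂ] (V14 ⊗[ℂ] ⋀[ℂ]^2 V14) →ₗ[ℂ] V14 ⊗[ℂ] V14 :=
  (TensorProduct.rid ℂ (V14 ⊗[ℂ] V14)).toLinearMap ∘ₗ
    TensorProduct.map LinearMap.id (TensorProduct.lift q2) ∘ₗ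
      (TensorProduct.tensorTensorTensorComm ℂ V14 (⋀[ℂ]^2 V14) V14 (⋀[ℂ]^2 V14)).toLinearMap

/-- The quadratic map `Θ : ∧³V₁₄ → End(V₁₄)`. -/
def Theta (ω : ⋀[ℂ]^3 V14) : Module.End ℂ V14 :=
  toEnd (contract (polar ω ⊗ₜ polar ω))

/-- `M_z = Θ(Ω_z)`. -/
def M (z : Delta14) : Module.End ℂ V14 := Theta (Omega z)

/-! ### The subspaces associated with `[z]` -/

/-- `(V, V')` is, up to order, the pair of subspaces associated with a point `[z]` of the open
orbit: an orthogonal decomposition `V₁₄ = V ⊕ V'` into seven-dimensional (hence non-degenerate)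
subspaces, preserved (as an unordered pair) by the stabilizer of `[z]` in `Spin₁₄`. -/
structure IsAssociatedPair (z : Delta14) (V V' : Submodule ℂ V14) : Prop where
  finrank_left : Module.finrank ℂ V = 7
  finrank_right : Module.finrank ℂ V' = 7
  isCompl : IsCompl V V'
  orthogonal : ∀ x ∈ V, ∀ y ∈ V', q x y = 0
  stable : ∀ g : Spin14Group, (∃ c : ℂ, spinRep g z = c • z) →
    (moveSubspace g V = V ∧ moveSubspace g V' = V') ∨
      (moveSubspace g V = V' ∧ moveSubspace g V' = V)

/-- `V` is the maximal isotropic subspace associated with a smooth point `[z]` of the hypersurface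
`(J = 0)`: the differential of `J` at `z`, a point `δ` of the dual `∧⁻E` of `Δ₁₄`, is a pure
spinor, and `V` is the maximal isotropic subspace annihilating it. -/
structure IsAssociatedIsotropic (J : Delta14 → ℂ) (z : Delta14) (V : Submodule ℂ V14) : Prop where
  finrank : Module.finrank ℂ V = 7
  isotropic : ∀ x ∈ V, ∀ y ∈ V, q x y = 0
  tangent : ∃ δ ∈ halfSpin 1, δ ≠ 0 ∧
    (∀ w : Delta14, deriv (fun t : ℂ => J (z + t • w)) 0 = pairing w δ) ∧
    ∀ v ∈ V, cliff v δ = 0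

end Spin14

end

open scoped TensorProduct
noncomputable section
namespace Spin14

/-! ### Polynomial functions in coordinates -/

section PolyFun

variable {W : Type} [AddCommGroup W] [Module ℂ W] {ι : Type}

/-! The invariant is `octic`, the trace of `M z * M z` divided by 14. `Omega`, `M` and the pairing
are equivariant, so each statement is checked at one spinor and transported along its orbit. Index
the basis of E by ℤ/7 and take {i, i+1, i+3} as the lines of the Fano plane: `fanoSpinor a` is the
scalar a plus the seven monomials of the complements of lines. The value a = 4 serves the open
orbit, a = 0 the hypersurface.

At a = 4, M is 384 times the exchange of E and F. Its eigenspaces are the graphs of ±id, and Ω is 4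
times the standard generic three-form on one graph minus 4 times that form on the other. At a = 0, M
is (x, y) ↦ 384 (y, 0), whose image and kernel are both E.

Orbits are compared through tangent lines. A polynomial vanishes identically if it vanishes on a
nonempty set that contains, at each of its points, germs of lines in spanning directions
(`eq_zero_of_forall_mem`). The products of two vectors take `fanoSpinor 4` to all of Δ₁₄
(`tangentSpace_fanoSpinor_four`). Hence a Zariski open orbit cannot avoid the orbit of `fanoSpinor
4`, and an invariant octic is determined by its value there.

The stabilizer of `[fanoSpinor 4]` preserves the pair of graphs because it multiplies M by c⁴ with
c⁸ = 1. Conversely, some products of four orthogonal vectors of the first graph have `fanoSpinor 4`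
as an eigenvector and act on V₁₄ by x ↦ x − 2·proj. They stabilize each member of any associated
pair, and six of them act irreducibly enough on the graph to force the pair
(`IsAssociatedPair.eq_range_graphMap`). Genericity of the three-form follows from a tangent
computation and Chevalley's theorem (`isGeneric_fanoForm`).

On the hypersurface, the tangent space to the orbit of `fanoSpinor 0` is the kernel of the
differential of the octic. A polynomial vanishing on that orbit is divisible by the octic: otherwise
elimination of one variable would give a nonzero polynomial vanishing on a cylinder over the orbit
(`dvd_of_forall_mem`). This needs `irreducible_octic`. A factor of the octic is constant on the
lines traced by unipotent elements, hence is also unchanged by the tori which these generate; a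
torus element scaling `fanoSpinor 4` by an eighth root of unity then shows that the factor has
degree 0 or 8 along the line of `fanoSpinor 4`. Finally the octic equals 36864 t at `fanoSpinor 0`
plus the scalar t, so its differential at `fanoSpinor 0` is the pairing with a multiple of the
generator of ∧⁷E, which is annihilated exactly by E.

The finite verifications are done over ℤ in the monomial basis, indexed by bitmasks, and evaluated
by the kernel. -/

theorem linear_mem_polyFun (l : Module.Dual ℂ W) : (fun x => l x) ∈ polyFun W :=
  Algebra.subset_adjoin ⟨l, rfl⟩

theorem eval_mem_polyFun (b : Module.Basis ι ℂ W) (p : MvPolynomial ι ℂ) :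
    (fun x => MvPolynomial.eval (b.repr x) p) ∈ polyFun W := by
  induction p using MvPolynomial.induction_on with
  | C a =>
    simp only [MvPolynomial.eval_C]
    exact (polyFun W).algebraMap_mem a
  | add p q hp hq =>
    simp only [map_add]
    exact (polyFun W).add_mem hp hq
  | mul_X p i hp =>
    simp only [map_mul, MvPolynomial.eval_X]
    exact (polyFun W).mul_mem hp (linear_mem_polyFun (b.coord i))

theorem exists_eval_of_mem_polyFun [Fintype ι] (b : Module.Basis ι ℂ W) {f : W → ℂ} (hf : f ∈ polyFun W) :
    ∃ p : MvPolynomial ι ℂ, ∀ x, f x = MvPolynomial.eval (b.repr x) p := by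
  induction hf using Algebra.adjoin_induction with
  | mem f h =>
    obtain ⟨l, rfl⟩ := h
    refine ⟨∑ i, MvPolynomial.C (l (b i)) * MvPolynomial.X i, fun x => ?_⟩
    simp only [map_sum, map_mul, MvPolynomial.eval_C, MvPolynomial.eval_X]
    conv_lhs => rw [← b.sum_repr x, map_sum]
    exact Finset.sum_congr rfl fun i _ => by rw [map_smul, smul_eq_mul, mul_comm]
  | algebraMap r => exact ⟨MvPolynomial.C r, fun x => by simp⟩
  | add f g _ _ hf hg =>
    obtain ⟨p, hp⟩ := hf
    obtain ⟨r, hr⟩ := hg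
    exact ⟨p + r, fun x => by simp [hp, hr]⟩
  | mul f g _ _ hf hg =>
    obtain ⟨p, hp⟩ := hf
    obtain ⟨r, hr⟩ := hg
    exact ⟨p * r, fun x => by simp [hp, hr]⟩

theorem polyFun_comp {W' : Type} [AddCommGroup W'] [Module ℂ W'] {f : W → ℂ} (hf : f ∈ polyFun W)
    (L : W' →ₗ[ℂ] W) : (fun x => f (L x)) ∈ polyFun W' := by
  induction hf using Algebra.adjoin_induction with
  | mem f h =>
    obtain ⟨l, rfl⟩ := h
    exact linear_mem_polyFun (l ∘ₗ L)
  | algebraMap r => exact (polyFun W').algebraMap_mem r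
  | add f g _ _ hf hg => exact (polyFun W').add_mem hf hg
  | mul f g _ _ hf hg => exact (polyFun W').mul_mem hf hg

/-- The bridge between analysis and algebra: derivatives along lines are computed by the formal
gradient, so a line germ inside a zero set gives a linear relation between partial derivatives. -/
theorem hasDerivAt_eval_line [Fintype ι] (p : MvPolynomial ι ℂ) (x w : ι → ℂ) :
    HasDerivAt (fun t : ℂ => MvPolynomial.eval (x + t • w) p)
      (∑ i, w i * MvPolynomial.eval x (MvPolynomial.pderiv i p)) 0 := by
  classical
  induction p using MvPolynomial.induction_on with
  | C a => simpa using hasDerivAt_const (0 : ℂ) a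
  | add p q hp hq =>
    simp only [map_add, mul_add, Finset.sum_add_distrib]
    exact hp.add hq
  | mul_X p j hp =>
    have h1 : HasDerivAt (fun t : ℂ => x j + t * w j) (w j) 0 := by
      simpa using ((hasDerivAt_id (0 : ℂ)).mul_const (w j)).const_add (x j)
    have h2 := hp.mul h1
    have h3 : (fun t : ℂ => MvPolynomial.eval (x + t • w) (p * MvPolynomial.X j)) =
        (fun t : ℂ => MvPolynomial.eval (x + t • w) p) * fun t : ℂ => x j + t * w j := by
      ext t
      simp
    rw [h3]
    refine h2.congr_deriv ?_
    simp only [MvPolynomial.pderiv_mul, map_add, map_mul, MvPolynomial.eval_X, zero_smul, add_zero,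
      zero_mul, mul_add, Finset.sum_add_distrib, Finset.sum_mul, MvPolynomial.pderiv_X]
    congr 1
    · exact Finset.sum_congr rfl fun i _ => by ring
    · rw [Finset.sum_eq_single j]
      · simp [mul_comm]
      · intro i _ hi
        simp [Pi.single_eq_of_ne' hi]
      · simp

theorem totalDegree_pderiv_lt {p : MvPolynomial ι ℂ} {n : ℕ} (hp : p.totalDegree ≤ n + 1) (i : ι) :
    (MvPolynomial.pderiv i p).totalDegree ≤ n := by
  classical
  rw [MvPolynomial.totalDegree]
  refine Finset.sup_le fun m hm => ?_
  rw [MvPolynomial.mem_support_iff, MvPolynomial.coeff_pderiv] at hm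
  have h := (MvPolynomial.le_totalDegree (MvPolynomial.mem_support_iff.mpr
    (left_ne_zero_of_mul hm))).trans hp
  rw [Finsupp.sum_add_index' (by simp) (by simp)] at h
  simpa using h

/-- Characteristic zero enters here: a coefficient reappears in a partial derivative multiplied by a
nonzero exponent. -/
theorem eq_C_of_pderiv_eq_zero {p : MvPolynomial ι ℂ}
    (hp : ∀ i, MvPolynomial.pderiv i p = 0) : p = MvPolynomial.C (p.coeff 0) := by
  classical
  ext m
  rw [MvPolynomial.coeff_C]
  split_ifs with h
  · rw [h]
  · obtain ⟨i, hi⟩ : ∃ i, m i ≠ 0 := by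
      by_contra! hc
      exact h (Finsupp.ext fun i => (hc i).symm)
    have h1 := congrArg (MvPolynomial.coeff (m - Finsupp.single i 1)) (hp i)
    rw [MvPolynomial.coeff_pderiv, tsub_add_cancel_of_le, MvPolynomial.coeff_zero] at h1
    · exact (mul_eq_zero.mp h1).resolve_right (Nat.cast_add_one_ne_zero _)
    · simpa [Finsupp.single_le_iff] using Nat.one_le_iff_ne_zero.mpr hi

/-! ### Vanishing of polynomials along tangent lines -/

open Topology Filter

/-- The directions in which a line through `z` stays in `O` near `z`. -/
def lineDirections (O : Set W) (z : W) : Set W := {w | ∀ᶠ t in 𝓝 (0 : ℂ), z + t • w ∈ O}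

/-- The derivative of a polynomial function along lines through a point is linear in the
direction. -/
theorem exists_differential [Module.Finite ℂ W] {f : W → ℂ} (hf : f ∈ polyFun W) (z : W) :
    ∃ l : Module.Dual ℂ W, ∀ w, HasDerivAt (fun t : ℂ => f (z + t • w)) (l w) 0 := by
  let b := Module.finBasis ℂ W
  obtain ⟨p, hp⟩ := exists_eval_of_mem_polyFun b hf
  refine ⟨∑ i, MvPolynomial.eval (b.repr z) (MvPolynomial.pderiv i p) • b.coord i, fun w => ?_⟩
  convert hasDerivAt_eval_line p (b.repr z) (b.repr w) using 1
  · ext t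
    rw [hp]
    simp
  · simp [mul_comm]

/-- A polynomial function vanishing on a set in which every point lies on enough line segments is
zero. -/
theorem eq_zero_of_forall_mem [Fintype ι] (b : Module.Basis ι ℂ W) {O : Set W} (hO : O.Nonempty)
    (hspan : ∀ z ∈ O, Submodule.span ℂ (lineDirections O z) = ⊤) (p : MvPolynomial ι ℂ)
    (hp : ∀ z ∈ O, MvPolynomial.eval (b.repr z) p = 0) : p = 0 := by
  classical
  have key : ∀ (n : ℕ) (p : MvPolynomial ι ℂ), p.totalDegree ≤ n →
      (∀ z ∈ O, MvPolynomial.eval (b.repr z) p = 0) → p = 0 := by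
    have const : ∀ a : ℂ, (∀ z ∈ O, MvPolynomial.eval (b.repr z)
        (MvPolynomial.C a : MvPolynomial ι ℂ) = 0) → (MvPolynomial.C a : MvPolynomial ι ℂ) = 0 := by
      intro a ha
      obtain ⟨z, hz⟩ := hO
      have := ha z hz
      rw [MvPolynomial.eval_C] at this
      rw [this, map_zero]
    intro n
    induction n with
    | zero =>
      intro p h1 h2
      rw [(MvPolynomial.totalDegree_eq_zero_iff_eq_C (p := p)).mp (Nat.le_zero.mp h1)] at h2 ⊢
      exact const _ h2
    | succ n ih =>
      intro p h1 h2
      -- At a point of `O` the gradient of `p` kills every direction of a line germ contained in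
      -- `O`, and these span. So all partial derivatives vanish on `O`, and they have smaller
      -- degree.
      have h3 : ∀ i, MvPolynomial.pderiv i p = 0 := by
        intro i
        refine ih _ (totalDegree_pderiv_lt h1 i) fun z hz => ?_
        let l : Module.Dual ℂ W :=
          ∑ j, MvPolynomial.eval (b.repr z) (MvPolynomial.pderiv j p) • b.coord j
        have hl : l = 0 := by
          refine LinearMap.ext_on (hspan z hz) fun w hw => ?_
          have d1 := hasDerivAt_eval_line p (b.repr z) (b.repr w)
          have d2 : (fun t : ℂ => MvPolynomial.eval (⇑(b.repr z) + t • ⇑(b.repr w)) p)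
              =ᶠ[𝓝 0] fun _ => 0 := by
            filter_upwards [hw] with t ht
            have := h2 _ ht
            simpa using this
          have d3 := d1.unique ((hasDerivAt_const (0 : ℂ) (0 : ℂ)).congr_of_eventuallyEq d2)
          simpa [l, mul_comm] using d3
        have := LinearMap.congr_fun hl (b i)
        simpa [l, Finsupp.single_apply] using this
      rw [eq_C_of_pderiv_eq_zero h3] at h2 ⊢
      exact const _ h2
  exact key _ p le_rfl hp

theorem polyFun_eq_zero [Module.Finite ℂ W] {O : Set W} (hO : O.Nonempty)
    (hspan : ∀ z ∈ O, Submodule.span ℂ (lineDirections O z) = ⊤) {f : W → ℂ} (hf : f ∈ polyFun W)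
    (h : ∀ z ∈ O, f z = 0) : f = 0 := by
  obtain ⟨p, hp⟩ := exists_eval_of_mem_polyFun (Module.finBasis ℂ W) hf
  have := eq_zero_of_forall_mem (Module.finBasis ℂ W) hO hspan p fun z hz => by rw [← hp, h z hz]
  ext x
  simp [hp, this]

/-- A map is polynomial if its composites with linear forms are. -/
def IsPolyMap {X : Type*} [AddCommGroup X] [Module ℂ X] (f : W → X) : Prop :=
  ∀ l : Module.Dual ℂ X, (fun x => l (f x)) ∈ polyFun W

/-! ### Polynomial maps with values in a vector space -/

section PolyMap

variable {X Y Z : Type*} [AddCommGroup X] [Module ℂ X] [AddCommGroup Y] [Module ℂ Y]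
  [AddCommGroup Z] [Module ℂ Z]

theorem isPolyMap_linear {X : Type*} [AddCommGroup X] [Module ℂ X] (L : W →ₗ[ℂ] X) :
    IsPolyMap (fun x => L x) := fun l => linear_mem_polyFun (LinearMap.comp (l : X →ₗ[ℂ] ℂ) L)

theorem IsPolyMap.comp_linear {f : W → X} (hf : IsPolyMap f) (L : X →ₗ[ℂ] Y) :
    IsPolyMap fun x => L (f x) := fun l => hf (LinearMap.comp (l : Y →ₗ[ℂ] ℂ) L)

theorem IsPolyMap.bilinear [Module.Finite ℂ X] [Module.Finite ℂ Y] {f : W → X} {g : W → Y}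
    (hf : IsPolyMap f) (hg : IsPolyMap g) (B : X →ₗ[ℂ] Y →ₗ[ℂ] Z) :
    IsPolyMap fun x => B (f x) (g x) := by
  intro l
  let b := Module.finBasis ℂ X
  let c := Module.finBasis ℂ Y
  have : (fun x => l (B (f x) (g x))) =
      ∑ i, ∑ j, l (B (b i) (c j)) • ((fun x => b.coord i (f x)) * fun x => c.coord j (g x)) := by
    ext x
    conv_lhs => rw [← b.sum_repr (f x), ← c.sum_repr (g x)]
    simp only [map_sum, LinearMap.sum_apply, map_smul, LinearMap.smul_apply, smul_eq_mul,
      Finset.sum_apply, Pi.smul_apply, Pi.mul_apply, Module.Basis.coord_apply,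
      Finset.mul_sum]
    rw [Finset.sum_comm]
    refine Finset.sum_congr rfl fun i _ => ?_
    refine Finset.sum_congr rfl fun j _ => ?_
    ring
  rw [this]
  exact (polyFun W).sum_mem fun i _ => (polyFun W).sum_mem fun j _ =>
    (polyFun W).smul_mem ((polyFun W).mul_mem (hf _) (hg _)) _

theorem IsPolyMap.sum {κ : Type*} (s : Finset κ) {f : κ → W → X} (hf : ∀ i ∈ s, IsPolyMap (f i)) :
    IsPolyMap fun x => ∑ i ∈ s, f i x := by
  intro l
  have : (fun x => l (∑ i ∈ s, f i x)) = ∑ i ∈ s, fun x => l (f i x) := by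
    ext x
    simp
  rw [this]
  exact (polyFun W).sum_mem fun i hi => hf i hi l

end PolyMap

end PolyFun

end Spin14
end

open scoped TensorProduct
noncomputable section
namespace Spin14

/-! ### Elimination of a variable -/

/-- The constant is the resultant. By Gauss's lemma `p` stays irreducible over the fraction field
and still does not divide `f`, so the two are coprime there and the resultant does not vanish. -/
theorem exists_mul_add_mul_eq_C {R : Type} [CommRing R] [IsDomain R] [UniqueFactorizationMonoid R]
    {p f : Polynomial R} (hp : Irreducible p) (hdeg : p.natDegree ≠ 0) (hf : ¬p ∣ f) :
    ∃ a b : Polynomial R, ∃ r : R, r ≠ 0 ∧ p * a + f * b = Polynomial.C r := by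
  have := Classical.arbitrary (NormalizedGCDMonoid R)
  let K := FractionRing R
  have hprim := hp.isPrimitive hdeg
  have hirr := (hprim.irreducible_iff_irreducible_map_fraction_map (K := K)).mp hp
  have hdvd : ¬p.map (algebraMap R K) ∣ f.map (algebraMap R K) := fun h =>
    hf (hprim.dvd_of_fraction_map_dvd_fraction_map h)
  have hcop : IsCoprime (p.map (algebraMap R K)) (f.map (algebraMap R K)) :=
    (Irreducible.coprime_iff_not_dvd hirr).mpr hdvd
  obtain ⟨a, b, -, -, h⟩ := Polynomial.exists_mul_add_mul_eq_C_resultant p f le_rfl le_rfl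
    (Or.inl hdeg)
  refine ⟨a, b, _, fun h0 => Polynomial.resultant_ne_zero _ _ hcop ?_, h⟩
  have hinj : Function.Injective (algebraMap R K) := IsFractionRing.injective R K
  rw [Polynomial.natDegree_map_eq_of_injective hinj, Polynomial.natDegree_map_eq_of_injective hinj,
    Polynomial.resultant_map_map, h0, map_zero]

/-- Elimination of the variable `none`: multivariate polynomials are viewed as polynomials in that
variable alone, and the nonzero partial derivative says that `p` really involves it. -/
theorem exists_mul_add_mul_eq_rename {σ : Type} {p f : MvPolynomial (Option σ) ℂ}
    (hp : Irreducible p) (hdeg : MvPolynomial.pderiv none p ≠ 0) (hf : ¬p ∣ f) :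
    ∃ a b : MvPolynomial (Option σ) ℂ, ∃ r : MvPolynomial σ ℂ, r ≠ 0 ∧
      p * a + f * b = MvPolynomial.rename some r := by
  classical
  let e := MvPolynomial.optionEquivLeft ℂ σ
  have hC : ∀ r : MvPolynomial σ ℂ, e.symm (Polynomial.C r) = MvPolynomial.rename some r := by
    intro r
    rw [AlgEquiv.symm_apply_eq]
    induction r using MvPolynomial.induction_on with
    | C a => simp [e]
    | add p q hp hq => simp [hp, hq]
    | mul_X p i hp => simp [hp, e]
  obtain ⟨a, b, r, hr, h⟩ := exists_mul_add_mul_eq_C (p := e p) (f := e f)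
    ((MulEquiv.irreducible_iff e).mpr hp) (fun h0 => hdeg (by
      obtain ⟨r, hr⟩ := Polynomial.natDegree_eq_zero.mp h0
      have h1 : p = MvPolynomial.rename some r := by
        rw [← hC, hr, AlgEquiv.symm_apply_apply]
      rw [h1]
      refine MvPolynomial.pderiv_eq_zero_of_notMem_vars fun hmem => ?_
      obtain ⟨i, -, hi⟩ := Finset.mem_image.mp (MvPolynomial.vars_rename some r hmem)
      exact Option.some_ne_none i hi))
    (fun h => hf ((map_dvd_iff e).mp h))
  refine ⟨e.symm a, e.symm b, r, hr, ?_⟩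
  rw [← hC, ← h, map_add, map_mul, map_mul, AlgEquiv.symm_apply_apply, AlgEquiv.symm_apply_apply]

open Topology Filter

theorem continuousAt_eval_line {ι : Type} [Fintype ι] (p : MvPolynomial ι ℂ) (x w : ι → ℂ) :
    ContinuousAt (fun t : ℂ => MvPolynomial.eval (x + t • w) p) 0 :=
  (hasDerivAt_eval_line p x w).continuousAt

/-- A polynomial vanishing on a set which has codimension one (in the sense of tangent lines), and
on which the irreducible polynomial `p` vanishes, is divisible by `p`. -/
theorem dvd_of_forall_mem {σ W : Type} [Fintype σ] [AddCommGroup W] [Module ℂ W]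
    (b : Module.Basis (Option σ) ℂ W) {O : Set W} {p f : MvPolynomial (Option σ) ℂ}
    (hp : Irreducible p) (hpO : ∀ z ∈ O, MvPolynomial.eval (b.repr z) p = 0)
    (hO : ∃ z ∈ O, MvPolynomial.eval (b.repr z) (MvPolynomial.pderiv none p) ≠ 0)
    (hspan : ∀ z ∈ O, MvPolynomial.eval (b.repr z) (MvPolynomial.pderiv none p) ≠ 0 →
      Submodule.span ℂ (insert (b none) (lineDirections O z)) = ⊤)
    (hf : ∀ z ∈ O, MvPolynomial.eval (b.repr z) f = 0) : p ∣ f := by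
  by_contra hdvd
  obtain ⟨z₀, hz₀, hz₀'⟩ := hO
  obtain ⟨c, d, r, hr, h⟩ := exists_mul_add_mul_eq_rename hp
    (fun h0 => hz₀' (by rw [h0, map_zero])) hdvd
  refine hr (MvPolynomial.rename_injective _ (Option.some_injective σ) ?_)
  rw [map_zero]
  -- `r` vanishes on `O` because `p` and `f` do, hence on the cylinder over `O` in the direction `b
  -- none`, of which it does not depend. The cylinder has spanning tangent directions, so `r` would
  -- be zero. Only points where the derivative of `p` is nonzero are kept; this condition persists
  -- near such a point.
  refine eq_zero_of_forall_mem b (O := {x | ∃ z ∈ O, ∃ s : ℂ,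
    MvPolynomial.eval (b.repr z) (MvPolynomial.pderiv none p) ≠ 0 ∧ x = z + s • b none})
    ⟨z₀, z₀, hz₀, 0, hz₀', by simp⟩ ?_ _ ?_
  · rintro _ ⟨z, hz, s, hz', rfl⟩
    refine top_le_iff.mp ((hspan z hz hz').symm.le.trans (Submodule.span_mono ?_))
    rintro w (rfl | hw)
    · exact Eventually.of_forall fun t => ⟨z, hz, s + t, hz', by module⟩
    · have hc := continuousAt_eval_line (MvPolynomial.pderiv none p) (b.repr z) (b.repr w)
      have hc' := hc.eventually_ne (y := 0) (by simpa using hz')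
      filter_upwards [hw, hc'] with t ht ht'
      refine ⟨z + t • w, ht, s, ?_, by module⟩
      simpa using ht'
  · rintro _ ⟨z, hz, s, hz', rfl⟩
    have h1 := congrArg (MvPolynomial.eval (b.repr z)) h
    rw [map_add, map_mul, map_mul, hpO z hz, hf z hz, zero_mul, zero_mul, add_zero,
      MvPolynomial.eval_rename] at h1
    rw [MvPolynomial.eval_rename, h1]
    congr 2
    ext i
    simp

/-! ### The image of a dominant polynomial map -/

/-- The image of a dominant polynomial map, defined on a principal open set, contains a nonempty
principal open set. -/
theorem exists_forall_exists_eval_eq {σ τ : Type} [Finite σ] [Finite τ] (F : σ → MvPolynomial τ ℂ)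
    (D : MvPolynomial τ ℂ)
    (hdom : ∀ p : MvPolynomial σ ℂ, (∀ u : τ → ℂ, MvPolynomial.eval u D ≠ 0 →
      MvPolynomial.eval (fun s => MvPolynomial.eval u (F s)) p = 0) → p = 0) :
    ∃ h : MvPolynomial σ ℂ, h ≠ 0 ∧ ∀ x : σ → ℂ, MvPolynomial.eval x h ≠ 0 →
      ∃ u : τ → ℂ, MvPolynomial.eval u D ≠ 0 ∧ ∀ s, MvPolynomial.eval u (F s) = x s := by
  let φ : MvPolynomial σ ℂ →+* MvPolynomial τ ℂ := (MvPolynomial.aeval F).toRingHom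
  have hev : ∀ (u : τ → ℂ) (p : MvPolynomial σ ℂ), MvPolynomial.eval u (φ p) =
      MvPolynomial.eval (fun s => MvPolynomial.eval u (F s)) p := by
    intro u p
    induction p using MvPolynomial.induction_on with
    | C a => simp [φ]
    | add p q hp hq => simp only [map_add, hp, hq]
    | mul_X p i hp =>
      rw [map_mul, map_mul, hp, map_mul]
      simp [φ]
  have hD : D ≠ 0 := by
    rintro rfl
    exact one_ne_zero (hdom 1 fun u hu => absurd (map_zero _) hu)
  have hinj : Function.Injective φ := by
    rw [injective_iff_map_eq_zero]
    intro p hp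
    exact hdom p fun u _ => by rw [← hev, hp, map_zero]
  have hfin : φ.FinitePresentation := by
    rw [← RingHom.FinitePresentation.of_finiteType]
    refine RingHom.FiniteType.of_comp_finiteType (f := algebraMap ℂ (MvPolynomial σ ℂ)) ?_
    have : φ.comp (algebraMap ℂ (MvPolynomial σ ℂ)) = algebraMap ℂ (MvPolynomial τ ℂ) :=
      (MvPolynomial.aeval F).comp_algebraMap
    rw [this, RingHom.finiteType_algebraMap]
    infer_instance
  -- Chevalley's theorem for the comorphism `φ`. Dominance makes `φ` injective, so the constructible
  -- image of the open set `D ≠ 0` contains the generic point.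
  have hcons := PrimeSpectrum.isConstructible_comap_image hfin
    (s := (PrimeSpectrum.basicOpen D : Set (PrimeSpectrum (MvPolynomial τ ℂ))))
    ((PrimeSpectrum.isCompact_basicOpen D).isConstructible (PrimeSpectrum.basicOpen D).isOpen)
  obtain ⟨T, hT⟩ := PrimeSpectrum.exists_constructibleSetData_iff.mpr hcons
  have hbot : (⟨⊥, Ideal.isPrime_bot⟩ : PrimeSpectrum (MvPolynomial σ ℂ)) ∈ T.toSet := by
    rw [hT]
    refine ⟨⟨⊥, Ideal.isPrime_bot⟩, hD, ?_⟩
    ext x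
    simp [map_eq_zero_iff φ hinj]
  simp only [PrimeSpectrum.ConstructibleSetData.toSet,
    PrimeSpectrum.BasicConstructibleSetData.toSet, Set.mem_iUnion] at hbot
  obtain ⟨C, hC, hC1, hC2⟩ := hbot
  -- The piece containing the generic point has no closed condition, so it is the principal open set
  -- of `C.f`.
  have hg : ∀ i, C.g i = 0 := fun i => by simpa using hC1 (Set.mem_range_self i)
  refine ⟨C.f, fun h0 => hC2 (by simp [h0]), fun x hx => ?_⟩
  let m : PrimeSpectrum (MvPolynomial σ ℂ) :=
    ⟨RingHom.ker (MvPolynomial.eval x), RingHom.ker_isPrime _⟩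
  have hm : m ∈ T.toSet := by
    simp only [PrimeSpectrum.ConstructibleSetData.toSet,
      PrimeSpectrum.BasicConstructibleSetData.toSet, Set.mem_iUnion]
    refine ⟨C, hC, ?_, ?_⟩
    · rintro _ ⟨i, rfl⟩
      rw [hg]
      exact zero_mem m.asIdeal
    · intro h
      exact hx (h (Set.mem_singleton _))
  rw [hT] at hm
  obtain ⟨P, hPD, hP⟩ := hm
  -- The prime `P` over the point `x` need not be closed. In a Jacobson ring some maximal ideal
  -- contains `P` and avoids `D`; by the Nullstellensatz it is a point `u`, and it still lies over
  -- `x`.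
  have hjac : P.asIdeal.jacobson = P.asIdeal := IsJacobsonRing.out inferInstance P.isPrime.isRadical
  have hPD' : D ∉ P.asIdeal.jacobson := by
    rw [hjac]
    exact hPD
  simp only [Ideal.jacobson, Ideal.mem_sInf, not_forall] at hPD'
  obtain ⟨N, ⟨hPN, hN⟩, hDN⟩ := hPD'
  obtain ⟨u, rfl⟩ := MvPolynomial.isMaximal_iff_eq_vanishingIdeal_singleton.mp hN
  refine ⟨u, fun h0 => hDN ?_, fun s => ?_⟩
  · rw [MvPolynomial.mem_vanishingIdeal_singleton_iff]
    simpa using h0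
  · have h1 : MvPolynomial.X s - MvPolynomial.C (x s) ∈ (PrimeSpectrum.comap φ P).asIdeal := by
      rw [hP]
      simp [m, RingHom.mem_ker]
    have h2 := hPN h1
    rw [MvPolynomial.mem_vanishingIdeal_singleton_iff] at h2
    have h3 : MvPolynomial.eval u (φ (MvPolynomial.X s - MvPolynomial.C (x s))) = 0 := by
      simpa using h2
    rw [hev] at h3
    simpa [sub_eq_zero] using h3

end Spin14
end

open scoped TensorProduct Topology

noncomputable section

namespace Spin14

/-! ### Coordinates on `V₁₄` -/

/-- The coordinates of a vector in the basis `(e_1, …, e_7, f_1, …, f_7)`. -/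
def coordEquiv : V14 ≃ₗ[ℂ] (Fin 14 → ℂ) where
  toFun v := Fin.append v.1 v.2
  invFun c := (fun i => c (Fin.castAdd 7 i), fun i => c (Fin.natAdd 7 i))
  left_inv v := by
    ext i
    · simp only [Fin.append_left]
    · simp only [Fin.append_right]
  right_inv c := by
    ext m
    refine Fin.addCases (fun i => ?_) (fun i => ?_) m
    · simp only [Fin.append_left]
    · simp only [Fin.append_right]
  map_add' v w := by
    ext m
    refine Fin.addCases (m := 7) (n := 7) (fun i => ?_) (fun i => ?_) m
    · simp only [Pi.add_apply, Fin.append_left, Prod.fst_add]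
    · simp only [Pi.add_apply, Fin.append_right, Prod.snd_add]
  map_smul' c v := by
    ext m
    refine Fin.addCases (m := 7) (n := 7) (fun i => ?_) (fun i => ?_) m
    · simp only [Pi.smul_apply, Fin.append_left, Prod.smul_fst, RingHom.id_apply]
    · simp only [Pi.smul_apply, Fin.append_right, Prod.smul_snd, RingHom.id_apply]

theorem vBasis_castAdd (i : Fin 7) : vBasis (Fin.castAdd 7 i) = eVec i := Fin.append_left _ _ i

theorem vBasis_natAdd (i : Fin 7) : vBasis (Fin.natAdd 7 i) = fVec i := Fin.append_right _ _ i

theorem castAdd_ne_natAdd : ∀ i j : Fin 7, Fin.castAdd 7 i ≠ Fin.natAdd 7 j := by decide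

theorem castAdd_add_seven : ∀ i : Fin 7, Fin.castAdd 7 i + 7 = Fin.natAdd 7 i := by decide

theorem natAdd_add_seven : ∀ i : Fin 7, Fin.natAdd 7 i + 7 = Fin.castAdd 7 i := by decide

theorem castAdd_eq_iff : ∀ i j : Fin 7, Fin.castAdd 7 i = Fin.castAdd 7 j ↔ i = j := by decide

theorem natAdd_eq_iff : ∀ i j : Fin 7, Fin.natAdd 7 i = Fin.natAdd 7 j ↔ i = j := by decide

/-- `(e_1, …, e_7, f_1, …, f_7)` as a basis. -/
def vB : Module.Basis (Fin 14) ℂ V14 := Module.Basis.ofEquivFun coordEquiv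

theorem vB_apply (m : Fin 14) : vB m = vBasis m := by
  rw [vB, Module.Basis.coe_ofEquivFun, LinearEquiv.symm_apply_eq]
  ext k
  change _ = Fin.append (vBasis m).1 (vBasis m).2 k
  refine Fin.addCases (m := 7) (n := 7) (fun i => ?_) (fun i => ?_) m <;>
  refine Fin.addCases (m := 7) (n := 7) (fun j => ?_) (fun j => ?_) k <;>
  simp only [vBasis_castAdd, vBasis_natAdd, Fin.append_left, Fin.append_right, eVec, fVec,
    Pi.single_apply, castAdd_eq_iff, natAdd_eq_iff, castAdd_ne_natAdd,
    (castAdd_ne_natAdd _ _).symm, if_false, Pi.zero_apply]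

/-- In `Fin 14` the shift by 7 is the involution exchanging `e_i` and `f_i`, so duality becomes
index arithmetic. -/
theorem wBasis_eq (m : Fin 14) : wBasis m = vBasis (m + 7) := by
  fin_cases m <;> rfl

theorem q_apply (v w : V14) : q v w = v.1 ⬝ᵥ w.2 + v.2 ⬝ᵥ w.1 := rfl

theorem q_comm (v w : V14) : q v w = q w v := by
  rw [q_apply, q_apply, dotProduct_comm v.1, dotProduct_comm v.2, add_comm]

theorem Q_eq_q (v : V14) : Q v = q v v := rfl

theorem q_vBasis (m k : Fin 14) : q (vBasis m) (vBasis k) = if k = m + 7 then 1 else 0 := by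
  refine Fin.addCases (m := 7) (n := 7) (fun i => ?_) (fun i => ?_) m <;>
  refine Fin.addCases (m := 7) (n := 7) (fun j => ?_) (fun j => ?_) k <;>
  simp only [vBasis_castAdd, vBasis_natAdd, castAdd_add_seven, natAdd_add_seven, castAdd_eq_iff,
    natAdd_eq_iff, castAdd_ne_natAdd, (castAdd_ne_natAdd _ _).symm, if_false, q_apply, eVec, fVec,
    single_dotProduct, zero_dotProduct, dotProduct_zero, Pi.single_apply, one_mul, add_zero,
    zero_add, eq_comm]

theorem q_vBasis_eq_coord (m : Fin 14) (v : V14) : q (vBasis (m + 7)) v = vB.repr v m := by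
  conv_lhs => rw [← vB.sum_repr v]
  have h7 : ∀ a b : Fin 14, b = a + 7 + 7 ↔ b = a := by decide
  simp [vB_apply, q_vBasis, h7]

theorem eq_of_q_eq {v w : V14} (h : ∀ u, q u v = q u w) : v = w := by
  refine vB.ext_elem fun m => ?_
  rw [← q_vBasis_eq_coord, ← q_vBasis_eq_coord, h]

/-! ### Spinors in coordinates

A subset of `{0, …, 6}` is encoded by its bitmask, a number below `128`. -/

/-- The coordinate space of spinors. -/
abbrev Sp : Type := Fin 128 → ℂ

/-- The bitmask obtained by changing membership of `m` modulo `7`. -/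
def flipBit (m : Fin 14) (n : Fin 128) : Fin 128 :=
  ⟨Nat.xor n.val (Nat.pow 2 (Nat.mod m.val 7)), Nat.xor_lt_two_pow (n := 7) n.2
    (Nat.pow_lt_pow_right one_lt_two (Nat.mod_lt _ (by decide)))⟩

/-- The cardinality of the subset with the given bitmask. -/
def bitCount (n : ℕ) : ℕ :=
  (n.testBit 0).toNat + (n.testBit 1).toNat + (n.testBit 2).toNat + (n.testBit 3).toNat +
    (n.testBit 4).toNat + (n.testBit 5).toNat + (n.testBit 6).toNat

/-- The bits of a number. -/
def bitAt (k i : ℕ) : Bool := Nat.beq (Nat.land (Nat.shiftRight k i) 1) 1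

/-- The number whose bits are the parities of the cardinalities of subsets. -/
def parityMask : ℕ := 0x6996966996696996966969966996966996696996699696696996966996696996

/-- The sign of moving the basis vector `i` past the smaller elements of a subset. -/
def moveSign (i n : ℕ) : ℤ :=
  bif bitAt parityMask (Nat.mod n (Nat.pow 2 i)) then Int.negSucc 0 else Int.ofNat 1

/-- The matrix coefficients of the Clifford action of `vBasis m`. -/
def genCoeff (m : Fin 14) (n : Fin 128) : ℤ :=
  bif Nat.ble m.val 6 then
    bif bitAt n.val m.val then moveSign m.val n.val else Int.ofNat 0
  else
    bif bitAt n.val (Nat.sub m.val 7) then Int.ofNat 0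
      else Int.mul (Int.ofNat 2) (moveSign (Nat.sub m.val 7) n.val)

/-- The Clifford action of `vBasis m` in coordinates, with coefficients in any commutative ring. -/
def gen (R : Type) [CommRing R] (m : Fin 14) : Module.End R (Fin 128 → R) where
  toFun s n := genCoeff m n * s (flipBit m n)
  map_add' s t := by
    ext n
    simp [mul_add]
  map_smul' c s := by
    ext n
    simp [mul_left_comm]

theorem gen_apply (R : Type) [CommRing R] (m : Fin 14) (s : Fin 128 → R) (n : Fin 128) :
    gen R m s n = genCoeff m n * s (flipBit m n) := rfl

/-- The product of two integers, the second of which is not looked at if the first is zero. -/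
def skipMul (a b : ℤ) : ℤ :=
  match a with
  | Int.ofNat 0 => Int.ofNat 0
  | Int.ofNat (k + 1) => Int.mul (Int.ofNat (k + 1)) b
  | Int.negSucc k => Int.mul (Int.negSucc k) b

/-- Most products met below have a zero factor. Rewriting them with `skipMul` before a kernel
evaluation cuts off the computation of the other factor. -/
theorem skipMul_eq (a b : ℤ) : skipMul a b = a * b := by
  rcases a with (_ | k) | k
  · exact (zero_mul b).symm
  · rfl
  · rfl

/-- The Clifford action of `vBasis m` on integer coordinates. -/
def skipGen (m : Fin 14) (s : Fin 128 → ℤ) (n : Fin 128) : ℤ :=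
  skipMul (s (flipBit m n)) (genCoeff m n)

theorem gen_eq_skipGen (m : Fin 14) (s : Fin 128 → ℤ) : gen ℤ m s = skipGen m s := by
  ext n
  rw [skipGen, skipMul_eq, mul_comm]
  rfl

theorem gen_cast (m : Fin 14) (s : Fin 128 → ℤ) :
    gen ℂ m (fun n => (s n : ℂ)) = fun n => ((gen ℤ m s n : ℤ) : ℂ) := by
  ext n
  simp [gen_apply]

theorem flipBit_comm : ∀ (m k : Fin 14) (n : Fin 128),
    flipBit k (flipBit m n) = flipBit m (flipBit k n) :=
  fun _ _ _ => Fin.ext (Nat.xor_right_comm _ _ _)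

theorem flipBit_flipBit : ∀ (m : Fin 14) (n : Fin 128),
    flipBit (m + 7) (flipBit m n) = n := fun m n => Fin.ext <| by
  have h : ∀ m : Fin 14, Nat.mod (m + 7).val 7 = Nat.mod m.val 7 := by decide
  change (n.val ^^^ Nat.pow 2 (Nat.mod m.val 7)) ^^^ Nat.pow 2 (Nat.mod (m + 7).val 7) = n.val
  rw [h, Nat.xor_xor_cancel_right]

/-- The Clifford relations on basis vectors, reduced to a statement on signs. -/
theorem genCoeff_anticomm : ∀ (m k : Fin 14) (n : Fin 128),
    genCoeff m n * genCoeff k (flipBit m n) + genCoeff k n * genCoeff m (flipBit k n) =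
      if k = m + 7 then 2 else 0 := by decide +kernel

theorem gen_anticomm (m k : Fin 14) (s : Sp) :
    gen ℂ m (gen ℂ k s) + gen ℂ k (gen ℂ m s) = if k = m + 7 then (2 : ℂ) • s else 0 := by
  ext n
  have h : ((genCoeff m n * genCoeff k (flipBit m n) +
      genCoeff k n * genCoeff m (flipBit k n) : ℤ) : ℂ) = ((if k = m + 7 then 2 else 0 : ℤ) : ℂ) :=
    congrArg _ (genCoeff_anticomm m k n)
  push_cast at h
  rw [Pi.add_apply, gen_apply, gen_apply, gen_apply, gen_apply, flipBit_comm m k, ← mul_assoc,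
    ← mul_assoc, ← add_mul, h]
  split_ifs with hk
  · rw [← flipBit_comm m k, hk, flipBit_flipBit]
    simp
  · simp

/-- The Clifford action in coordinates. -/
def op : V14 →ₗ[ℂ] Module.End ℂ Sp := vB.constr ℂ (gen ℂ)

theorem op_vBasis (m : Fin 14) : op (vBasis m) = gen ℂ m := by
  rw [← vB_apply, op, Module.Basis.constr_basis]

theorem op_anticomm (v w : V14) (s : Sp) :
    op v (op w s) + op w (op v s) = (2 * q v w) • s := by
  let B₁ : V14 →ₗ[ℂ] V14 →ₗ[ℂ] Sp :=
    LinearMap.mk₂ ℂ (fun v w => op v (op w s) + op w (op v s))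
      (fun a b c => by simp only [map_add, LinearMap.add_apply]; abel)
      (fun a b c => by simp only [map_smul, LinearMap.smul_apply, smul_add])
      (fun a b c => by simp only [map_add, LinearMap.add_apply]; abel)
      (fun a b c => by simp only [map_smul, LinearMap.smul_apply, smul_add])
  let B₂ : V14 →ₗ[ℂ] V14 →ₗ[ℂ] Sp :=
    LinearMap.mk₂ ℂ (fun v w => (2 * q v w) • s)
      (fun a b c => by simp only [map_add, LinearMap.add_apply]; module)
      (fun a b c => by simp only [map_smul, LinearMap.smul_apply, smul_eq_mul]; module)
      (fun a b c => by simp only [map_add]; module)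
      (fun a b c => by simp only [map_smul, smul_eq_mul]; module)
  have h : B₁ = B₂ := by
    refine vB.ext fun m => vB.ext fun k => ?_
    simp only [B₁, B₂, LinearMap.mk₂_apply, vB_apply, op_vBasis, gen_anticomm, q_vBasis]
    split_ifs <;> simp
  exact LinearMap.congr_fun₂ h v w

theorem op_op (v : V14) (s : Sp) : op v (op v s) = Q v • s := by
  have h := op_anticomm v v s
  rw [← two_smul ℂ, mul_smul] at h
  exact smul_right_injective _ (two_ne_zero (α := ℂ)) h

/-- The coordinates of the spinor `1`. -/
def vacuum : Sp := Pi.single 0 1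

/-- Coordinates of spinors. -/
def coordMap : Spinors →ₗ[ℂ] Sp :=
  LinearMap.applyₗ vacuum ∘ₗ (ExteriorAlgebra.lift ℂ
    ⟨op ∘ₗ LinearMap.inl ℂ E7 E7, fun x => by
      refine LinearMap.ext fun s => ?_
      simp [op_op, Q_apply]⟩).toLinearMap

theorem coordMap_one : coordMap 1 = vacuum := by simp [coordMap]

theorem coordMap_ι_mul (x : E7) (s : Spinors) :
    coordMap (ExteriorAlgebra.ι ℂ x * s) = op (x, 0) (coordMap s) := by
  simp [coordMap]

theorem gen_f_vacuum : ∀ (i : Fin 7) (n : Fin 128),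
    gen ℤ (Fin.natAdd 7 i) (Pi.single 0 1) n = 0 := by decide +kernel

theorem vacuum_eq_cast : vacuum = fun n => (((Pi.single 0 1 : Fin 128 → ℤ) n : ℤ) : ℂ) := by
  ext n
  simp [vacuum, Pi.single_apply]

theorem op_f_vacuum (y : E7) : op (0, y) vacuum = 0 := by
  have h : (0, y) = ∑ i, y i • vBasis (Fin.natAdd 7 i) := by
    simp only [vBasis_natAdd, fVec]
    ext j
    · simp [Prod.fst_sum]
    · simp [Prod.snd_sum, Pi.single_apply]
  rw [h, map_sum, LinearMap.sum_apply]
  refine Finset.sum_eq_zero fun i _ => ?_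
  rw [map_smul, LinearMap.smul_apply, op_vBasis, vacuum_eq_cast, gen_cast]
  simp only [gen_f_vacuum, Int.cast_zero]
  exact smul_zero _

/-- Both operators annihilate scalars and satisfy the same anticommutation rule with multiplication
by a vector of E; this determines them by induction. -/
theorem coordMap_contract (y : E7) (s : Spinors) :
    (2 : ℂ) • coordMap (CliffordAlgebra.contractLeft (Q := (0 : QuadraticForm ℂ E7))
      (dualForm y) s) = op (0, y) (coordMap s) := by
  induction s using CliffordAlgebra.left_induction with
  | algebraMap r =>
    rw [CliffordAlgebra.contractLeft_algebraMap, map_zero, smul_zero, Algebra.algebraMap_eq_smul_one]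
    erw [map_smul, coordMap_one]
    rw [map_smul, op_f_vacuum, smul_zero]
  | add s t hs ht => simp only [map_add, smul_add, hs, ht]
  | ι_mul s x hs =>
    rw [CliffordAlgebra.contractLeft_ι_mul, map_sub, map_smul]
    have h1 := coordMap_ι_mul x s
    have h2 := coordMap_ι_mul x (CliffordAlgebra.contractLeft (Q := (0 : QuadraticForm ℂ E7))
      (dualForm y) s)
    have h3 := op_anticomm (0, y) (x, 0) (coordMap s)
    have h4 : q (0, y) (x, 0) = dualForm y x := by simp [q_apply, dualForm]
    erw [h1, h2]
    rw [smul_sub, ← map_smul (op (x, 0)), hs, eq_sub_of_add_eq h3, h4, mul_smul]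

theorem coordMap_cliff (v : V14) (s : Spinors) : coordMap (cliff v s) = op v (coordMap s) := by
  rw [cliff_apply, map_add, map_smul, coordMap_ι_mul, coordMap_contract, ← LinearMap.add_apply,
    ← map_add]
  simp

theorem exists_flipBit : ∀ n : Fin 128, n ≠ 0 → ∃ i : Fin 7,
    flipBit (Fin.castAdd 7 i) n < n ∧ (genCoeff (Fin.castAdd 7 i) n = 1 ∨
      genCoeff (Fin.castAdd 7 i) n = -1) := by decide +kernel

theorem flipBit_injective (m : Fin 14) : Function.Injective (flipBit m) :=
  Function.LeftInverse.injective (flipBit_flipBit m)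

theorem gen_single (m : Fin 14) (n : Fin 128) :
    gen ℂ m (Pi.single (flipBit m n) 1) = (genCoeff m n : ℂ) • Pi.single n 1 := by
  ext k
  by_cases hk : k = n
  · subst hk
    simp [gen_apply]
  · simp [gen_apply, hk, (flipBit_injective m).ne hk]

/-- Removing an element of a subset lowers its bitmask, and wedging with that element restores the
monomial up to sign. -/
theorem single_mem_range (n : Fin 128) : (Pi.single n 1 : Sp) ∈ LinearMap.range coordMap := by
  induction n using WellFoundedLT.induction with
  | ind n ih =>
    by_cases hn : n = 0
    · exact ⟨1, by rw [coordMap_one, vacuum, hn]⟩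
    · obtain ⟨i, hlt, hi⟩ := exists_flipBit n hn
      obtain ⟨s, hs⟩ := ih _ hlt
      have h : coordMap (cliff (vBasis (Fin.castAdd 7 i)) s) =
          (genCoeff (Fin.castAdd 7 i) n : ℂ) • Pi.single n 1 := by
        rw [coordMap_cliff, op_vBasis, hs, gen_single]
      rcases hi with hi | hi <;> rw [hi] at h
      · exact ⟨_, h.trans (by simp)⟩
      · exact ⟨-_, (map_neg _ _).trans (by rw [h]; simp)⟩

theorem coordMap_surjective : Function.Surjective coordMap := by
  rw [← LinearMap.range_eq_top, ← top_le_iff, ← (Pi.basisFun ℂ (Fin 128)).span_eq,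
    Submodule.span_le]
  rintro _ ⟨n, rfl⟩
  rw [Pi.basisFun_apply]
  exact single_mem_range n

instance : Module.Finite ℂ Spinors := Module.Finite.of_basis (Pi.basisFun ℂ (Fin 7)).ExteriorAlgebra

theorem finrank_spinors : Module.finrank ℂ Spinors = 128 := by
  rw [Module.finrank_eq_card_basis (Pi.basisFun ℂ (Fin 7)).ExteriorAlgebra]
  simp

/-- Coordinates of spinors, as an equivalence. -/
def spinorEquiv : Spinors ≃ₗ[ℂ] Sp :=
  LinearEquiv.ofBijective coordMap ⟨(LinearMap.injective_iff_surjective_of_finrank_eq_finrank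
    (by rw [finrank_spinors]; simp)).mpr coordMap_surjective, coordMap_surjective⟩

theorem spinorEquiv_apply (s : Spinors) : spinorEquiv s = coordMap s := rfl

theorem coordMap_injective : Function.Injective coordMap := spinorEquiv.injective

/-! ### The grading and the pairing in coordinates -/

theorem bitCount_flipBit : ∀ (i : Fin 7) (n : Fin 128), genCoeff (Fin.castAdd 7 i) n ≠ 0 →
    bitCount n = bitCount (flipBit (Fin.castAdd 7 i) n) + 1 := by decide +kernel

theorem bitCount_parity : ∀ (m : Fin 14) (n : Fin 128),
    (bitCount (flipBit m n) : ZMod 2) = bitCount n + 1 := by decide +kernel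

theorem op_apply (v : V14) (s : Sp) (n : Fin 128) :
    op v s n = ∑ m, vB.repr v m * (genCoeff m n * s (flipBit m n)) := by
  conv_lhs => rw [← vB.sum_repr v]
  simp only [map_sum, LinearMap.sum_apply, map_smul, LinearMap.smul_apply, vB_apply, op_vBasis,
    Finset.sum_apply, Pi.smul_apply, gen_apply, smul_eq_mul]

theorem vB_repr_natAdd (x : E7) (i : Fin 7) : vB.repr (x, 0) (Fin.natAdd 7 i) = 0 := by
  rw [← q_vBasis_eq_coord, natAdd_add_seven, vBasis_castAdd, q_apply]
  simp [eVec]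

theorem op_inl_support {k : ℕ} (x : E7) {s : Sp} (hs : ∀ n : Fin 128, bitCount n ≠ k → s n = 0)
    (n : Fin 128) (hn : bitCount n ≠ k + 1) : op (x, 0) s n = 0 := by
  rw [op_apply]
  refine Finset.sum_eq_zero fun m _ => ?_
  refine Fin.addCases (m := 7) (n := 7) (fun i => ?_) (fun i => ?_) m
  · by_cases h : genCoeff (Fin.castAdd 7 i) n = 0
    · rw [h]
      simp
    · rw [hs _ fun h' => hn (by rw [bitCount_flipBit i n h, h'])]
      simp
  · rw [vB_repr_natAdd, zero_mul]

theorem op_parity {j : ZMod 2} (v : V14) {s : Sp}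
    (hs : ∀ n : Fin 128, (bitCount n : ZMod 2) ≠ j → s n = 0)
    (n : Fin 128) (hn : (bitCount n : ZMod 2) ≠ j + 1) : op v s n = 0 := by
  rw [op_apply]
  refine Finset.sum_eq_zero fun m _ => ?_
  rw [hs _ fun h' => hn ?_, mul_zero, mul_zero]
  rw [bitCount_parity] at h'
  rw [← h', add_assoc, show (1 + 1 : ZMod 2) = 0 from by decide, add_zero]

theorem coordMap_ιMulti_support (k : ℕ) (v : Fin k → E7) (n : Fin 128) (hn : bitCount n ≠ k) :
    coordMap (ExteriorAlgebra.ιMulti ℂ k v) n = 0 := by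
  induction k generalizing n with
  | zero =>
    rw [ExteriorAlgebra.ιMulti_zero_apply, coordMap_one, vacuum]
    exact Pi.single_eq_of_ne (fun h => hn (by rw [h]; rfl)) _
  | succ k ih =>
    rw [ExteriorAlgebra.ιMulti_succ_apply, coordMap_ι_mul]
    exact op_inl_support _ (ih _) n hn

theorem gen_top : gen ℤ 0 (gen ℤ 1 (gen ℤ 2 (gen ℤ 3 (gen ℤ 4 (gen ℤ 5 (gen ℤ 6
    (Pi.single 0 1))))))) 127 = 1 := by decide +kernel

theorem coordMap_ι_single (i : Fin 7) (s : Spinors) :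
    coordMap (ExteriorAlgebra.ι ℂ (Pi.single i 1) * s) =
      gen ℂ (Fin.castAdd 7 i) (coordMap s) := by
  rw [coordMap_ι_mul, ← op_vBasis, vBasis_castAdd, eVec]

theorem coordMap_top : coordMap (ExteriorAlgebra.ιMulti ℂ 7 (Pi.basisFun ℂ (Fin 7))) 127 = 1 := by
  simp only [ExteriorAlgebra.ιMulti_succ_apply, ExteriorAlgebra.ιMulti_zero_apply, Matrix.vecTail,
    Function.comp_apply, Pi.basisFun_apply, coordMap_ι_single, coordMap_one, vacuum_eq_cast]
  simp only [gen_cast]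
  exact (congrArg (Int.cast : ℤ → ℂ) gen_top).trans (by simp)

/-- Compared degree by degree. In degree 7 both sides are alternating and agree on the standard
basis; in the other degrees both vanish. -/
theorem topCoeff_eq (s : Spinors) : topCoeff s = coordMap s 127 := by
  suffices h : topCoeff = LinearMap.proj 127 ∘ₗ coordMap from LinearMap.congr_fun h s
  refine ExteriorAlgebra.lhom_ext fun k => ?_
  rw [topCoeff, ExteriorAlgebra.liftAlternating_comp_ιMulti]
  by_cases hk : k = 7
  · subst hk
    rw [Pi.single_eq_same]
    refine Module.Basis.ext_alternating (Pi.basisFun ℂ (Fin 7)) fun v hv => ?_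
    have hb : Function.Bijective v := Finite.injective_iff_bijective.mp hv
    let σ : Equiv.Perm (Fin 7) := Equiv.ofBijective v hb
    have h1 : (fun i => Pi.basisFun ℂ (Fin 7) (v i)) = (Pi.basisFun ℂ (Fin 7)) ∘ σ := rfl
    rw [h1, AlternatingMap.map_perm, AlternatingMap.map_perm]
    congr 1
    rw [LinearMap.compAlternatingMap_apply, LinearMap.comp_apply, LinearMap.proj_apply,
      coordMap_top, ← Pi.basisFun_det, Module.Basis.det_self]
  · rw [Pi.single_eq_of_ne hk]
    ext v
    rw [LinearMap.compAlternatingMap_apply, LinearMap.comp_apply, LinearMap.proj_apply,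
      coordMap_ιMulti_support k v 127 fun h => hk (by rw [← h]; decide)]
    rfl

/-- The sign of the pairing of a basis spinor with its complement. -/
def pairSign (n : ℕ) : ℤ :=
  -- For a subset S of {0, …, 6} with p elements, putting S before its complement costs the sign of
  -- exponent ∑S − p(p−1)/2, and the reversal contributes p(p−1)/2. Only the parity of ∑S remains,
  -- that is, of the number of odd elements. The complement of the mask `n` is `n.rev`.
  if ((n.testBit 1).toNat + (n.testBit 3).toNat + (n.testBit 5).toNat) % 2 = 0 then 1 else -1

/-- The pairing in coordinates. -/
def pairCoord (R : Type) [CommRing R] (s t : Fin 128 → R) : R :=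
  ∑ n : Fin 128, pairSign n * s n * t n.rev

theorem pairSign_flipBit : ∀ (m : Fin 14) (n : Fin 128),
    pairSign (flipBit m n) * genCoeff m (flipBit m n).rev = pairSign n * genCoeff m n ∧
      flipBit m (flipBit m n).rev = n.rev ∧ flipBit m (flipBit m n) = n := by decide +kernel

theorem pairSign_rev : ∀ n : Fin 128, pairSign n.rev = -pairSign n := by decide +kernel

/-- Reindexing by the involution `flipBit m` matches the two sums term by term; the signs agree by
`pairSign_flipBit`. -/
theorem pairCoord_gen (m : Fin 14) (s t : Sp) :
    pairCoord ℂ (gen ℂ m s) t = pairCoord ℂ s (gen ℂ m t) := by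
  let e : Equiv.Perm (Fin 128) := Function.Involutive.toPerm (flipBit m)
    fun n => (pairSign_flipBit m n).2.2
  rw [pairCoord, pairCoord, ← Equiv.sum_comp e fun n => (pairSign n : ℂ) * s n * gen ℂ m t n.rev]
  refine Finset.sum_congr rfl fun n _ => ?_
  obtain ⟨h1, h2, -⟩ := pairSign_flipBit m n
  have h3 := congrArg (Int.cast : ℤ → ℂ) h1
  push_cast at h3
  change _ = (pairSign (flipBit m n) : ℂ) * s (flipBit m n) * gen ℂ m t (flipBit m n).rev
  rw [gen_apply, gen_apply, h2]
  linear_combination -(s (flipBit m n) * t n.rev) * h3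

theorem pairCoord_op (v : V14) (s t : Sp) :
    pairCoord ℂ (op v s) t = pairCoord ℂ s (op v t) := by
  have h : ∀ m, pairCoord ℂ (op (vB m) s) t = pairCoord ℂ s (op (vB m) t) := fun m => by
    rw [vB_apply, op_vBasis, pairCoord_gen]
  let L : V14 →ₗ[ℂ] ℂ :=
    { toFun := fun v => pairCoord ℂ (op v s) t
      map_add' := fun v w => by simp [pairCoord, mul_add, add_mul, Finset.sum_add_distrib]
      map_smul' := fun c v => by
        simp only [pairCoord, map_smul, LinearMap.smul_apply, Pi.smul_apply, smul_eq_mul,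
          RingHom.id_apply, Finset.mul_sum]
        exact Finset.sum_congr rfl fun n _ => by ring }
  let R : V14 →ₗ[ℂ] ℂ :=
    { toFun := fun v => pairCoord ℂ s (op v t)
      map_add' := fun v w => by simp [pairCoord, mul_add, Finset.sum_add_distrib]
      map_smul' := fun c v => by
        simp only [pairCoord, map_smul, LinearMap.smul_apply, Pi.smul_apply, smul_eq_mul,
          RingHom.id_apply, Finset.mul_sum]
        exact Finset.sum_congr rfl fun n _ => by ring }
  exact LinearMap.congr_fun (vB.ext h : L = R) v

/-- Skewness comes from the three odd elements of {0, …, 6}: complementary subsets have opposite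
signs. -/
theorem pairCoord_swap (s t : Sp) : pairCoord ℂ s t = -pairCoord ℂ t s := by
  rw [pairCoord, pairCoord, ← Equiv.sum_comp Fin.revPerm, ← Finset.sum_neg_distrib]
  refine Finset.sum_congr rfl fun n _ => ?_
  rw [Fin.revPerm_apply, pairSign_rev, Fin.rev_rev]
  push_cast
  ring

theorem pairCoord_vacuum (t : Sp) : pairCoord ℂ vacuum t = t 127 := by
  rw [pairCoord, Finset.sum_eq_single 0]
  · have : Fin.rev (0 : Fin 128) = 127 := rfl
    rw [this]
    simp [vacuum, pairSign]
  · intro n _ hn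
    simp [vacuum, hn]
  · simp

/-- Self-adjointness of vectors moves the factors of `s` to the other side one at a time, which
leaves the case of a scalar `s`. -/
theorem pairing_eq (s t : Spinors) : pairing s t = pairCoord ℂ (coordMap s) (coordMap t) := by
  rw [pairing, topCoeff_eq]
  induction s using CliffordAlgebra.left_induction generalizing t with
  | algebraMap r =>
    rw [CliffordAlgebra.reverse.commutes, ← Algebra.smul_def]
    have h : coordMap (algebraMap ℂ (CliffordAlgebra (0 : QuadraticForm ℂ E7)) r) =
        r • vacuum := by
      rw [Algebra.algebraMap_eq_smul_one, ← coordMap_one]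
      exact map_smul _ _ _
    have h2 : coordMap (r • t) = r • coordMap t := map_smul _ _ _
    rw [h]
    erw [h2]
    rw [Pi.smul_apply, ← pairCoord_vacuum (coordMap t)]
    simp only [pairCoord, Pi.smul_apply, smul_eq_mul, Finset.mul_sum]
    exact Finset.sum_congr rfl fun n _ => by ring
  | add a b ha hb =>
    rw [map_add, add_mul, map_add]
    have h : coordMap (a + b) = coordMap a + coordMap b := map_add coordMap a b
    rw [Pi.add_apply]
    erw [ha, hb, h]
    simp only [pairCoord, Pi.add_apply, mul_add, add_mul, Finset.sum_add_distrib]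
  | ι_mul s x hs =>
    have h1 := coordMap_ι_mul x s
    have h2 := coordMap_ι_mul x t
    rw [CliffordAlgebra.reverse.map_mul, CliffordAlgebra.reverse_ι, mul_assoc]
    erw [hs, h1, h2]
    rw [pairCoord_op]

theorem pairing_cliff (v : V14) (s t : Spinors) :
    pairing (cliff v s) t = pairing s (cliff v t) := by
  rw [pairing_eq, pairing_eq, coordMap_cliff, coordMap_cliff, pairCoord_op]

theorem pairing_swap (s t : Spinors) : pairing s t = -pairing t s := by
  rw [pairing_eq, pairing_eq, pairCoord_swap]

/-- Vectors are self-adjoint for a skew pairing. This is what makes (a, b, c) ↦ ⟨z, a b c z⟩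
alternating. -/
theorem pairing_cliff_self (v : V14) (s : Spinors) : pairing s (cliff v s) = 0 := by
  have h := pairing_swap s (cliff v s)
  rw [pairing_cliff] at h
  linear_combination h / 2

/-- The pairing, as a bilinear map. -/
def pairingBilin : Spinors →ₗ[ℂ] Spinors →ₗ[ℂ] ℂ :=
  LinearMap.mk₂ ℂ pairing
    (fun s s' t => by simp only [pairing, map_add, add_mul])
    (fun c s t => by simp only [pairing, map_smul, Algebra.smul_mul_assoc])
    (fun s t t' => by simp only [pairing, mul_add, map_add])
    (fun c s t => by simp only [pairing, map_smul, Algebra.mul_smul_comm])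

theorem pairingBilin_apply (s t : Spinors) : pairingBilin s t = pairing s t := rfl

/-! ### Coordinates of half-spinors -/

theorem coordMap_parity {j : ZMod 2} {s : Spinors} (hs : s ∈ halfSpin j) (n : Fin 128)
    (hn : (bitCount n : ZMod 2) ≠ j) : coordMap s n = 0 := by
  have two : ∀ j : ZMod 2, j + 1 + 1 = j := by decide
  have ind : ∀ (s : Spinors) (j : ZMod 2),
      (∀ n : Fin 128, (bitCount n : ZMod 2) ≠ j → coordMap s n = 0) → ∀ m m' : E7,
      ∀ n : Fin 128, (bitCount n : ZMod 2) ≠ j →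
        coordMap (ExteriorAlgebra.ι ℂ m * ExteriorAlgebra.ι ℂ m' * s) n = 0 := by
    intro s j h m m' n hn
    rw [mul_assoc, coordMap_ι_mul, coordMap_ι_mul]
    refine op_parity (j := j + 1) _ (fun k hk => op_parity _ h k hk) n ?_
    rwa [two]
  have hv : ∀ n : Fin 128, (bitCount n : ZMod 2) ≠ 0 → vacuum n = 0 := fun n hn =>
    Pi.single_eq_of_ne (fun h => hn (by rw [h]; rfl)) _
  have hi : j = 0 ∨ j = 1 := (by decide : ∀ j : ZMod 2, j = 0 ∨ j = 1) j
  rcases hi with rfl | rfl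
  · induction s, hs using CliffordAlgebra.even_induction generalizing n with
    | algebraMap r =>
      have h : coordMap (algebraMap ℂ (CliffordAlgebra (0 : QuadraticForm ℂ E7)) r) =
          r • vacuum := by
        rw [Algebra.algebraMap_eq_smul_one, ← coordMap_one]
        exact map_smul _ _ _
      erw [h]
      rw [Pi.smul_apply, hv n hn, smul_zero]
    | add x y hx hy h1 h2 =>
      have h : coordMap (x + y) = coordMap x + coordMap y := map_add coordMap _ _
      erw [h]
      rw [Pi.add_apply, h1 n hn, h2 n hn, add_zero]
    | ι_mul_ι_mul m m' x hx h => exact ind x 0 (fun k hk => h k hk) m m' n hn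
  · induction s, hs using CliffordAlgebra.odd_induction generalizing n with
    | ι v =>
      have h := coordMap_ι_mul v 1
      rw [mul_one, coordMap_one] at h
      erw [h]
      exact op_parity (j := 0) _ hv n hn
    | add x y hx hy h1 h2 =>
      have h : coordMap (x + y) = coordMap x + coordMap y := map_add coordMap _ _
      erw [h]
      rw [Pi.add_apply, h1 n hn, h2 n hn, add_zero]
    | ι_mul_ι_mul m m' x hx h => exact ind x 1 (fun k hk => h k hk) m m' n hn

theorem mem_halfSpin_zero {s : Spinors}
    (h : ∀ n : Fin 128, (bitCount n : ZMod 2) ≠ 0 → coordMap s n = 0) : s ∈ halfSpin 0 := by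
  have hc := CliffordAlgebra.evenOdd_isCompl (Q := (0 : QuadraticForm ℂ E7))
  obtain ⟨a, ha, b, hb, hab⟩ := Submodule.mem_sup.mp
    (hc.sup_eq_top.symm ▸ Submodule.mem_top : s ∈ halfSpin 0 ⊔ halfSpin 1)
  have hb0 : b = 0 := by
    refine coordMap_injective ?_
    rw [map_zero]
    ext n
    by_cases hn : (bitCount n : ZMod 2) = 1
    · have h1 := h n (by rw [hn]; decide)
      have h2 : coordMap (a + b) = coordMap a + coordMap b := map_add coordMap _ _
      rw [← hab, h2, Pi.add_apply, coordMap_parity ha n (by rw [hn]; decide), zero_add] at h1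
      exact h1
    · exact coordMap_parity hb n hn
  rw [← hab, hb0]
  simpa using ha

/-- Each odd coordinate is detected by the complementary even monomial. The spinor representing a
differential is therefore unique. -/
theorem eq_zero_of_pairing {δ : Spinors} (hδ : δ ∈ halfSpin 1)
    (h : ∀ w : Delta14, pairing w δ = 0) : δ = 0 := by
  have hparity : ∀ n : Fin 128, (bitCount n : ZMod 2) = 1 →
      (bitCount n.rev : ZMod 2) = 0 ∧ pairSign n.rev ≠ 0 := by decide +kernel
  refine coordMap_injective ?_
  rw [map_zero]
  ext n
  by_cases hn : (bitCount n : ZMod 2) = 1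
  · obtain ⟨h1, h2⟩ := hparity n hn
    have hmem : spinorEquiv.symm (Pi.single n.rev 1) ∈ halfSpin 0 := by
      refine mem_halfSpin_zero fun k hk => ?_
      rw [← spinorEquiv_apply, LinearEquiv.apply_symm_apply]
      exact Pi.single_eq_of_ne (fun hkn => hk (by rw [hkn, h1])) _
    have h3 := h ⟨_, hmem⟩
    rw [pairing_eq, ← spinorEquiv_apply, LinearEquiv.apply_symm_apply, pairCoord,
      Finset.sum_eq_single n.rev] at h3
    · rw [Pi.single_eq_same, mul_one, Fin.rev_rev] at h3
      exact (mul_eq_zero.mp h3).resolve_left (by exact_mod_cast h2)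
    · intro k _ hk
      simp [hk]
    · simp
  · exact coordMap_parity hδ n hn

/-! ### Spin group elements -/

theorem cliff_anticomm (v w : V14) (s : Spinors) :
    cliff v (cliff w s) + cliff w (cliff v s) = (2 * q v w) • s := by
  refine coordMap_injective ?_
  rw [map_add, map_smul, coordMap_cliff, coordMap_cliff, coordMap_cliff, coordMap_cliff,
    op_anticomm]

theorem cliff_self (v : V14) (s : Spinors) : cliff v (cliff v s) = Q v • s :=
  LinearMap.congr_fun (cliff_cliff v) s

theorem cliffordRep_ι (v : V14) : cliffordRep (CliffordAlgebra.ι Q v) = cliff v := by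
  rw [cliffordRep, CliffordAlgebra.lift_ι_apply]

theorem cliff_injective : Function.Injective cliff := by
  refine (injective_iff_map_eq_zero cliff).mpr fun v hv => eq_of_q_eq fun u => ?_
  have h := congrArg coordMap (cliff_anticomm v u 1)
  rw [hv, LinearMap.zero_apply, LinearMap.zero_apply, map_zero, add_zero, map_zero, map_smul,
    coordMap_one] at h
  have h0 := congrFun h 0
  rw [map_zero, q_comm]
  simpa [vacuum] using h0

theorem ι_injective : Function.Injective (CliffordAlgebra.ι Q) := fun v w h => by
  refine cliff_injective ?_
  rw [← cliffordRep_ι, ← cliffordRep_ι, h]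

theorem algebraMap_injective : Function.Injective (algebraMap ℂ (CliffordAlgebra Q)) := by
  intro a b h
  have h1 := congrArg (fun x => coordMap (cliffordRep x 1) 0) h
  simpa [vacuum, Module.algebraMap_end_apply, coordMap_one] using h1

theorem ι_mul_ι_add_swap_q (v w : V14) :
    CliffordAlgebra.ι Q v * CliffordAlgebra.ι Q w + CliffordAlgebra.ι Q w * CliffordAlgebra.ι Q v =
      algebraMap ℂ _ (2 * q v w) := by
  rw [CliffordAlgebra.ι_mul_ι_add_swap, QuadraticMap.polar, Q_eq_q, Q_eq_q, Q_eq_q]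
  congr 1
  simp only [map_add, LinearMap.add_apply, q_comm w v]
  ring

theorem star_ι_mul_ι (u w : V14) : star (CliffordAlgebra.ι Q u * CliffordAlgebra.ι Q w) =
    CliffordAlgebra.ι Q w * CliffordAlgebra.ι Q u := by
  rw [star_mul, CliffordAlgebra.star_ι, CliffordAlgebra.star_ι, neg_mul_neg]

theorem ι_mem_lipschitzGroup (u : V14) (hu : Q u ≠ 0) :
    ∃ x : (CliffordAlgebra Q)ˣ, x ∈ lipschitzGroup Q ∧ (x : CliffordAlgebra Q) =
      CliffordAlgebra.ι Q u := by
  have h1 : CliffordAlgebra.ι Q u * CliffordAlgebra.ι Q ((Q u)⁻¹ • u) = 1 := by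
    rw [map_smul, Algebra.mul_smul_comm, CliffordAlgebra.ι_sq_scalar, Algebra.smul_def,
      ← map_mul, inv_mul_cancel₀ hu, map_one]
  have h2 : CliffordAlgebra.ι Q ((Q u)⁻¹ • u) * CliffordAlgebra.ι Q u = 1 := by
    rw [map_smul, Algebra.smul_mul_assoc, CliffordAlgebra.ι_sq_scalar, Algebra.smul_def,
      ← map_mul, inv_mul_cancel₀ hu, map_one]
  exact ⟨⟨_, _, h1, h2⟩, Subgroup.subset_closure ⟨u, rfl⟩, rfl⟩

/-- The condition on `Q u * Q w` says that the spinor norm of the product is one. All group elements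
constructed below are products of such pairs. -/
theorem ι_mul_ι_mem_spinGroup {u w : V14} (h : Q u * Q w = 1) :
    CliffordAlgebra.ι Q u * CliffordAlgebra.ι Q w ∈ spinGroup Q := by
  obtain ⟨x, hx, hxu⟩ := ι_mem_lipschitzGroup u (left_ne_zero_of_mul_eq_one h)
  obtain ⟨y, hy, hyw⟩ := ι_mem_lipschitzGroup w (right_ne_zero_of_mul_eq_one h)
  refine ⟨⟨⟨x * y, mul_mem hx hy, ?_⟩, ?_⟩, ?_⟩
  · change ((x * y : (CliffordAlgebra Q)ˣ) : CliffordAlgebra Q) = _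
    rw [Units.val_mul, hxu, hyw]
  · change _ ∈ unitary (CliffordAlgebra Q)
    rw [Unitary.mem_iff, star_ι_mul_ι]
    constructor
    · rw [mul_assoc, ← mul_assoc (CliffordAlgebra.ι Q u), CliffordAlgebra.ι_sq_scalar,
        Algebra.commutes, ← mul_assoc, CliffordAlgebra.ι_sq_scalar, ← map_mul, mul_comm, h, map_one]
    · rw [mul_assoc, ← mul_assoc (CliffordAlgebra.ι Q w), CliffordAlgebra.ι_sq_scalar,
        Algebra.commutes, ← mul_assoc, CliffordAlgebra.ι_sq_scalar, ← map_mul, h, map_one]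
  · change _ ∈ CliffordAlgebra.evenOdd Q 0
    exact CliffordAlgebra.ι_mul_ι_mem_evenOdd_zero Q u w

/-- The product of two vectors of inverse norms, as an element of `Spin₁₄`. -/
def spinPair (u w : V14) (h : Q u * Q w = 1) : Spin14Group :=
  ⟨CliffordAlgebra.ι Q u * CliffordAlgebra.ι Q w, ι_mul_ι_mem_spinGroup h⟩

theorem spinRep_coe (g : Spin14Group) (z : Delta14) :
    (spinRep g z : Spinors) = cliffordRep (g : CliffordAlgebra Q) z := rfl

theorem spinRep_spinPair (u w : V14) (h : Q u * Q w = 1) (z : Delta14) :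
    (spinRep (spinPair u w h) z : Spinors) = cliff u (cliff w z) := by
  rw [spinRep_coe, spinPair, map_mul, cliffordRep_ι, cliffordRep_ι]
  rfl

theorem spinRep_inv_apply (g : Spin14Group) (z : Delta14) : spinRep g⁻¹ (spinRep g z) = z := by
  rw [← Module.End.mul_apply, ← map_mul, inv_mul_cancel, map_one, Module.End.one_apply]

theorem spinRep_apply_inv (g : Spin14Group) (z : Delta14) : spinRep g (spinRep g⁻¹ z) = z := by
  rw [← Module.End.mul_apply, ← map_mul, mul_inv_cancel, map_one, Module.End.one_apply]

/-! ### The vector representation -/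

theorem coe_mul_coe_inv (g : Spin14Group) :
    (g : CliffordAlgebra Q) * ((g⁻¹ : Spin14Group) : CliffordAlgebra Q) = 1 := by
  rw [← Submonoid.coe_mul, mul_inv_cancel, Submonoid.coe_one]

theorem coe_inv_mul_coe (g : Spin14Group) :
    ((g⁻¹ : Spin14Group) : CliffordAlgebra Q) * (g : CliffordAlgebra Q) = 1 := by
  rw [← Submonoid.coe_mul, inv_mul_cancel, Submonoid.coe_one]

theorem conj_ι_mem_range (g : Spin14Group) (v : V14) :
    (g : CliffordAlgebra Q) * CliffordAlgebra.ι Q v * ((g⁻¹ : Spin14Group) : CliffordAlgebra Q) ∈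
      LinearMap.range (CliffordAlgebra.ι Q) := by
  let x : (CliffordAlgebra Q)ˣ := ⟨g, (g⁻¹ : Spin14Group), coe_mul_coe_inv g, coe_inv_mul_coe g⟩
  have : Invertible (2 : ℂ) := invertibleOfNonzero two_ne_zero
  have h := spinGroup.conjAct_smul_ι_mem_range_ι (x := x) g.2 v
  rwa [ConjAct.units_smul_def, ConjAct.ofConjAct_toConjAct] at h

/-- The vector representation, as a linear map. -/
def vecMap (g : Spin14Group) : V14 →ₗ[ℂ] V14 :=
  (LinearEquiv.ofInjective (CliffordAlgebra.ι Q) ι_injective).symm.toLinearMap ∘ₗ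
    (LinearMap.mulLeftRight ℂ ((g : CliffordAlgebra Q), ((g⁻¹ : Spin14Group) : CliffordAlgebra Q)) ∘ₗ
      CliffordAlgebra.ι Q).codRestrict _ (fun v => conj_ι_mem_range g v)

theorem ι_vecMap (g : Spin14Group) (v : V14) : CliffordAlgebra.ι Q (vecMap g v) =
    (g : CliffordAlgebra Q) * CliffordAlgebra.ι Q v * ((g⁻¹ : Spin14Group) : CliffordAlgebra Q) := by
  rw [← LinearEquiv.ofInjective_apply (h := ι_injective), vecMap, LinearMap.comp_apply,
    LinearEquiv.coe_coe, LinearEquiv.apply_symm_apply]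
  rfl

theorem vecMap_eq_iff (g : Spin14Group) (v w : V14) : vecMap g v = w ↔
    (g : CliffordAlgebra Q) * CliffordAlgebra.ι Q v = CliffordAlgebra.ι Q w * g := by
  rw [← ι_injective.eq_iff, ι_vecMap]
  constructor
  · intro h
    rw [← h, mul_assoc _ _ (g : CliffordAlgebra Q), coe_inv_mul_coe, mul_one]
  · intro h
    rw [h, mul_assoc, coe_mul_coe_inv, mul_one]

theorem vecMap_inv_apply (g : Spin14Group) (v : V14) : vecMap g⁻¹ (vecMap g v) = v := by
  rw [vecMap_eq_iff, ι_vecMap, ← mul_assoc, ← mul_assoc, coe_inv_mul_coe, one_mul]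

theorem vecMap_apply_inv (g : Spin14Group) (v : V14) : vecMap g (vecMap g⁻¹ v) = v := by
  have := vecMap_inv_apply g⁻¹ v
  rwa [inv_inv] at this

/-- The vector representation. -/
def vecEquiv (g : Spin14Group) : V14 ≃ₗ[ℂ] V14 :=
  LinearEquiv.ofLinearMap (vecMap g) (vecMap g⁻¹) (LinearMap.ext (vecMap_apply_inv g))
    (LinearMap.ext (vecMap_inv_apply g))

theorem q_vecMap (g : Spin14Group) (v w : V14) : q (vecMap g v) (vecMap g w) = q v w := by
  have h : algebraMap ℂ (CliffordAlgebra Q) (2 * q (vecMap g v) (vecMap g w)) =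
      algebraMap ℂ (CliffordAlgebra Q) (2 * q v w) := by
    have h1 : ∀ a b : CliffordAlgebra Q, (g : CliffordAlgebra Q) * a *
        ((g⁻¹ : Spin14Group) : CliffordAlgebra Q) * (g * b * ((g⁻¹ : Spin14Group) :
          CliffordAlgebra Q)) = g * (a * b) * ((g⁻¹ : Spin14Group) : CliffordAlgebra Q) := by
      intro a b
      calc _ = (g : CliffordAlgebra Q) * a * (((g⁻¹ : Spin14Group) : CliffordAlgebra Q) * g) * b *
            ((g⁻¹ : Spin14Group) : CliffordAlgebra Q) := by noncomm_ring
        _ = _ := by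
          rw [coe_inv_mul_coe]
          noncomm_ring
    rw [← ι_mul_ι_add_swap_q, ι_vecMap, ι_vecMap, h1, h1, ← add_mul, ← mul_add, ι_mul_ι_add_swap_q,
      ← Algebra.commutes, mul_assoc, coe_mul_coe_inv, mul_one]
  exact mul_left_cancel₀ two_ne_zero (algebraMap_injective h)

theorem moveSubspace_eq (g : Spin14Group) (W : Submodule ℂ V14) :
    moveSubspace g W = W.map (vecMap g) := by
  ext v
  rw [moveSubspace, Submodule.mem_comap, Submodule.mem_map, Submodule.mem_map]
  constructor
  · rintro ⟨_, ⟨w, hw, rfl⟩, h⟩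
    exact ⟨w, hw, ι_injective ((ι_vecMap g w).trans h)⟩
  · rintro ⟨w, hw, rfl⟩
    exact ⟨_, ⟨w, hw, rfl⟩, (ι_vecMap g w).symm⟩

theorem cliff_vecMap (g : Spin14Group) (v : V14) (s : Spinors) :
    cliff (vecMap g v) (cliffordRep (g : CliffordAlgebra Q) s) =
      cliffordRep (g : CliffordAlgebra Q) (cliff v s) := by
  rw [← cliffordRep_ι, ← cliffordRep_ι, ← Module.End.mul_apply, ← Module.End.mul_apply, ← map_mul,
    ← map_mul, ← (vecMap_eq_iff g v _).mp rfl]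

theorem pairing_cliffordRep (x : CliffordAlgebra Q) (s t : Spinors) :
    pairing (cliffordRep x s) t = pairing s (cliffordRep (CliffordAlgebra.reverse x) t) := by
  rw [← pairingBilin_apply, ← pairingBilin_apply]
  induction x using CliffordAlgebra.left_induction generalizing t with
  | algebraMap r =>
    rw [CliffordAlgebra.reverse.commutes, AlgHom.commutes, Module.algebraMap_end_apply,
      Module.algebraMap_end_apply, map_smul, map_smul, LinearMap.smul_apply]
  | add a b ha hb => simp only [map_add, LinearMap.add_apply, ha, hb]
  | ι_mul x v hx =>
    rw [CliffordAlgebra.reverse.map_mul, CliffordAlgebra.reverse_ι, map_mul, map_mul,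
      Module.End.mul_apply, Module.End.mul_apply, ← hx, cliffordRep_ι, pairingBilin_apply,
      pairing_cliff, pairingBilin_apply]

/-- On even elements the star operation is the reversal, and spin elements are unitary for it. As
reversal is the adjoint for the pairing, the pairing is invariant. -/
theorem reverse_eq_inv (g : Spin14Group) :
    CliffordAlgebra.reverse (g : CliffordAlgebra Q) = ((g⁻¹ : Spin14Group) : CliffordAlgebra Q) := by
  have h := spinGroup.star_mul_self_of_mem g.2
  rw [CliffordAlgebra.star_def, spinGroup.involute_eq g.2] at h
  calc _ = CliffordAlgebra.reverse (g : CliffordAlgebra Q) *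
        ((g : CliffordAlgebra Q) * ((g⁻¹ : Spin14Group) : CliffordAlgebra Q)) := by
          rw [coe_mul_coe_inv, mul_one]
    _ = _ := by rw [← mul_assoc, h, one_mul]

theorem cliffordRep_inv_apply (g : Spin14Group) (s : Spinors) :
    cliffordRep ((g⁻¹ : Spin14Group) : CliffordAlgebra Q)
      (cliffordRep (g : CliffordAlgebra Q) s) = s := by
  rw [← Module.End.mul_apply, ← map_mul, coe_inv_mul_coe, map_one, Module.End.one_apply]

theorem pairing_spin (g : Spin14Group) (s t : Spinors) :
    pairing (cliffordRep (g : CliffordAlgebra Q) s) (cliffordRep (g : CliffordAlgebra Q) t) =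
      pairing s t := by
  rw [pairing_cliffordRep, reverse_eq_inv, cliffordRep_inv_apply]

theorem cliffordRep_mem_odd (g : Spin14Group) {s : Spinors} (hs : s ∈ halfSpin 1) :
    cliffordRep (g : CliffordAlgebra Q) s ∈ halfSpin 1 := by
  have two : (1 : ZMod 2) + 1 + 1 = 1 := by decide
  have hx : (g : CliffordAlgebra Q) ∈ CliffordAlgebra.evenOdd Q 0 := spinGroup.mem_even g.2
  generalize (g : CliffordAlgebra Q) = x at hx
  induction x, hx using CliffordAlgebra.even_induction with
  | algebraMap r =>
    rw [AlgHom.commutes, Module.algebraMap_end_apply]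
    exact Submodule.smul_mem _ _ hs
  | add x y hx hy h1 h2 =>
    rw [map_add, LinearMap.add_apply]
    exact add_mem h1 h2
  | ι_mul_ι_mul m m' x hx h =>
    rw [map_mul, map_mul, Module.End.mul_apply, Module.End.mul_apply, cliffordRep_ι, cliffordRep_ι]
    have := cliff_mem m (cliff_mem m' h)
    rwa [two] at this

/-! ### Three-vectors as alternating forms -/

/-- The value at `v` of a three-vector, viewed as an alternating form through `q`. -/
def evalForm (v : Fin 3 → V14) : Module.Dual ℂ (⋀[ℂ]^3 V14) :=
  exteriorPower.pairingDual ℂ V14 3 (exteriorPower.ιMulti ℂ 3 fun i => q (v i))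

theorem evalForm_ιMulti (v u : Fin 3 → V14) : evalForm v (exteriorPower.ιMulti ℂ 3 u) =
    (Matrix.of fun i j => q (v j) (u i)).det := by
  rw [evalForm, exteriorPower.pairingDual_ιMulti_ιMulti]

/-- The alternating form associated with a three-vector. -/
def toForm (ω : ⋀[ℂ]^3 V14) : V14 [⋀^Fin 3]→ₗ[ℂ] ℂ :=
  ((LinearMap.applyₗ ω).compAlternatingMap (exteriorPower.alternatingMapToDual ℂ V14 3)).compLinearMap
    q

theorem toForm_apply (ω : ⋀[ℂ]^3 V14) (v : Fin 3 → V14) : toForm ω v = evalForm v ω := by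
  rw [evalForm, exteriorPower.pairingDual, exteriorPower.alternatingMapLinearEquiv_apply_ιMulti]
  rfl

theorem coord_eq_q (m : Fin 14) : vB.coord m = q (vBasis (m + 7)) := by
  refine LinearMap.ext fun v => ?_
  rw [q_vBasis_eq_coord, Module.Basis.coord_apply]

theorem eq_of_evalForm {ω η : ⋀[ℂ]^3 V14}
    (h : ∀ i j k : Fin 14, evalForm ![vBasis i, vBasis j, vBasis k] ω =
      evalForm ![vBasis i, vBasis j, vBasis k] η) : ω = η := by
  refine (vB.exteriorPower 3).ext_elem fun s => ?_
  rw [exteriorPower.basis_repr_apply, exteriorPower.basis_repr_apply, exteriorPower.ιMultiDual,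
    exteriorPower.ιMulti_family]
  set a := Set.powersetCard.ofFinEmbEquiv.symm s
  have h1 : vB.coord ∘ a = fun i => q (![vBasis (a 0 + 7), vBasis (a 1 + 7), vBasis (a 2 + 7)] i) := by
    ext1 i
    rw [Function.comp_apply, coord_eq_q]
    fin_cases i <;> rfl
  have h2 := h (a 0 + 7) (a 1 + 7) (a 2 + 7)
  rw [evalForm, ← h1] at h2
  exact h2

/-- Stated with two maps so as to cover any pair compatible with `q`; it is used with both equal to
an isometry. -/
theorem evalForm_map (f g : V14 →ₗ[ℂ] V14) (hfg : ∀ v w, q (f v) (g w) = q v w) (v : Fin 3 → V14)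
    (ω : ⋀[ℂ]^3 V14) : evalForm (fun i => f (v i)) (exteriorPower.map 3 g ω) = evalForm v ω := by
  rw [← LinearMap.comp_apply]
  congr 1
  refine exteriorPower.linearMap_ext (AlternatingMap.ext fun u => ?_)
  rw [LinearMap.compAlternatingMap_apply, LinearMap.compAlternatingMap_apply, LinearMap.comp_apply,
    exteriorPower.map_apply_ιMulti, evalForm_ιMulti, evalForm_ιMulti]
  simp only [Function.comp_apply, hfg]

/-- The alternating form `(a, b, c) ↦ ⟨z, a b c z⟩`. -/
def spinorForm (z : Spinors) : V14 [⋀^Fin 3]→ₗ[ℂ] ℂ where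
  toFun v := pairingBilin z (cliff (v 0) (cliff (v 1) (cliff (v 2) z)))
  map_update_add' := by
    intro inst v i x y
    obtain rfl : inst = instDecidableEqFin 3 := Subsingleton.elim _ _
    fin_cases i <;> simp
  map_update_smul' := by
    intro inst v i c x
    obtain rfl : inst = instDecidableEqFin 3 := Subsingleton.elim _ _
    fin_cases i <;> simp
  map_eq_zero_of_eq' := by
    intro v i j h hij
    have h01 : v 0 = v 1 ∨ v 1 = v 2 ∨ v 2 = v 0 := by
      fin_cases i <;> fin_cases j <;> simp_all
    have h0 : ∀ v, pairingBilin z (cliff v z) = 0 := fun v => pairing_cliff_self v z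
    rcases h01 with h | h | h
    · rw [h, cliff_self, map_smul, h0, smul_zero]
    · rw [h, cliff_self, map_smul, map_smul, h0, smul_zero]
    · rw [h, eq_sub_of_add_eq (cliff_anticomm (v 0) (v 1) _), cliff_self, map_sub, map_smul,
        map_smul, map_smul, h0, h0, smul_zero, smul_zero, sub_zero]

theorem spinorForm_apply (z : Spinors) (v : Fin 3 → V14) : spinorForm z v =
    pairing z (cliff (v 0) (cliff (v 1) (cliff (v 2) z))) := rfl

theorem evalForm_basis (v : Fin 3 → Fin 14) (hv : StrictMono v) {i j k : Fin 14} (hij : i < j)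
    (hjk : j < k) : evalForm (fun l => vBasis (v l))
      (exteriorPower.ιMulti ℂ 3 ![wBasis i, wBasis j, wBasis k]) =
        if i = v 0 then if j = v 1 then if k = v 2 then 1 else 0 else 0 else 0 := by
  have hb : StrictMono ![i, j, k] := by
    rw [Fin.strictMono_iff_lt_succ]
    intro l
    fin_cases l
    · exact hij
    · exact hjk
  have h1 : ![wBasis i, wBasis j, wBasis k] = wBasis ∘ OrderEmbedding.ofStrictMono ![i, j, k] hb := by
    ext1 l
    fin_cases l <;> rfl
  have hone : ∀ m : Fin 14, q (vBasis m) (wBasis m) = 1 := fun m => by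
    rw [wBasis_eq, q_vBasis, if_pos rfl]
  have hzero : ∀ ⦃m n : Fin 14⦄, m ≠ n → q (vBasis m) (wBasis n) = 0 := fun m n hmn => by
    rw [wBasis_eq, q_vBasis, if_neg fun h => hmn (add_right_cancel h).symm]
  rw [h1, evalForm]
  change exteriorPower.pairingDual ℂ V14 3
    (exteriorPower.ιMulti ℂ 3 ((fun m => q (vBasis m)) ∘ OrderEmbedding.ofStrictMono v hv)) _ = _
  by_cases h : OrderEmbedding.ofStrictMono v hv = OrderEmbedding.ofStrictMono ![i, j, k] hb
  · have hc : ∀ l, v l = ![i, j, k] l := fun l => DFunLike.congr_fun h l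
    rw [← h, exteriorPower.pairingDual_apply_apply_eq_one wBasis _ hone hzero,
      if_pos (show i = v 0 from (hc 0).symm), if_pos (show j = v 1 from (hc 1).symm),
      if_pos (show k = v 2 from (hc 2).symm)]
  · rw [exteriorPower.pairingDual_apply_apply_eq_one_zero wBasis _ hzero _ _ _ h]
    split_ifs with h0 h1 h2
    · refine absurd ?_ h
      ext1 l
      fin_cases l
      · exact h0.symm
      · exact h1.symm
      · exact h2.symm
    all_goals rfl

/-- Both sides are alternating, so sorting the indices reduces the comparison to increasing triples,
where a single term of the sum survives. This frees `Omega` from the choice of basis, and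
equivariance follows. -/
theorem toForm_Omega (z : Delta14) : toForm (Omega z) = spinorForm z := by
  refine Module.Basis.ext_alternating vB fun v hv => ?_
  have hsort : StrictMono (v ∘ Tuple.sort v) :=
    (Tuple.monotone_sort v).strictMono_of_injective (hv.comp (Tuple.sort v).injective)
  suffices h : ∀ u : Fin 3 → Fin 14, StrictMono u →
      toForm (Omega z) (fun i => vB (u i)) = spinorForm z (fun i => vB (u i)) by
    have h1 := h _ hsort
    have h2 : (fun i => vB ((v ∘ Tuple.sort v) i)) = (fun i => vB (v i)) ∘ Tuple.sort v := rfl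
    rw [h2, AlternatingMap.map_perm, AlternatingMap.map_perm] at h1
    exact smul_left_cancel _ h1
  intro u hu
  simp only [vB_apply]
  rw [toForm_apply, Omega, spinorForm_apply, map_sum]
  have hterm : ∀ i j k : Fin 14, i < j → j < k → evalForm (fun l => vBasis (u l))
      (pairing z (cliff (vBasis i) (cliff (vBasis j) (cliff (vBasis k) z))) •
        exteriorPower.ιMulti ℂ 3 ![wBasis i, wBasis j, wBasis k]) =
      if i = u 0 then if j = u 1 then if k = u 2 then
        pairing z (cliff (vBasis i) (cliff (vBasis j) (cliff (vBasis k) z))) else 0 else 0 else 0 := by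
    intro i j k hij hjk
    rw [map_smul, evalForm_basis u hu hij hjk]
    simp only [smul_eq_mul, mul_ite, mul_one, mul_zero]
  have h01 : u 0 < u 1 := hu (by decide)
  have h12 : u 1 < u 2 := hu (by decide)
  calc _ = ∑ i, ∑ j ∈ Finset.Ioi i, ∑ k ∈ Finset.Ioi j,
        if i = u 0 then if j = u 1 then if k = u 2 then
        pairing z (cliff (vBasis i) (cliff (vBasis j) (cliff (vBasis k) z))) else 0 else 0 else 0 := by
        refine Finset.sum_congr rfl fun i _ => ?_
        rw [map_sum]
        refine Finset.sum_congr rfl fun j hj => ?_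
        rw [map_sum]
        exact Finset.sum_congr rfl fun k hk => hterm i j k (Finset.mem_Ioi.mp hj)
          (Finset.mem_Ioi.mp hk)
    _ = _ := by
        rw [Finset.sum_eq_single (u 0), Finset.sum_eq_single (u 1), Finset.sum_eq_single (u 2)]
        · simp
        · intro k _ hk
          simp [hk]
        · intro h
          exact absurd (Finset.mem_Ioi.mpr h12) h
        · intro j _ hj
          simp [hj]
        · intro h
          exact absurd (Finset.mem_Ioi.mpr h01) h
        · intro i _ hi
          simp [hi]
        · simp

theorem evalForm_Omega (z : Delta14) (v : Fin 3 → V14) : evalForm v (Omega z) =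
    pairing z (cliff (v 0) (cliff (v 1) (cliff (v 2) z))) := by
  rw [← toForm_apply, toForm_Omega, spinorForm_apply]

theorem Omega_spinRep (g : Spin14Group) (z : Delta14) :
    Omega (spinRep g z) = exteriorPower.map 3 (vecMap g) (Omega z) := by
  refine eq_of_evalForm fun i j k => ?_
  have h : ∀ v : Fin 3 → V14, evalForm v (Omega (spinRep g z)) =
      evalForm v (exteriorPower.map 3 (vecMap g) (Omega z)) := by
    intro v
    have hv : v = fun i => vecMap g (vecMap g⁻¹ (v i)) := by
      ext1 i
      rw [vecMap_apply_inv]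
    rw [hv, evalForm_map _ _ (q_vecMap g), evalForm_Omega, evalForm_Omega, spinRep_coe,
      cliff_vecMap, cliff_vecMap, cliff_vecMap, pairing_spin]
  exact h _

theorem Omega_smul (c : ℂ) (z : Delta14) : Omega (c • z) = c ^ 2 • Omega z := by
  refine eq_of_evalForm fun i j k => ?_
  rw [map_smul, evalForm_Omega, evalForm_Omega, ← pairingBilin_apply, ← pairingBilin_apply,
    Submodule.coe_smul]
  simp only [map_smul, LinearMap.smul_apply, smul_eq_mul]
  ring

/-! ### The quadratic map `Θ` -/

/-- The contraction of a vector with a tensor in `V₁₄ ⊗ ∧²V₁₄`. -/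
def contractLeft (x : V14) : V14 ⊗[ℂ] ⋀[ℂ]^2 V14 →ₗ[ℂ] ⋀[ℂ]^2 V14 :=
  (TensorProduct.lid ℂ _).toLinearMap ∘ₗ LinearMap.rTensor _ (q x)

theorem contractLeft_tmul (x a : V14) (α : ⋀[ℂ]^2 V14) :
    contractLeft x (a ⊗ₜ α) = q x a • α := rfl

theorem polar_ιMulti (v : Fin 3 → V14) : polar (exteriorPower.ιMulti ℂ 3 v) =
    v 0 ⊗ₜ wedge2 (v 1) (v 2) + v 1 ⊗ₜ wedge2 (v 2) (v 0) + v 2 ⊗ₜ wedge2 (v 0) (v 1) := by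
  rw [polar, exteriorPower.alternatingMapLinearEquiv_apply_ιMulti]
  rfl

theorem q2_wedge2 (a b c d : V14) : q2 (wedge2 a b) (wedge2 c d) = q a c * q b d - q a d * q b c := by
  rw [q2, LinearMap.comp_apply, wedge2, wedge2, exteriorPower.map_apply_ιMulti,
    exteriorPower.pairingDual_ιMulti_ιMulti, Matrix.det_fin_two]
  simp
  ring

theorem q_toEnd_contract (S T : V14 ⊗[ℂ] ⋀[ℂ]^2 V14) (x y : V14) :
    q (toEnd (contract (S ⊗ₜ T)) x) y = q2 (contractLeft x S) (contractLeft y T) := by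
  induction S with
  | zero => simp
  | add S S' h h' => simp only [TensorProduct.add_tmul, map_add, LinearMap.add_apply, h, h']
  | tmul a α =>
    induction T with
    | zero => simp
    | add T T' h h' => simp only [TensorProduct.tmul_add, map_add, LinearMap.add_apply, h, h']
    | tmul b β =>
      have h1 : contract ((a ⊗ₜ α) ⊗ₜ (b ⊗ₜ β)) = q2 α β • (a ⊗ₜ[ℂ] b) := by
        simp [contract]
      rw [h1, map_smul, toEnd, contractLeft_tmul, contractLeft_tmul]
      simp only [LinearMap.comp_apply, TensorProduct.map_tmul, LinearMap.id_apply,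
        dualTensorHom_apply, LinearMap.smul_apply, map_smul, smul_eq_mul]
      rw [q_comm a x, q_comm b y]
      ring

theorem q_Theta (ω : ⋀[ℂ]^3 V14) (x y : V14) :
    q (Theta ω x) y = q2 (contractLeft x (polar ω)) (contractLeft y (polar ω)) :=
  q_toEnd_contract _ _ x y

theorem linearMap_ext_wedge2 {N : Type} [AddCommGroup N] [Module ℂ N]
    {f g : ⋀[ℂ]^2 V14 →ₗ[ℂ] N} (h : ∀ a b, f (wedge2 a b) = g (wedge2 a b)) : f = g := by
  refine exteriorPower.linearMap_ext (AlternatingMap.ext fun u => ?_)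
  have hu : u = ![u 0, u 1] := by
    ext i : 1
    fin_cases i <;> rfl
  rw [LinearMap.compAlternatingMap_apply, LinearMap.compAlternatingMap_apply, hu]
  exact h _ _

theorem linearMap_ext_wedge3 {N : Type} [AddCommGroup N] [Module ℂ N]
    {V : Type} [AddCommGroup V] [Module ℂ V] {f g : ⋀[ℂ]^3 V →ₗ[ℂ] N}
    (h : ∀ a b c, f (exteriorPower.ιMulti ℂ 3 ![a, b, c]) = g (exteriorPower.ιMulti ℂ 3 ![a, b, c])) :
    f = g := by
  refine exteriorPower.linearMap_ext (AlternatingMap.ext fun u => ?_)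
  have hu : u = ![u 0, u 1, u 2] := by
    ext i : 1
    fin_cases i <;> rfl
  rw [LinearMap.compAlternatingMap_apply, LinearMap.compAlternatingMap_apply, hu]
  exact h _ _ _

/-- The embedding `polar` is interior multiplication in disguise: contracting its first factor with
x yields the two-vector representing ω(x, ·, ·). Together with `q_Theta`, it expresses Θ through
values of ω. -/
theorem q2_contractLeft_polar (x a b : V14) (ω : ⋀[ℂ]^3 V14) :
    q2 (wedge2 a b) (contractLeft x (polar ω)) = evalForm ![x, a, b] ω := by
  suffices h : q2 (wedge2 a b) ∘ₗ contractLeft x ∘ₗ polar = evalForm ![x, a, b] from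
    LinearMap.congr_fun h ω
  refine linearMap_ext_wedge3 fun c d e => ?_
  rw [LinearMap.comp_apply, LinearMap.comp_apply, polar_ιMulti, evalForm_ιMulti, Matrix.det_fin_three]
  simp only [map_add, contractLeft_tmul, map_smul, smul_eq_mul, q2_wedge2, Matrix.of_apply,
    Matrix.cons_val_zero, Matrix.cons_val_one, Matrix.cons_val]
  ring

theorem q2_map (g : Spin14Group) (α β : ⋀[ℂ]^2 V14) :
    q2 (exteriorPower.map 2 (vecMap g) α) (exteriorPower.map 2 (vecMap g) β) = q2 α β := by
  suffices h : LinearMap.compl₁₂ q2 (exteriorPower.map 2 (vecMap g))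
      (exteriorPower.map 2 (vecMap g)) = q2 from LinearMap.congr_fun₂ h α β
  refine linearMap_ext_wedge2 fun a b => linearMap_ext_wedge2 fun c d => ?_
  have hw : ∀ a b, exteriorPower.map 2 (vecMap g) (wedge2 a b) =
      wedge2 (vecMap g a) (vecMap g b) := fun a b => by
    rw [wedge2, exteriorPower.map_apply_ιMulti, wedge2]
    congr 1
    ext i : 1
    fin_cases i <;> rfl
  rw [LinearMap.compl₁₂_apply, hw, hw, q2_wedge2, q2_wedge2, q_vecMap, q_vecMap, q_vecMap, q_vecMap]

theorem contractLeft_polar_map (g : Spin14Group) (x : V14) (ω : ⋀[ℂ]^3 V14) :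
    contractLeft (vecMap g x) (polar (exteriorPower.map 3 (vecMap g) ω)) =
      exteriorPower.map 2 (vecMap g) (contractLeft x (polar ω)) := by
  suffices h : contractLeft (vecMap g x) ∘ₗ polar ∘ₗ exteriorPower.map 3 (vecMap g) =
      exteriorPower.map 2 (vecMap g) ∘ₗ contractLeft x ∘ₗ polar from LinearMap.congr_fun h ω
  refine linearMap_ext_wedge3 fun a b c => ?_
  have hw : ∀ a b, exteriorPower.map 2 (vecMap g) (wedge2 a b) =
      wedge2 (vecMap g a) (vecMap g b) := fun a b => by
    rw [wedge2, exteriorPower.map_apply_ιMulti, wedge2]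
    congr 1
    ext i : 1
    fin_cases i <;> rfl
  simp only [LinearMap.comp_apply, exteriorPower.map_apply_ιMulti, polar_ιMulti, map_add,
    contractLeft_tmul, map_smul, hw, Function.comp_apply, q_vecMap]

theorem M_spinRep (g : Spin14Group) (z : Delta14) (x : V14) :
    M (spinRep g z) (vecMap g x) = vecMap g (M z x) := by
  refine eq_of_q_eq fun y => ?_
  rw [q_comm, q_comm y, ← vecMap_apply_inv g y, q_vecMap, M, M, q_Theta, q_Theta, Omega_spinRep,
    contractLeft_polar_map, contractLeft_polar_map, q2_map]

theorem M_spinRep_eq (g : Spin14Group) (z : Delta14) :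
    M (spinRep g z) = (vecEquiv g).conj (M z) := by
  refine LinearMap.ext fun x => ?_
  rw [LinearEquiv.conj_apply_apply]
  change _ = vecMap g (M z (vecMap g⁻¹ x))
  rw [← M_spinRep, vecMap_apply_inv]

theorem M_smul (c : ℂ) (z : Delta14) : M (c • z) = c ^ 4 • M z := by
  refine LinearMap.ext fun x => eq_of_q_eq fun y => ?_
  rw [q_comm, q_comm y, LinearMap.smul_apply, map_smul, LinearMap.smul_apply, M, M, q_Theta,
    q_Theta, Omega_smul]
  simp only [map_smul, LinearMap.smul_apply, smul_eq_mul]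
  ring

theorem sum_q_smul (a : V14) : ∑ p, q a (vBasis p) • vBasis (p + 7) = a := by
  have h : ∀ p : Fin 14, p + 7 + 7 = p := by decide
  conv_rhs => rw [← vB.sum_repr a]
  rw [← Equiv.sum_comp (Equiv.addRight (7 : Fin 14))]
  refine Finset.sum_congr rfl fun p _ => ?_
  rw [Equiv.coe_addRight, h, q_comm, q_vBasis_eq_coord, vB_apply]

/-- The sum runs over ordered pairs, so each two-vector of the basis is counted twice. -/
theorem two_smul_eq_sum (α : ⋀[ℂ]^2 V14) : (2 : ℂ) • α =
    ∑ p, ∑ r, q2 (wedge2 (vBasis p) (vBasis r)) α • wedge2 (vBasis (p + 7)) (vBasis (r + 7)) := by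
  let L : ⋀[ℂ]^2 V14 →ₗ[ℂ] ⋀[ℂ]^2 V14 := ∑ p : Fin 14, ∑ r : Fin 14,
    (q2 (wedge2 (vBasis p) (vBasis r))).smulRight (wedge2 (vBasis (p + 7)) (vBasis (r + 7)))
  have hL : ∀ α, L α = ∑ p, ∑ r, q2 (wedge2 (vBasis p) (vBasis r)) α •
      wedge2 (vBasis (p + 7)) (vBasis (r + 7)) := fun α => by
    simp only [L, LinearMap.sum_apply, LinearMap.smulRight_apply]
  rw [← hL]
  suffices h : (2 : ℂ) • LinearMap.id = L from LinearMap.congr_fun h α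
  have hr : ∀ (s : Fin 14 → V14) (b : V14), wedge2 (∑ p, s p) b = ∑ p, wedge2 (s p) b := fun s b =>
    map_sum (⟨⟨fun a => wedge2 a b, fun a a' => wedge2_add_left a a' b⟩,
      fun c a => wedge2_smul_left c a b⟩ : V14 →ₗ[ℂ] ⋀[ℂ]^2 V14) s _
  have hl : ∀ (s : Fin 14 → V14) (b : V14), wedge2 b (∑ p, s p) = ∑ p, wedge2 b (s p) := fun s b =>
    map_sum (⟨⟨fun a => wedge2 b a, fun a a' => wedge2_add_right b a a'⟩,
      fun c a => wedge2_smul_right c b a⟩ : V14 →ₗ[ℂ] ⋀[ℂ]^2 V14) s _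
  have hexp : ∀ a b, wedge2 a b = ∑ p, ∑ r, (q a (vBasis p) * q b (vBasis r)) •
      wedge2 (vBasis (p + 7)) (vBasis (r + 7)) := fun a b => by
    conv_lhs => rw [← sum_q_smul a, ← sum_q_smul b]
    rw [hr]
    refine Finset.sum_congr rfl fun p _ => ?_
    rw [hl]
    refine Finset.sum_congr rfl fun r _ => ?_
    rw [wedge2_smul_left, wedge2_smul_right, smul_smul]
  refine linearMap_ext_wedge2 fun a b => ?_
  rw [LinearMap.smul_apply, LinearMap.id_apply, hL]
  have h2 : (2 : ℂ) • wedge2 a b = wedge2 a b - wedge2 b a := by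
    rw [wedge2_swap a b]
    module
  refine h2.trans ?_
  rw [hexp b a]
  conv_lhs => rw [hexp a b]
  rw [← Finset.sum_sub_distrib]
  refine Finset.sum_congr rfl fun p _ => ?_
  rw [← Finset.sum_sub_distrib]
  refine Finset.sum_congr rfl fun r _ => ?_
  rw [q2_wedge2, q_comm _ a, q_comm _ b, q_comm _ a, q_comm _ b]
  module

/-- The computable form of `M`: its matrix is a contraction of two copies of the table of values of
the three-form. -/
theorem two_mul_q_M (z : Delta14) (x y : V14) : 2 * q (M z x) y = ∑ p, ∑ r,
    pairing z (cliff x (cliff (vBasis p) (cliff (vBasis r) z))) *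
      pairing z (cliff y (cliff (vBasis (p + 7)) (cliff (vBasis (r + 7)) z))) := by
  rw [M, q_Theta, ← smul_eq_mul, ← LinearMap.smul_apply, ← map_smul,
    two_smul_eq_sum (contractLeft x _)]
  simp only [map_sum, map_smul, LinearMap.sum_apply, LinearMap.smul_apply, q2_contractLeft_polar,
    evalForm_Omega, smul_eq_mul]
  rfl

/-! ### The invariant of degree eight -/

theorem isPolyMap_Omega : IsPolyMap Omega := by
  refine IsPolyMap.sum _ fun i _ => IsPolyMap.sum _ fun j _ => IsPolyMap.sum _ fun k _ => ?_
  let L : Delta14 →ₗ[ℂ] Spinors := (halfSpin 0).subtype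
  have h : IsPolyMap fun z : Delta14 =>
      pairingBilin (L z) ((cliff (vBasis i) ∘ₗ cliff (vBasis j) ∘ₗ cliff (vBasis k) ∘ₗ L) z) :=
    (isPolyMap_linear L).bilinear (isPolyMap_linear _) pairingBilin
  exact h.comp_linear (LinearMap.toSpanSingleton ℂ _ _)

theorem isPolyMap_M : IsPolyMap M := by
  have h : IsPolyMap fun z : Delta14 => (TensorProduct.mk ℂ (V14 ⊗[ℂ] ⋀[ℂ]^2 V14)
      (V14 ⊗[ℂ] ⋀[ℂ]^2 V14)) (polar (Omega z)) (polar (Omega z)) :=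
    (isPolyMap_Omega.comp_linear polar).bilinear (isPolyMap_Omega.comp_linear polar) _
  exact h.comp_linear (toEnd ∘ₗ contract)

/-- The octic invariant, `z ↦ tr(M_z²) / 14`. -/
def octic (z : Delta14) : ℂ := LinearMap.trace ℂ V14 (M z * M z) / 14

theorem octic_mem_polyFun : octic ∈ polyFun Delta14 := by
  have h : IsPolyMap fun z : Delta14 => LinearMap.mul ℂ (Module.End ℂ V14) (M z) (M z) :=
    isPolyMap_M.bilinear isPolyMap_M _
  have h2 := (polyFun Delta14).smul_mem (h (LinearMap.trace ℂ V14)) (14⁻¹ : ℂ)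
  have h3 : octic = (14⁻¹ : ℂ) • fun z => LinearMap.trace ℂ V14
      (LinearMap.mul ℂ (Module.End ℂ V14) (M z) (M z)) := by
    ext z
    simp [octic, div_eq_inv_mul]
  rw [h3]
  exact h2

theorem octic_smul (c : ℂ) (z : Delta14) : octic (c • z) = c ^ 8 * octic z := by
  rw [octic, octic, M_smul, smul_mul_smul_comm, map_smul, smul_eq_mul]
  ring

theorem octic_spinRep (g : Spin14Group) (z : Delta14) : octic (spinRep g z) = octic z := by
  rw [octic, octic, M_spinRep_eq, Module.End.mul_eq_comp, ← LinearEquiv.conj_comp,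
    LinearMap.trace_conj', Module.End.mul_eq_comp]

theorem isInvariantOctic_octic : IsInvariantOctic octic :=
  ⟨octic_mem_polyFun, octic_smul, octic_spinRep⟩

/-- The division by 14, the dimension of V₁₄, in `octic` is there for this: it gives `octic z = m ^
2` when M is m times an involution. -/
theorem octic_of_M_sq {z : Delta14} {c : ℂ} (h : M z * M z = c • LinearMap.id) : octic z = c := by
  rw [octic, h, map_smul, LinearMap.trace_id]
  simp

/-! ### Orbits -/

theorem mem_orbitCone_self (z : Delta14) : z ∈ orbitCone z :=
  ⟨1, one_ne_zero, 1, by rw [map_one, Module.End.one_apply, one_smul]⟩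

theorem smul_mem_orbitCone {z w : Delta14} (hw : w ∈ orbitCone z) {c : ℂ} (hc : c ≠ 0) :
    c • w ∈ orbitCone z := by
  obtain ⟨a, ha, g, rfl⟩ := hw
  exact ⟨c * a, mul_ne_zero hc ha, g, by rw [mul_smul]⟩

theorem spinRep_mem_orbitCone {z w : Delta14} (hw : w ∈ orbitCone z) (h : Spin14Group) :
    spinRep h w ∈ orbitCone z := by
  obtain ⟨a, ha, g, rfl⟩ := hw
  exact ⟨a, ha, h * g, by rw [map_smul, map_mul, Module.End.mul_apply]⟩

theorem orbitCone_symm {z w : Delta14} (hw : w ∈ orbitCone z) : z ∈ orbitCone w := by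
  obtain ⟨a, ha, g, rfl⟩ := hw
  exact ⟨a⁻¹, inv_ne_zero ha, g⁻¹, by
    rw [map_smul, spinRep_inv_apply, smul_smul, inv_mul_cancel₀ ha, one_smul]⟩

theorem orbitCone_trans {z w x : Delta14} (hw : w ∈ orbitCone z) (hx : x ∈ orbitCone w) :
    x ∈ orbitCone z := by
  obtain ⟨a, ha, g, rfl⟩ := hx
  exact smul_mem_orbitCone (spinRep_mem_orbitCone hw g) ha

/-! ### The Lie algebra action and lines in orbits -/

/-- The action of the product of two vectors on half-spinors. -/
def biv (u w : V14) : Module.End ℂ Delta14 :=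
  (cliff u * cliff w).restrict fun s hs => by
    have two : (0 : ZMod 2) + 1 + 1 = 0 := by decide
    have := cliff_mem u (cliff_mem w hs)
    rwa [two] at this

theorem biv_coe (u w : V14) (z : Delta14) : (biv u w z : Spinors) = cliff u (cliff w z) := rfl

theorem biv_add_biv (u w : V14) (z : Delta14) : biv u w z + biv w u z = (2 * q u w) • z :=
  Subtype.ext (cliff_anticomm u w z)

theorem biv_self (u : V14) (z : Delta14) : biv u u z = Q u • z :=
  Subtype.ext (cliff_self u z)

theorem biv_add_left (u u' w : V14) (z : Delta14) : biv (u + u') w z = biv u w z + biv u' w z :=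
  Subtype.ext (by simp [biv_coe])

theorem biv_smul_left (c : ℂ) (u w : V14) (z : Delta14) : biv (c • u) w z = c • biv u w z :=
  Subtype.ext (by simp [biv_coe])

theorem biv_add_right (u w w' : V14) (z : Delta14) : biv u (w + w') z = biv u w z + biv u w' z :=
  Subtype.ext (by simp [biv_coe])

theorem biv_smul_right (c : ℂ) (u w : V14) (z : Delta14) : biv u (c • w) z = c • biv u w z :=
  Subtype.ext (by simp [biv_coe])

/-- `biv` as a bilinear map. -/
def bivBilin (z : Delta14) : V14 →ₗ[ℂ] V14 →ₗ[ℂ] Delta14 :=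
  LinearMap.mk₂ ℂ (fun u w => biv u w z) (fun u u' w => biv_add_left u u' w z)
    (fun c u w => biv_smul_left c u w z) (fun u w w' => biv_add_right u w w' z)
    (fun c u w => biv_smul_right c u w z)

theorem bivBilin_apply (z : Delta14) (u w : V14) : bivBilin z u w = biv u w z := rfl

theorem spinRep_biv (g : Spin14Group) (u w : V14) (z : Delta14) :
    spinRep g (biv u w z) = biv (vecMap g u) (vecMap g w) (spinRep g z) := by
  refine Subtype.ext ?_
  rw [spinRep_coe, biv_coe, biv_coe, spinRep_coe, cliff_vecMap, cliff_vecMap]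

theorem spinRep_spinPair' (u w : V14) (h : Q u * Q w = 1) (z : Delta14) :
    spinRep (spinPair u w h) z = biv u w z :=
  Subtype.ext (spinRep_spinPair u w h z)

theorem Q_smul (c : ℂ) (u : V14) : Q (c • u) = c ^ 2 * Q u := by
  rw [QuadraticMap.map_smul, smul_eq_mul, sq]

theorem Q_add (u w : V14) : Q (u + w) = Q u + Q w + 2 * q u w := by
  simp only [Q_eq_q, map_add, LinearMap.add_apply, q_comm w u]
  ring

/-- In the Clifford algebra, (x / Q x)(x + t (Q x) w) = 1 + t x w, and the second factor has the
norm of x because w is isotropic and orthogonal to x. -/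
theorem exists_spinRep_unipotent_of_anisotropic {x w : V14} (hx : Q x ≠ 0) (hw : Q w = 0)
    (hxw : q x w = 0) (t : ℂ) :
    ∃ g : Spin14Group, ∀ z, spinRep g z = z + t • biv x w z := by
  have h1 : Q ((Q x)⁻¹ • x) * Q (x + (t * Q x) • w) = 1 := by
    rw [Q_smul, Q_add, Q_smul, map_smul, hxw, hw]
    field_simp
    simp
  refine ⟨spinPair _ _ h1, fun z => ?_⟩
  rw [spinRep_spinPair', biv_smul_left, biv_add_right, biv_smul_right, biv_self, smul_add,
    smul_smul, smul_smul, inv_mul_cancel₀ hx, one_smul, mul_comm t, ← mul_assoc,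
    inv_mul_cancel₀ hx, one_mul]

/-- The product of 1 + t (u + x) w and 1 − t x w is 1 + t u w, since w anticommutes with x and
squares to zero. -/
theorem exists_spinRep_unipotent {u w x : V14} (hu : Q u = 0) (hw : Q w = 0) (huw : q u w = 0)
    (hx : Q x ≠ 0) (hxu : q x u = 0) (hxw : q x w = 0) (t : ℂ) :
    ∃ g : Spin14Group, ∀ z, spinRep g z = z + t • biv u w z := by
  obtain ⟨g, hg⟩ := exists_spinRep_unipotent_of_anisotropic (x := u + x) (w := w)
    (by rwa [Q_add, hu, q_comm, hxu, mul_zero, add_zero, zero_add]) hw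
    (by rw [map_add, LinearMap.add_apply, huw, hxw, add_zero]) t
  obtain ⟨h, hh⟩ := exists_spinRep_unipotent_of_anisotropic hx hw hxw (-t)
  refine ⟨g * h, fun z => ?_⟩
  have h0 : biv x w (biv x w z) = 0 := by
    refine Subtype.ext ?_
    rw [biv_coe, biv_coe, eq_sub_of_add_eq (cliff_anticomm w x _), cliff_self w, hw, q_comm, hxw]
    simp
  have h1 : biv u w (biv x w z) = 0 := by
    refine Subtype.ext ?_
    rw [biv_coe, biv_coe, eq_sub_of_add_eq (cliff_anticomm w x _), cliff_self w, hw, q_comm, hxw]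
    simp
  rw [map_mul, Module.End.mul_apply, hh, hg, biv_add_left, map_add, map_add, map_smul, map_smul,
    h0, h1]
  module

/-- Supplies an auxiliary anisotropic vector `e_i + f_i` orthogonal to two given basis vectors. -/
theorem exists_anisotropic : ∀ m k : Fin 14, ∃ i : Fin 14, m ≠ i ∧ m ≠ i + 7 ∧ k ≠ i ∧ k ≠ i + 7 ∧
    i ≠ i + 7 ∧ i + 7 + 7 = i := by decide

theorem Q_vBasis (m : Fin 14) : Q (vBasis m) = 0 := by
  have : ∀ m : Fin 14, m ≠ m + 7 := by decide
  rw [Q_eq_q, q_vBasis, if_neg (this m)]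

theorem exists_spinRep_basis_unipotent {m k : Fin 14} (hmk : k ≠ m + 7) (t : ℂ) :
    ∃ g : Spin14Group, ∀ z, spinRep g z = z + t • biv (vBasis m) (vBasis k) z := by
  obtain ⟨i, h1, h2, h3, h4, h5, h6⟩ := exists_anisotropic m k
  refine exists_spinRep_unipotent (x := vBasis i + vBasis (i + 7)) (Q_vBasis m) (Q_vBasis k)
    (by rw [q_vBasis, if_neg hmk]) ?_ ?_ ?_ t
  · rw [Q_add, Q_vBasis, Q_vBasis, q_vBasis, if_pos rfl]
    norm_num
  · rw [map_add, LinearMap.add_apply, q_vBasis, q_vBasis, h6, if_neg h2, if_neg h1, add_zero]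
  · rw [map_add, LinearMap.add_apply, q_vBasis, q_vBasis, h6, if_neg h4, if_neg h3, add_zero]

/-- The operator multiplying `e_S` by `s` if `i ∉ S`, and by `1` otherwise. -/
def dilate (i : Fin 7) (s : ℂ) : Module.End ℂ Delta14 :=
  LinearMap.id + ((s - 1) / 2) • biv (vBasis (Fin.natAdd 7 i)) (vBasis (Fin.castAdd 7 i))

theorem dilate_apply (i : Fin 7) (s : ℂ) (z : Delta14) : dilate i s z =
    z + ((s - 1) / 2) • biv (vBasis (Fin.natAdd 7 i)) (vBasis (Fin.castAdd 7 i)) z := rfl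

/-- The vectors e + r² f and e + f have norms 2r² and 2. Their product divided by 2r is a spin
element acting by r⁻¹ on monomials containing `i` and by r on the others; multiplication by r gives
the dilation. -/
theorem exists_spinRep_dilate (i : Fin 7) {r : ℂ} (hr : r ≠ 0) :
    ∃ g : Spin14Group, ∀ z, dilate i (r ^ 2) z = r • spinRep g z := by
  set e := vBasis (Fin.castAdd 7 i)
  set f := vBasis (Fin.natAdd 7 i)
  have he : Q e = 0 := Q_vBasis _
  have hf : Q f = 0 := Q_vBasis _
  have hef : q e f = 1 := by rw [q_vBasis, castAdd_add_seven, if_pos rfl]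
  have h : Q ((2 * r)⁻¹ • (e + r ^ 2 • f)) * Q (e + f) = 1 := by
    rw [Q_smul, Q_add, Q_add, Q_smul, map_smul, he, hf, hef, smul_eq_mul]
    field_simp
    ring
  refine ⟨spinPair _ _ h, fun z => ?_⟩
  have h1 : biv e f z = (2 : ℂ) • z - biv f e z := by
    rw [eq_sub_iff_add_eq, biv_add_biv, hef, mul_one]
  rw [spinRep_spinPair', dilate_apply, biv_smul_left, biv_add_left, biv_add_right, biv_add_right,
    biv_smul_left, biv_smul_left, biv_self, biv_self, he, hf, h1]
  match_scalars <;> field_simp <;> ring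

theorem dilate_mem_orbitCone {z w : Delta14} (hw : w ∈ orbitCone z) (i : Fin 7) {s : ℂ}
    (hs : s ≠ 0) : dilate i s w ∈ orbitCone z := by
  obtain ⟨r, rfl⟩ := IsAlgClosed.exists_pow_nat_eq s two_pos
  have hr : r ≠ 0 := fun h => hs (by rw [h]; ring)
  obtain ⟨g, hg⟩ := exists_spinRep_dilate i hr
  rw [hg]
  exact smul_mem_orbitCone (spinRep_mem_orbitCone hw g) hr

theorem octic_dilate (i : Fin 7) {s : ℂ} (hs : s ≠ 0) (z : Delta14) :
    octic (dilate i s z) = s ^ 4 * octic z := by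
  obtain ⟨r, rfl⟩ := IsAlgClosed.exists_pow_nat_eq s two_pos
  have hr : r ≠ 0 := fun h => hs (by rw [h]; ring)
  obtain ⟨g, hg⟩ := exists_spinRep_dilate i hr
  rw [hg, octic_smul, octic_spinRep]
  ring

/-- The tangent space at `z` of the cone over its orbit. -/
def tangentSpace (z : Delta14) : Submodule ℂ Delta14 :=
  Submodule.span ℂ (Set.range fun mk : Fin 14 × Fin 14 => biv (vBasis mk.1) (vBasis mk.2) z)

theorem biv_mem_tangentSpace (u w : V14) (z : Delta14) : biv u w z ∈ tangentSpace z := by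
  rw [← bivBilin_apply, ← vB.sum_repr u, ← vB.sum_repr w]
  simp only [map_sum, LinearMap.sum_apply, map_smul, LinearMap.smul_apply, vB_apply, bivBilin_apply]
  exact sum_mem fun m _ => Submodule.smul_mem _ _ (sum_mem fun k _ => Submodule.smul_mem _ _
    (Submodule.subset_span ⟨(k, m), rfl⟩))

theorem tangentSpace_spinRep (g : Spin14Group) (z : Delta14) :
    (tangentSpace z).map (spinRep g) ≤ tangentSpace (spinRep g z) := by
  rw [tangentSpace, Submodule.map_span_le]
  rintro _ ⟨⟨m, k⟩, rfl⟩
  rw [spinRep_biv]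
  exact biv_mem_tangentSpace _ _ _

theorem tangentSpace_smul {c : ℂ} (hc : c ≠ 0) (z : Delta14) :
    tangentSpace z ≤ tangentSpace (c • z) := by
  rw [tangentSpace, Submodule.span_le]
  rintro _ ⟨⟨m, k⟩, rfl⟩
  have h := Submodule.smul_mem _ c⁻¹ (biv_mem_tangentSpace (vBasis m) (vBasis k) (c • z))
  rwa [map_smul, smul_smul, inv_mul_cancel₀ hc, one_smul] at h

/-- For indices which are not dual, the product of two basis vectors generates a unipotent group
whose orbit is a line. For f_i e_i the line consists of dilations as long as 1 + 2t ≠ 0. The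
reversed product e_i f_i differs from −f_i e_i by a scalar, and the cone is stable under scaling. -/
theorem tangentSpace_le_span_lineDirections {z w : Delta14} (hw : w ∈ orbitCone z) :
    tangentSpace w ≤ Submodule.span ℂ (lineDirections (orbitCone z) w) := by
  have hself : w ∈ Submodule.span ℂ (lineDirections (orbitCone z) w) := by
    refine Submodule.subset_span ?_
    have h : ∀ᶠ t in 𝓝 (0 : ℂ), 1 + t ≠ 0 :=
      (continuous_const.add continuous_id).continuousAt.eventually_ne (by simp)
    filter_upwards [h] with t ht
    have := smul_mem_orbitCone hw ht
    rwa [add_smul, one_smul] at this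
  have hopp : ∀ i : Fin 7, biv (vBasis (Fin.natAdd 7 i)) (vBasis (Fin.castAdd 7 i)) w ∈
      Submodule.span ℂ (lineDirections (orbitCone z) w) := by
    intro i
    refine Submodule.subset_span ?_
    have h : ∀ᶠ t in 𝓝 (0 : ℂ), 1 + 2 * t ≠ 0 :=
      (continuous_const.add (continuous_const.mul continuous_id)).continuousAt.eventually_ne
        (by simp)
    filter_upwards [h] with t ht
    have := dilate_mem_orbitCone hw i ht
    rwa [dilate_apply, show (1 + 2 * t - 1) / 2 = t by ring] at this
  rw [tangentSpace, Submodule.span_le]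
  rintro _ ⟨⟨m, k⟩, rfl⟩
  change biv (vBasis m) (vBasis k) w ∈ _
  by_cases hmk : k = m + 7
  · subst hmk
    refine Fin.addCases (m := 7) (n := 7) (fun i => ?_) (fun i => ?_) m
    · rw [castAdd_add_seven, eq_sub_of_add_eq (biv_add_biv _ _ w)]
      exact sub_mem (Submodule.smul_mem _ _ hself) (hopp i)
    · rw [natAdd_add_seven]
      exact hopp i
  · refine Submodule.subset_span (Filter.Eventually.of_forall fun t => ?_)
    obtain ⟨g, hg⟩ := exists_spinRep_basis_unipotent hmk t
    rw [← hg]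
    exact spinRep_mem_orbitCone hw g

theorem span_lineDirections_eq_top {z w : Delta14} (hz : tangentSpace z = ⊤)
    (hw : w ∈ orbitCone z) : Submodule.span ℂ (lineDirections (orbitCone z) w) = ⊤ := by
  refine top_le_iff.mp (le_trans ?_ (tangentSpace_le_span_lineDirections hw))
  obtain ⟨c, hc, g, rfl⟩ := hw
  refine le_trans (le_trans ?_ (tangentSpace_spinRep g z)) (tangentSpace_smul hc _)
  rw [hz]
  intro x _
  exact ⟨spinRep g⁻¹ x, trivial, spinRep_apply_inv g x⟩

theorem polyFun_eq_zero_of_orbitCone {z : Delta14} (hz : tangentSpace z = ⊤) {f : Delta14 → ℂ}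
    (hf : f ∈ polyFun Delta14) (h : ∀ w ∈ orbitCone z, f w = 0) : f = 0 :=
  polyFun_eq_zero ⟨z, mem_orbitCone_self z⟩ (fun _ hw => span_lineDirections_eq_top hz hw) hf h

/-- If the orbits were disjoint, a polynomial nonzero at `w` and vanishing off the cone of `w` would
vanish on the cone of `z`, hence everywhere. -/
theorem mem_orbitCone_of_inOpenOrbit {z w : Delta14} (hz : tangentSpace z = ⊤)
    (hw : InOpenOrbit w) : w ∈ orbitCone z := by
  obtain ⟨-, I, hI, hU⟩ := hw
  have hself : w ∈ orbitCone w := mem_orbitCone_self w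
  rw [hU] at hself
  obtain ⟨f, hf, hfw⟩ := hself
  by_contra hn
  have h0 : f = 0 := polyFun_eq_zero_of_orbitCone hz (hI f hf) fun x hx => by
    by_contra hfx
    have hxw : x ∈ orbitCone w := by
      rw [hU]
      exact ⟨f, hf, hfx⟩
    exact hn (orbitCone_trans hx (orbitCone_symm hxw))
  exact hfw (by rw [h0]; rfl)

/-- Both octics scale in the same way on the cone over the orbit of `z`, so the combination
vanishing at `z` vanishes on the whole cone. -/
theorem eq_smul_of_isInvariantOctic {z : Delta14} (hz : tangentSpace z = ⊤) {J J' : Delta14 → ℂ}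
    (hJ : IsInvariantOctic J) (hJ' : IsInvariantOctic J') (h0 : J z ≠ 0) :
    J' = (J' z / J z) • J := by
  rw [← sub_eq_zero]
  refine polyFun_eq_zero_of_orbitCone hz ((polyFun Delta14).sub_mem hJ'.polynomial
    ((polyFun Delta14).smul_mem hJ.polynomial _)) ?_
  rintro _ ⟨c, hc, g, rfl⟩
  rw [Pi.sub_apply, Pi.smul_apply, hJ.homogeneous, hJ'.homogeneous, hJ.invariant, hJ'.invariant,
    smul_eq_mul]
  field_simp
  ring

/-! ### Coordinates on the half-spin representation -/

/-- The bitmasks of the subsets of even cardinality. -/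
abbrev EvenMask : Type := {n : Fin 128 // (bitCount n : ZMod 2) = 0}

/-- Coordinates on `Δ₁₄`. -/
def deltaEquiv : Delta14 ≃ₗ[ℂ] (EvenMask → ℂ) where
  toFun z n := coordMap z n.1
  invFun c := ⟨spinorEquiv.symm fun n => if h : (bitCount n : ZMod 2) = 0 then c ⟨n, h⟩ else 0, by
    refine mem_halfSpin_zero fun n hn => ?_
    rw [← spinorEquiv_apply, LinearEquiv.apply_symm_apply, dif_neg hn]⟩
  left_inv z := by
    refine Subtype.ext (spinorEquiv.symm_apply_eq.mpr (funext fun n => ?_))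
    rw [spinorEquiv_apply]
    split_ifs with h
    · rfl
    · exact (coordMap_parity z.2 n h).symm
  right_inv c := by
    ext n
    change spinorEquiv (spinorEquiv.symm _) n.1 = _
    rw [LinearEquiv.apply_symm_apply, dif_pos n.2]
  map_add' z w := by
    ext n
    rw [Submodule.coe_add, map_add]
    rfl
  map_smul' c z := by
    ext n
    rw [Submodule.coe_smul, map_smul]
    rfl

/-- The monomial basis of `Δ₁₄`. -/
def deltaBasis : Module.Basis EvenMask ℂ Delta14 := Module.Basis.ofEquivFun deltaEquiv

theorem deltaBasis_repr (z : Delta14) (n : EvenMask) : deltaBasis.repr z n = coordMap z n.1 := rfl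

theorem delta_ext {z w : Delta14}
    (h : ∀ n : Fin 128, (bitCount n : ZMod 2) = 0 → coordMap z n = coordMap w n) : z = w :=
  deltaEquiv.injective (funext fun n => h n.1 n.2)

theorem coordMap_deltaBasis (n : EvenMask) : coordMap (deltaBasis n) = Pi.single n.1 1 := by
  ext k
  by_cases hk : (bitCount k : ZMod 2) = 0
  · have h := congrFun (deltaBasis.equivFun.apply_symm_apply (Pi.single n 1)) ⟨k, hk⟩
    rw [Module.Basis.equivFun_symm_apply] at h
    simp only [Pi.single_apply, ite_smul, one_smul, zero_smul, Finset.sum_ite_eq',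
      Finset.mem_univ, if_true, Module.Basis.equivFun_apply, deltaBasis_repr] at h
    rw [h, Pi.single_apply]
    simp only [Subtype.ext_iff]
  · rw [coordMap_parity (deltaBasis n).2 k hk, Pi.single_eq_of_ne fun h => hk (by rw [h, n.2])]

theorem coordMap_biv (m k : Fin 14) (z : Delta14) :
    coordMap (biv (vBasis m) (vBasis k) z) = gen ℂ m (gen ℂ k (coordMap z)) := by
  rw [biv_coe, coordMap_cliff, coordMap_cliff, op_vBasis, op_vBasis]

/-! ### The representatives of the orbits -/

/-- The bit at `n` says whether `n` is the bitmask of the complement of one of the lines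
`{i, i + 1, i + 3}` of the Fano plane. -/
def quadMask : ℕ := 83117314565738183697387452905816064

/-- The coordinates of the sum of `a` and of the monomials of the complements of lines. -/
def fanoCoord (a : ℤ) (n : Fin 128) : ℤ :=
  bif Nat.beq n.val 0 then a else bif bitAt quadMask n.val then Int.ofNat 1 else Int.ofNat 0

theorem fanoCoord_eq (a : ℤ) (n : Fin 128) :
    fanoCoord a n = if n = 0 then a else if quadMask.testBit n then 1 else 0 := by
  have h : ∀ n : Fin 128, Nat.beq n.val 0 = decide (n = 0) ∧
      bitAt quadMask n.val = quadMask.testBit n := by decide +kernel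
  rw [fanoCoord, (h n).1, (h n).2, Bool.cond_decide]
  cases quadMask.testBit n <;> rfl

theorem quadMask_parity : ∀ n : Fin 128, quadMask.testBit n = true →
    (bitCount n : ZMod 2) = 0 ∧ n ≠ 0 := by
  decide +kernel

/-- The sum of the scalar `a` and of the monomials of the complements of lines. -/
def fanoSpinor (a : ℤ) : Delta14 :=
  ⟨spinorEquiv.symm fun n => (fanoCoord a n : ℂ), by
    refine mem_halfSpin_zero fun n hn => ?_
    rw [← spinorEquiv_apply, LinearEquiv.apply_symm_apply, fanoCoord_eq, if_neg fun h => hn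
      (by rw [h]; rfl), if_neg fun h => hn (quadMask_parity n h).1, Int.cast_zero]⟩

theorem coordMap_fanoSpinor (a : ℤ) : coordMap (fanoSpinor a) = fun n => (fanoCoord a n : ℂ) := by
  rw [← spinorEquiv_apply, fanoSpinor, LinearEquiv.apply_symm_apply]

/-- For each nonzero even bitmask, a combination of products of two basis vectors which takes
`fanoSpinor 0` to a multiple of the corresponding monomial. -/
def monomialTable : List (Fin 128 × List (Fin 14 × Fin 14 × ℤ)) :=
  [(3, [(7, 8, -1), (9, 12, -1), (11, 13, -1)]), (5, [(7, 9, -1), (8, 12, 1), (10, 11, -1)]),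
   (6, [(7, 12, -1), (8, 9, -1), (10, 13, -1)]), (9, [(7, 10, -1), (9, 11, 1), (12, 13, -1)]),
   (10, [(8, 10, -1), (9, 13, 1), (11, 12, -1)]), (12, [(7, 11, -1), (8, 13, -1), (9, 10, -1)]),
   (15, [(0, 13, -2), (1, 11, 2), (5, 10, 2)]), (17, [(7, 11, -1), (8, 13, 1), (9, 10, -1)]),
   (18, [(7, 13, -1), (8, 11, -1), (10, 12, 1)]), (20, [(7, 10, 1), (9, 11, -1), (12, 13, -1)]),
   (23, [(1, 10, -2), (2, 13, -2), (5, 11, 2)]), (24, [(7, 9, -1), (8, 12, -1), (10, 11, -1)]),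
   (27, [(0, 12, -2), (1, 9, 2), (6, 10, -2)]),
   (29, [(0, 7, 1), (1, 8, -1), (2, 9, 1), (3, 10, 1), (4, 11, 1), (5, 12, -1), (6, 13, -1)]),
   (30, [(0, 8, 2), (2, 12, 2), (4, 13, 2)]), (33, [(7, 12, -1), (8, 9, -1), (10, 13, 1)]),
   (34, [(7, 9, 1), (8, 12, -1), (10, 11, -1)]), (36, [(7, 8, -1), (9, 12, -1), (11, 13, 1)]),
   (39, [(0, 7, 1), (1, 8, 1), (2, 9, 1), (3, 10, -1), (4, 11, -1), (5, 12, 1), (6, 13, -1)]),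
   (40, [(7, 13, -1), (8, 11, 1), (10, 12, -1)]), (43, [(0, 11, 2), (1, 13, 2), (2, 10, 2)]),
   (45, [(1, 10, -2), (2, 13, 2), (5, 11, 2)]), (46, [(0, 10, 2), (2, 11, -2), (5, 13, 2)]),
   (48, [(8, 10, -1), (9, 13, -1), (11, 12, -1)]), (51, [(0, 10, -2), (2, 11, 2), (5, 13, 2)]),
   (53, [(0, 13, -2), (1, 11, -2), (5, 10, -2)]), (54, [(0, 11, 2), (1, 13, -2), (2, 10, 2)]),
   (57, [(0, 8, 2), (2, 12, 2), (4, 13, -2)]),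
   (58, [(0, 7, -1), (1, 8, 1), (2, 9, -1), (3, 10, 1), (4, 11, 1), (5, 12, 1), (6, 13, -1)]),
   (60, [(0, 12, -2), (2, 8, 2), (3, 13, 2)]), (63, [(0, 2, -8)]),
   (65, [(7, 13, -1), (8, 11, -1), (10, 12, -1)]), (66, [(7, 11, 1), (8, 13, -1), (9, 10, -1)]),
   (68, [(8, 10, 1), (9, 13, -1), (11, 12, -1)]), (71, [(0, 10, 2), (2, 11, 2), (5, 13, 2)]),
   (72, [(7, 12, 1), (8, 9, -1), (10, 13, -1)]), (75, [(0, 9, -2), (1, 12, -2), (4, 10, 2)]),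
   (77, [(0, 8, 2), (2, 12, -2), (4, 13, 2)]),
   (78, [(0, 7, -1), (1, 8, 1), (2, 9, 1), (3, 10, 1), (4, 11, -1), (5, 12, -1), (6, 13, 1)]),
   (80, [(7, 8, -1), (9, 12, 1), (11, 13, -1)]),
   (83, [(0, 7, 1), (1, 8, 1), (2, 9, -1), (3, 10, -1), (4, 11, 1), (5, 12, -1), (6, 13, 1)]),
   (85, [(0, 12, 2), (1, 9, 2), (6, 10, -2)]), (86, [(0, 9, -2), (1, 12, 2), (4, 10, 2)]),
   (89, [(1, 10, 2), (4, 12, 2), (6, 9, 2)]), (90, [(0, 10, -2), (4, 9, -2), (6, 12, 2)]),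
   (92, [(0, 13, -2), (3, 12, -2), (4, 8, 2)]), (95, [(0, 4, -8)]),
   (96, [(7, 10, -1), (9, 11, -1), (12, 13, -1)]), (99, [(1, 10, 2), (2, 13, -2), (5, 11, 2)]),
   (101, [(0, 11, -2), (1, 13, 2), (2, 10, 2)]), (102, [(0, 13, -2), (1, 11, -2), (5, 10, 2)]),
   (105, [(0, 7, 1), (1, 8, -1), (2, 9, -1), (3, 10, 1), (4, 11, -1), (5, 12, 1), (6, 13, 1)]),
   (106, [(0, 8, 2), (5, 9, -2), (6, 11, -2)]), (108, [(0, 9, 2), (3, 11, 2), (5, 8, 2)]),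
   (111, [(0, 5, -8)]), (113, [(0, 9, 2), (1, 12, -2), (4, 10, 2)]),
   (114, [(0, 12, 2), (1, 9, 2), (6, 10, 2)]),
   (116, [(0, 7, -1), (1, 8, -1), (2, 9, 1), (3, 10, -1), (4, 11, 1), (5, 12, 1), (6, 13, 1)]),
   (119, [(0, 1, 8)]), (120, [(0, 11, -2), (3, 9, 2), (6, 8, -2)]), (123, [(0, 6, 8)]),
   (125, [(0, 3, -8)]), (126, [(1, 3, -8)])]
/-- The value at `n` of a combination of products of two basis vectors. -/
def evalCombination (L : List (Fin 14 × Fin 14 × ℤ)) (s : Fin 128 → ℤ) (n : Fin 128) : ℤ :=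
  (L.map fun x => x.2.2 * gen ℤ x.1 (gen ℤ x.2.1 s) n).sum

/-- Each entry is a certificate: its combination sends `fanoSpinor 0` to 8 times a monomial.
Together they show that the tangent space contains every even monomial of positive degree. -/
theorem monomialTable_spec : ∀ x ∈ monomialTable, ∀ n : Fin 128,
    evalCombination x.2 (fanoCoord 0) n = if n = x.1 then 8 else 0 := by
  simp only [evalCombination, gen_eq_skipGen]
  decide +kernel

theorem monomialTable_complete : ∀ n : Fin 128, (bitCount n : ZMod 2) = 0 → n ≠ 0 →
    ∃ x ∈ monomialTable, x.1 = n := by decide +kernel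

theorem evalCombination_mem (L : List (Fin 14 × Fin 14 × ℤ)) (a : ℤ) :
    ∃ w ∈ tangentSpace (fanoSpinor a), ∀ n,
      coordMap w n = (evalCombination L (fanoCoord a) n : ℂ) := by
  induction L with
  | nil => exact ⟨0, zero_mem _, fun n => by simp [evalCombination]⟩
  | cons x L ih =>
    obtain ⟨w, hw, h⟩ := ih
    refine ⟨(x.2.2 : ℂ) • biv (vBasis x.1) (vBasis x.2.1) (fanoSpinor a) + w,
      add_mem (Submodule.smul_mem _ _ (biv_mem_tangentSpace _ _ _)) hw, fun n => ?_⟩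
    rw [Submodule.coe_add, Submodule.coe_smul, map_add, map_smul, coordMap_biv,
      coordMap_fanoSpinor, gen_cast, gen_cast, Pi.add_apply, Pi.smul_apply, h, evalCombination,
      evalCombination, List.map_cons, List.sum_cons]
    push_cast
    rfl

theorem deltaBasis_mem_tangentSpace {a c : ℤ} (hc : c ≠ 0) {L : List (Fin 14 × Fin 14 × ℤ)}
    {k : EvenMask} (h : ∀ n : Fin 128, evalCombination L (fanoCoord a) n = if n = k.1 then c else 0) :
    deltaBasis k ∈ tangentSpace (fanoSpinor a) := by
  obtain ⟨w, hw, hwL⟩ := evalCombination_mem L a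
  have h1 : deltaBasis k = (c : ℂ)⁻¹ • w := by
    refine delta_ext fun n _ => ?_
    rw [coordMap_deltaBasis, Submodule.coe_smul, map_smul, Pi.smul_apply, hwL, h, Pi.single_apply]
    split_ifs
    · have : (c : ℂ) ≠ 0 := by exact_mod_cast hc
      rw [smul_eq_mul, inv_mul_cancel₀ this]
    · simp
  rw [h1]
  exact Submodule.smul_mem _ _ hw

theorem deltaBasis_mem_tangentSpace_zero {k : EvenMask} (hk : k.1 ≠ 0) :
    deltaBasis k ∈ tangentSpace (fanoSpinor 0) := by
  obtain ⟨x, hx, hxk⟩ := monomialTable_complete k.1 k.2 hk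
  refine deltaBasis_mem_tangentSpace (c := 8) (by decide) (L := x.2) fun n => ?_
  rw [monomialTable_spec x hx n, hxk]

/-- The combination of products of two basis vectors which takes `fanoSpinor 4` to the same
spinor as a given one does `fanoSpinor 0`, when products of two elements of `E` are corrected. -/
def correction (x : Fin 14 × Fin 14 × ℤ) : List (Fin 14 × Fin 14 × ℤ) :=
  -- Only a product e_i e_j sees the additional scalar 4. With coefficient 2c it produces the extra
  -- term 8c e_i ∧ e_j, which is cancelled by −c times the certificate for that two-element subset.
  -- The certificates for two-element subsets use products of elements of F, which annihilate
  -- scalars. The doubling turns the factor 8 into 16.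
  if x.2.1 < 7 ∧ x.1 < x.2.1 then
    (x.1, x.2.1, 2 * x.2.2) :: ((monomialTable.lookup
      (Fin.ofNat 128 (2 ^ x.1.val + 2 ^ x.2.1.val))).getD []).map fun y => (y.1, y.2.1, -x.2.2 * y.2.2)
  else [(x.1, x.2.1, 2 * x.2.2)]

theorem correction_spec : ∀ x ∈ monomialTable, ∀ n : Fin 128,
    evalCombination (x.2.flatMap correction) (fanoCoord 4) n = if n = x.1 then 16 else 0 := by
  simp only [evalCombination, gen_eq_skipGen]
  decide +kernel

/-- A combination of products of two basis vectors taking `fanoSpinor 4` to a scalar. -/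
def scalarCombination : List (Fin 14 × Fin 14 × ℤ) :=
  [(7, 0, 4), (0, 7, 3), (1, 8, -1), (2, 9, -1), (3, 10, -1), (4, 11, -1), (5, 12, -1), (6, 13, -1)]

theorem scalarCombination_spec : ∀ n : Fin 128,
    evalCombination scalarCombination (fanoCoord 4) n = if n = 0 then 32 else 0 := by
  simp only [evalCombination, gen_eq_skipGen]
  decide +kernel

/-- The corrected certificates give the monomials of positive degree, and `scalarCombination` the
remaining scalar direction. -/
theorem tangentSpace_fanoSpinor_four : tangentSpace (fanoSpinor 4) = ⊤ := by
  rw [← top_le_iff, ← deltaBasis.span_eq, Submodule.span_le]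
  rintro _ ⟨k, rfl⟩
  by_cases hk : k.1 = 0
  · refine deltaBasis_mem_tangentSpace (c := 32) (by decide) (L := scalarCombination) fun n => ?_
    rw [scalarCombination_spec, hk]
  · obtain ⟨x, hx, hxk⟩ := monomialTable_complete k.1 k.2 hk
    refine deltaBasis_mem_tangentSpace (c := 16) (by decide) (L := x.2.flatMap correction)
      fun n => ?_
    rw [correction_spec x hx n, hxk]

/-! ### Values of the forms -/

/-- `fanoPos.testBit (i + 7 j + 49 k)` says whether `(i, j, k)` is a positively oriented line. -/
def fanoPos : ℕ := 0x2000040101000200400000000080080202010000000010100010002000040080400000008000100400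

/-- `fanoNeg.testBit (i + 7 j + 49 k)` says whether `(i, j, k)` is a negatively oriented line. -/
def fanoNeg : ℕ := 0x40080100000000010040202008000002000002000400400010080000101000000080010100200400000

/-- The orientation of a triple of points of the Fano plane, zero if it is not a line. -/
def fanoSign (n : ℕ) : ℤ := 
  bif bitAt fanoPos n then Int.ofNat 1 else bif bitAt fanoNeg n then Int.negSucc 0 else Int.ofNat 0

/-- The values of the form `(u, v, w) ↦ ⟨z, u v w z⟩` on the basis, for `z = fanoSpinor a`. -/
def tripleValue (a : ℤ) (i j k : Fin 14) : ℤ :=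
  let m := Nat.add (Nat.div i.val 7) (Nat.add (Nat.div j.val 7) (Nat.div k.val 7))
  skipMul (fanoSign (Nat.add (Nat.mod i.val 7) (Nat.mul 7 (Nat.add (Nat.mod j.val 7)
    (Nat.mul 7 (Nat.mod k.val 7))))))
      -- With `m` the number of factors in F, the form takes the values ±8 on lines when `m` is 2,
      -- and ±2a when `m` is 0. The choice a = 4 makes them equal, so that E and F play symmetric
      -- roles up to duality.
      (bif Nat.beq m 2 then Int.ofNat 8 else bif Nat.beq m 0 then Int.mul (Int.ofNat 2) a
        else Int.ofNat 0)

/-- The masks where `fanoCoord a` may be nonzero. -/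
def fanoSupport : List (Fin 128) := [0, 116, 105, 83, 39, 78, 29, 58]

/-- Restricts the sum to the eight masks in the support, so that the kernel evaluates 8 terms rather
than 128. -/
theorem pairCoord_fanoCoord (a : ℤ) (t : Fin 128 → ℤ) : pairCoord ℤ (fanoCoord a) t =
    (fanoSupport.map fun n : Fin 128 => pairSign n * fanoCoord a n * t n.rev).sum := by
  have h : ∀ n : Fin 128, n ∉ fanoSupport.toFinset → n ≠ 0 ∧ quadMask.testBit n = false := by
    decide +kernel
  have h2 : fanoSupport.Nodup := by decide
  rw [← List.sum_toFinset _ h2, pairCoord]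
  symm
  refine Finset.sum_subset (Finset.subset_univ _) fun n _ hn => ?_
  rw [fanoCoord_eq, if_neg (h n hn).1, (h n hn).2]
  simp

theorem tripleValue_spec_four : ∀ i j k : Fin 14, (fanoSupport.map fun n : Fin 128 => pairSign n *
    fanoCoord 4 n * gen ℤ i (gen ℤ j (gen ℤ k (fanoCoord 4))) n.rev).sum = tripleValue 4 i j k := by
  simp only [gen_eq_skipGen]
  decide +kernel

theorem tripleValue_spec_zero : ∀ i j k : Fin 14, (fanoSupport.map fun n : Fin 128 => pairSign n *
    fanoCoord 0 n * gen ℤ i (gen ℤ j (gen ℤ k (fanoCoord 0))) n.rev).sum = tripleValue 0 i j k := by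
  simp only [gen_eq_skipGen]
  decide +kernel

theorem pairCoord_cast (s t : Fin 128 → ℤ) :
    pairCoord ℂ (fun n => (s n : ℂ)) (fun n => (t n : ℂ)) = (pairCoord ℤ s t : ℂ) := by
  simp [pairCoord]

theorem pairing_fanoSpinor {a : ℤ} (ha : a = 4 ∨ a = 0) (i j k : Fin 14) :
    pairing (fanoSpinor a) (cliff (vBasis i) (cliff (vBasis j) (cliff (vBasis k) (fanoSpinor a)))) =
      (tripleValue a i j k : ℂ) := by
  rw [pairing_eq, coordMap_cliff, coordMap_cliff, coordMap_cliff, op_vBasis, op_vBasis, op_vBasis,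
    coordMap_fanoSpinor, gen_cast, gen_cast, gen_cast, pairCoord_cast, pairCoord_fanoCoord]
  rcases ha with rfl | rfl
  · rw [tripleValue_spec_four]
  · rw [tripleValue_spec_zero]

/-! ### The endomorphism and the three-form at the representatives -/

/-- A point lies on three lines, hence begins six ordered lines; each allows two distributions of
the other indices between E and F, and 6 · 2 · 8² = 768, twice the eigenvalue 384. -/
theorem tripleValue_sum_four : ∀ m n : Fin 14, ∑ p : Fin 14, ∑ r : Fin 14,
    tripleValue 4 m p r * tripleValue 4 n (p + 7) (r + 7) = if n = m then 768 else 0 := by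
  simp only [← skipMul_eq]
  decide +kernel

/-- For an index in E the other two must both lie in F; passing to their duals leaves all three in
E, where the form now vanishes. For an index in F the count is that of the case a = 4. -/
theorem tripleValue_sum_zero : ∀ m n : Fin 14, ∑ p : Fin 14, ∑ r : Fin 14,
    tripleValue 0 m p r * tripleValue 0 n (p + 7) (r + 7) =
      if n = m ∧ 7 ≤ m then 768 else 0 := by
  simp only [← skipMul_eq]
  decide +kernel

theorem q_M_fanoSpinor {a : ℤ} (ha : a = 4 ∨ a = 0) (m n : Fin 14) :
    2 * q (M (fanoSpinor a) (vBasis m)) (vBasis n) = ((∑ p : Fin 14, ∑ r : Fin 14,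
      tripleValue a m p r * tripleValue a n (p + 7) (r + 7) : ℤ) : ℂ) := by
  rw [two_mul_q_M]
  push_cast
  simp only [pairing_fanoSpinor ha]

theorem M_fanoSpinor_four_basis (m : Fin 14) :
    M (fanoSpinor 4) (vBasis m) = (384 : ℂ) • vBasis (m + 7) := by
  have h7 : m + 7 + 7 = m := by revert m; decide
  refine eq_of_q_eq fun u => ?_
  suffices h : q (M (fanoSpinor 4) (vBasis m)) = q ((384 : ℂ) • vBasis (m + 7)) by
    rw [q_comm, h, q_comm]
  refine vB.ext fun n => ?_
  have h := q_M_fanoSpinor (Or.inl rfl : (4 : ℤ) = 4 ∨ (4 : ℤ) = 0) m n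
  rw [tripleValue_sum_four] at h
  rw [vB_apply, map_smul, LinearMap.smul_apply, q_vBasis, h7]
  refine mul_left_cancel₀ (two_ne_zero (α := ℂ)) (h.trans ?_)
  split_ifs
  · norm_num
  · simp

theorem M_fanoSpinor_zero_basis (m : Fin 14) :
    M (fanoSpinor 0) (vBasis m) = if 7 ≤ m then (384 : ℂ) • vBasis (m + 7) else 0 := by
  have h7 : m + 7 + 7 = m := by revert m; decide
  refine eq_of_q_eq fun u => ?_
  suffices h : q (M (fanoSpinor 0) (vBasis m)) =
      q (if 7 ≤ m then (384 : ℂ) • vBasis (m + 7) else 0) by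
    rw [q_comm, h, q_comm]
  refine vB.ext fun n => ?_
  have h := q_M_fanoSpinor (Or.inr rfl : (0 : ℤ) = 4 ∨ (0 : ℤ) = 0) m n
  rw [tripleValue_sum_zero] at h
  refine mul_left_cancel₀ (two_ne_zero (α := ℂ)) ?_
  rw [vB_apply, h]
  by_cases hm : 7 ≤ m
  · rw [if_pos hm, map_smul, LinearMap.smul_apply, q_vBasis, h7]
    by_cases hn : n = m
    · rw [if_pos ⟨hn, hm⟩, if_pos hn]
      norm_num
    · rw [if_neg fun h => hn h.1, if_neg hn]
      simp
  · rw [if_neg hm, if_neg fun h => hm h.2]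
    simp

theorem M_fanoSpinor_four (v : V14) : M (fanoSpinor 4) v = (384 : ℂ) • (v.2, v.1) := by
  suffices h : M (fanoSpinor 4) = (384 : ℂ) • ((LinearMap.snd ℂ E7 E7).prod (LinearMap.fst ℂ E7 E7))
    from LinearMap.congr_fun h v
  refine vB.ext fun m => ?_
  rw [vB_apply, M_fanoSpinor_four_basis]
  refine Fin.addCases (m := 7) (n := 7) (fun i => ?_) (fun i => ?_) m
  · rw [castAdd_add_seven, vBasis_castAdd, vBasis_natAdd]
    rfl
  · rw [natAdd_add_seven, vBasis_castAdd, vBasis_natAdd]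
    rfl

theorem M_fanoSpinor_zero (v : V14) : M (fanoSpinor 0) v = (384 : ℂ) • (v.2, 0) := by
  suffices h : M (fanoSpinor 0) = (384 : ℂ) • ((LinearMap.snd ℂ E7 E7).prod 0)
    from LinearMap.congr_fun h v
  have h7 : ∀ i : Fin 7, ¬(7 ≤ Fin.castAdd 7 i) ∧ 7 ≤ Fin.natAdd 7 i := by decide
  refine vB.ext fun m => ?_
  rw [vB_apply, M_fanoSpinor_zero_basis]
  refine Fin.addCases (m := 7) (n := 7) (fun i => ?_) (fun i => ?_) m
  · rw [if_neg (h7 i).1, vBasis_castAdd]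
    ext <;> simp [eVec]
  · rw [if_pos (h7 i).2, natAdd_add_seven, vBasis_castAdd, vBasis_natAdd]
    rfl

theorem octic_fanoSpinor_four : octic (fanoSpinor 4) = 384 ^ 2 := by
  refine octic_of_M_sq (LinearMap.ext fun v => ?_)
  rw [Module.End.mul_apply, M_fanoSpinor_four, M_fanoSpinor_four, LinearMap.smul_apply,
    LinearMap.id_apply, sq, mul_smul]
  rfl

/-- The signs of the lines `{l, l + 1, l + 3}`. -/
def lineSign (l : Fin 7) : ℤ := if l = 1 ∨ l = 3 ∨ l = 4 then 1 else -1

/-- The standard generic three-form in dimension seven. -/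
def fanoForm : ⋀[ℂ]^3 E7 := ∑ l : Fin 7, (lineSign l : ℂ) • exteriorPower.ιMulti ℂ 3
  ![Pi.single l 1, Pi.single (l + 1) 1, Pi.single (l + 3) 1]

/-- The embeddings `x ↦ (x, ± x)` of `ℂ⁷` in `V₁₄`. -/
def graphMap (ε : ℤˣ) : E7 →ₗ[ℂ] V14 := LinearMap.id.prod (((ε : ℤ) : ℂ) • LinearMap.id)

theorem graphMap_apply (ε : ℤˣ) (x : E7) : graphMap ε x = (x, ((ε : ℤ) : ℂ) • x) := rfl

/-- The integers `q(v_m, (e_l, ± e_l))`. -/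
def graphCoeff (ε : ℤˣ) (m : Fin 14) (l : Fin 7) : ℤ :=
  bif Nat.beq m.val l.val then ε else
    bif Nat.beq m.val (Nat.add l.val 7) then Int.ofNat 1 else Int.ofNat 0

theorem graphCoeff_eq (ε : ℤˣ) (m : Fin 14) (l : Fin 7) :
    graphCoeff ε m l = if m.val = l.val then (ε : ℤ) else if m.val = l.val + 7 then 1 else 0 := by
  have h : ∀ a b : ℕ, Nat.beq a b = decide (a = b) := fun a b => by
    rw [Bool.eq_iff_iff, decide_eq_true_iff, Nat.beq_eq]
  simp only [graphCoeff, h, Bool.cond_decide]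
  rfl

theorem q_graphMap (ε : ℤˣ) (m : Fin 14) (l : Fin 7) :
    q (vBasis m) (graphMap ε (Pi.single l 1)) = (graphCoeff ε m l : ℂ) := by
  rw [graphMap_apply, q_apply]
  refine Fin.addCases (m := 7) (n := 7) (fun i => ?_) (fun i => ?_) m
  · rw [vBasis_castAdd]
    have h : (i.val = l.val) ↔ i = l := Fin.ext_iff.symm
    have h2 : i.val ≠ l.val + 7 := by omega
    by_cases hil : i = l <;> simp [eVec, graphCoeff_eq, h2, h, hil]
  · rw [vBasis_natAdd]
    have h : (7 + i.val = l.val + 7) ↔ i = l := by rw [Fin.ext_iff]; omega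
    have h2 : 7 + i.val ≠ l.val := by omega
    rw [graphCoeff_eq, Fin.val_natAdd, if_neg h2]
    by_cases hil : i = l
    · rw [if_pos (h.mpr hil)]
      simp [fVec, hil]
    · rw [if_neg (mt h.mp hil)]
      simp [fVec, hil]

/-- The determinant of a `3 × 3` integer matrix given by its entries. -/
def detThree (x : Fin 3 → Fin 3 → ℤ) : ℤ :=
  x 0 0 * (x 1 1 * x 2 2 - x 1 2 * x 2 1) - x 0 1 * (x 1 0 * x 2 2 - x 1 2 * x 2 0) +
    x 0 2 * (x 1 0 * x 2 1 - x 1 1 * x 2 0)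

theorem det_cast_eq (x : Fin 3 → Fin 3 → ℤ) :
    (Matrix.of fun i j => (x i j : ℂ)).det = (detThree x : ℂ) := by
  rw [Matrix.det_fin_three, detThree]
  push_cast
  simp only [Matrix.of_apply]
  ring

/-- The integers `q(v_i ∧ v_j ∧ v_k, e_l ∧ e_{l+1} ∧ e_{l+3})` after embedding by `graphMap`. -/
def lineDet (ε : ℤˣ) (i j k : Fin 14) (l : Fin 7) : ℤ :=
  detThree fun a b => graphCoeff ε (![i, j, k] b) (![l, l + 1, l + 3] a)

/-- Expanding (e + f)³ − (e − f)³ along a line keeps the terms with an odd number of vectors f, each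
twice, which accounts for 4 · 2 = 8. Pairing through `q` exchanges e and f, so these are the terms
with an even number of indices in F. -/
theorem lineDet_spec : ∀ i j k : Fin 14,
    ∑ l : Fin 7, lineSign l * (4 * lineDet 1 i j k l - 4 * lineDet (-1) i j k l) =
      tripleValue 4 i j k := by
  simp only [lineDet, detThree, Matrix.cons_val, ← skipMul_eq]
  decide +kernel

theorem evalForm_map_fanoForm (ε : ℤˣ) (i j k : Fin 14) :
    evalForm ![vBasis i, vBasis j, vBasis k] (exteriorPower.map 3 (graphMap ε) fanoForm) =
      ∑ l : Fin 7, (lineSign l : ℂ) * (lineDet ε i j k l : ℂ) := by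
  rw [fanoForm, map_sum, map_sum]
  refine Finset.sum_congr rfl fun l _ => ?_
  rw [map_smul, map_smul, exteriorPower.map_apply_ιMulti, evalForm_ιMulti, smul_eq_mul, lineDet,
    ← det_cast_eq]
  congr 3
  ext a b
  rw [← q_graphMap]
  congr 1
  · fin_cases b <;> rfl
  · fin_cases a <;> rfl

theorem Omega_fanoSpinor_four : Omega (fanoSpinor 4) =
    exteriorPower.map 3 (graphMap 1) ((4 : ℂ) • fanoForm) +
      exteriorPower.map 3 (graphMap (-1)) ((-4 : ℂ) • fanoForm) := by
  refine eq_of_evalForm fun i j k => ?_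
  rw [evalForm_Omega, map_add, map_smul, map_smul, map_smul, map_smul, evalForm_map_fanoForm,
    evalForm_map_fanoForm]
  refine (pairing_fanoSpinor (Or.inl rfl) i j k).trans ?_
  rw [← lineDet_spec]
  push_cast
  rw [Finset.smul_sum, Finset.smul_sum, ← Finset.sum_add_distrib]
  refine Finset.sum_congr rfl fun l _ => ?_
  rw [smul_eq_mul, smul_eq_mul]
  ring

/-- Without the scalar term, a nonzero value needs exactly two indices in F. The corresponding two
dual vectors lie in E, whence `Omega` belongs to ∧²E ∧ V₁₄. -/
theorem tripleValue_zero_eq_zero : ∀ i j k : Fin 14, i < j → (j : ℕ) < 7 →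
    tripleValue 0 i j k = 0 := by decide +kernel

theorem Omega_fanoSpinor_zero_mem :
    Omega (fanoSpinor 0) ∈ wedgeTwoWedge (LinearMap.range (LinearMap.inl ℂ E7 E7)) := by
  have hw : ∀ j : Fin 14, ¬((j : ℕ) < 7) → wBasis j ∈ LinearMap.range (LinearMap.inl ℂ E7 E7) := by
    intro j
    refine Fin.addCases (m := 7) (n := 7) (fun i => ?_) (fun i => ?_) j
    · exact fun h => absurd i.2 h
    · exact fun _ => ⟨Pi.single i 1, (Fin.append_right fVec eVec i).symm⟩
  refine sum_mem fun i _ => sum_mem fun j hj => sum_mem fun k hk => ?_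
  have hij := Finset.mem_Ioi.mp hj
  have hjk := Finset.mem_Ioi.mp hk
  rw [pairing_fanoSpinor (Or.inr rfl)]
  by_cases hj7 : (j : ℕ) < 7
  · rw [tripleValue_zero_eq_zero i j k hij hj7, Int.cast_zero, zero_smul]
    exact zero_mem _
  · refine Submodule.smul_mem _ _ (Submodule.subset_span
      ⟨wBasis j, hw j hj7, wBasis k, hw k (fun h => hj7 (lt_trans hjk h)), wBasis i, ?_⟩)
    let σ : Equiv.Perm (Fin 3) := finRotate 3
    have h1 : ![wBasis j, wBasis k, wBasis i] = ![wBasis i, wBasis j, wBasis k] ∘ σ := by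
      ext1 l
      fin_cases l <;> rfl
    have h2 : Equiv.Perm.sign σ = 1 := by decide
    rw [h1, AlternatingMap.map_perm, h2, one_smul]

/-! ### The vector representation on products of vectors -/

/-- The opposite of the reflection in a vector. -/
def reflect (u x : V14) : V14 := (2 * q x u / Q u) • u - x

theorem ι_mul_ι_reflect {u : V14} (hu : Q u ≠ 0) (x : V14) :
    CliffordAlgebra.ι Q u * CliffordAlgebra.ι Q x =
      CliffordAlgebra.ι Q (reflect u x) * CliffordAlgebra.ι Q u := by
  rw [reflect, map_sub, map_smul, sub_mul, Algebra.smul_mul_assoc, CliffordAlgebra.ι_sq_scalar,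
    eq_sub_iff_add_eq, ι_mul_ι_add_swap_q, Algebra.smul_def, ← map_mul, q_comm,
    div_mul_cancel₀ _ hu]

theorem vecMap_spinPair (u w : V14) (h : Q u * Q w = 1) (x : V14) :
    vecMap (spinPair u w h) x = reflect u (reflect w x) := by
  rw [vecMap_eq_iff]
  change CliffordAlgebra.ι Q u * CliffordAlgebra.ι Q w * CliffordAlgebra.ι Q x =
    _ * (CliffordAlgebra.ι Q u * CliffordAlgebra.ι Q w)
  rw [mul_assoc, ι_mul_ι_reflect (right_ne_zero_of_mul_eq_one h), ← mul_assoc,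
    ι_mul_ι_reflect (left_ne_zero_of_mul_eq_one h), mul_assoc]

theorem reflect_smul {c : ℂ} (hc : c ≠ 0) (u x : V14) : reflect (c • u) x = reflect u x := by
  rw [reflect, reflect, Q_smul, map_smul, smul_smul, smul_eq_mul]
  congr 2
  by_cases hu : Q u = 0
  · simp [hu]
  · field_simp

/-- For anisotropic vectors `u`, `w`, the product `u w` is proportional to an element of
`Spin₁₄`. -/
theorem exists_spinRep_eq_smul_biv {u w : V14} (hu : Q u ≠ 0) (hw : Q w ≠ 0) :
    ∃ (g : Spin14Group) (c : ℂ), c ≠ 0 ∧ (∀ z, spinRep g z = c • biv u w z) ∧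
      ∀ x, vecMap g x = reflect u (reflect w x) := by
  obtain ⟨c, hc⟩ := IsAlgClosed.exists_pow_nat_eq (Q u * Q w)⁻¹ two_pos
  have h0 : c ≠ 0 := fun h => inv_ne_zero (mul_ne_zero hu hw) (by rw [← hc, h]; ring)
  have h1 : Q (c • u) * Q w = 1 := by
    rw [Q_smul, hc, mul_assoc, inv_mul_cancel₀ (mul_ne_zero hu hw)]
  exact ⟨spinPair _ _ h1, c, h0, fun z => by rw [spinRep_spinPair', biv_smul_left],
    fun x => by rw [vecMap_spinPair, reflect_smul h0]⟩

/-- The orthogonal projection to the span of four mutually orthogonal vectors. -/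
def projFour (u : Fin 4 → V14) (x : V14) : V14 := ∑ i, (q x (u i) / Q (u i)) • u i

/-- The four minus signs in `reflect` cancel, leaving −1 on the span of the vectors and +1 on its
orthogonal complement. -/
theorem reflect_four {u : Fin 4 → V14} (horth : ∀ i j, i ≠ j → q (u i) (u j) = 0) (x : V14) :
    reflect (u 0) (reflect (u 1) (reflect (u 2) (reflect (u 3) x))) =
      x - (2 : ℂ) • projFour u x := by
  simp only [reflect, projFour, Fin.sum_univ_four, map_sub, map_smul, LinearMap.sub_apply,
    LinearMap.smul_apply, smul_eq_mul, horth 3 2 (by decide), horth 3 1 (by decide),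
    horth 3 0 (by decide), horth 2 1 (by decide), horth 2 0 (by decide), horth 1 0 (by decide),
    mul_zero, zero_sub, neg_neg, mul_neg, neg_div]
  module

/-- The product of the four vectors is proportional to a spin element which stabilizes `[z]` and
acts by x ↦ x − 2·proj. Once exchange of the two subspaces is excluded, `W` is stable under the
projection. -/
theorem IsAssociatedPair.projFour_mem {z : Delta14} {W W' : Submodule ℂ V14}
    (h : IsAssociatedPair z W W') {u : Fin 4 → V14} (hQ : ∀ i, Q (u i) ≠ 0)
    (horth : ∀ i j, i ≠ j → q (u i) (u j) = 0) {κ : ℂ}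
    (hz : biv (u 0) (u 1) (biv (u 2) (u 3) z) = κ • z) {x : V14} (hx : x ∈ W) :
    projFour u x ∈ W := by
  obtain ⟨g, a, ha, hg, hgv⟩ := exists_spinRep_eq_smul_biv (hQ 0) (hQ 1)
  obtain ⟨g', a', ha', hg', hgv'⟩ := exists_spinRep_eq_smul_biv (hQ 2) (hQ 3)
  have hvec : ∀ y, vecMap (g * g') y = y - (2 : ℂ) • projFour u y := fun y => by
    rw [← reflect_four horth, ← hgv', ← hgv, vecMap_eq_iff]
    have h1 := (vecMap_eq_iff g (vecMap g' y) _).mp rfl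
    have h2 := (vecMap_eq_iff g' y _).mp rfl
    rw [Submonoid.coe_mul, mul_assoc, h2, ← mul_assoc, h1, mul_assoc]
  have hstab : ∃ c : ℂ, spinRep (g * g') z = c • z := ⟨a' * (a * κ), by
    rw [map_mul, Module.End.mul_apply, hg', map_smul, hg, hz, smul_smul, smul_smul, mul_assoc]⟩
  -- Four linear conditions on a space of dimension 7 have a nonzero solution in `W`. This fixed
  -- vector would lie in both `W` and `W'` if they were exchanged.
  have hfix : ∃ y ∈ W, y ≠ 0 ∧ vecMap (g * g') y = y := by
    let L : W →ₗ[ℂ] (Fin 4 → ℂ) := LinearMap.pi fun i => q (u i) ∘ₗ W.subtype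
    have hker : LinearMap.ker L ≠ ⊥ := LinearMap.ker_ne_bot_of_finrank_lt
      (by rw [h.finrank_left]; simp)
    obtain ⟨y, hy, hy0⟩ := (Submodule.ne_bot_iff _).mp hker
    refine ⟨y, y.2, fun hy' => hy0 (Subtype.ext hy'), ?_⟩
    have hyi : ∀ i, q y (u i) = 0 := fun i => by
      rw [q_comm]
      exact congrFun (LinearMap.mem_ker.mp hy) i
    rw [hvec, projFour]
    simp [hyi]
  rcases h.stable _ hstab with ⟨h1, -⟩ | ⟨h1, -⟩
  · have h2 : vecMap (g * g') x ∈ W := by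
      rw [← h1, moveSubspace_eq]
      exact Submodule.mem_map_of_mem hx
    rw [hvec] at h2
    have h3 := Submodule.smul_mem W (2⁻¹ : ℂ) (sub_mem hx h2)
    rwa [sub_sub_cancel, smul_smul, inv_mul_cancel₀ two_ne_zero, one_smul] at h3
  · obtain ⟨y, hy, hy0, hgy⟩ := hfix
    have h2 : vecMap (g * g') y ∈ W' := by
      rw [← h1, moveSubspace_eq]
      exact Submodule.mem_map_of_mem hy
    rw [hgy] at h2
    exact absurd (Submodule.disjoint_def.mp h.isCompl.disjoint y hy h2) hy0

/-! ### Elements of the stabilizer of the representative of the open orbit -/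

/-- The integer vector `e_i + ε e_j`. -/
def intVec (t : Fin 7 × Fin 7 × ℤ) (i : Fin 7) : ℤ :=
  (if i = t.1 then 1 else 0) + t.2.2 * (if i = t.2.1 then 1 else 0)

/-- Quadruples of orthogonal vectors of `ℂ⁷`, whose images by `graphMap 1` have a product with
`fanoSpinor 4` as an eigenvector, and the eigenvalue. -/
def eigenQuads : List ((Fin 4 → Fin 7 × Fin 7 × ℤ) × ℤ) :=
  -- The first three quadruples span the coordinate subspaces of complements of lines, and separate
  -- the coordinates. The other three link coordinates two by two.
  [(![(2, 0, 0), (4, 0, 0), (5, 0, 0), (6, 0, 0)], 4),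
   (![(0, 0, 0), (3, 0, 0), (5, 0, 0), (6, 0, 0)], 4),
   (![(0, 0, 0), (1, 0, 0), (4, 0, 0), (6, 0, 0)], 4),
   (![(0, 1, 1), (2, 5, 1), (3, 0, 0), (4, 0, 0)], 8),
   (![(1, 2, 1), (3, 6, -1), (0, 0, 0), (4, 0, 0)], 8),
   (![(0, 4, -1), (1, 6, 1), (2, 0, 0), (5, 0, 0)], 8)]

/-- The Clifford action of `graphMap 1 (e_i + ε e_j)` in integer coordinates. -/
def vecOp (t : Fin 7 × Fin 7 × ℤ) (s : Fin 128 → ℤ) (n : Fin 128) : ℤ :=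
  gen ℤ (Fin.castAdd 7 t.1) s n + gen ℤ (Fin.natAdd 7 t.1) s n +
    if t.2.2 = 0 then 0 else
      t.2.2 * (gen ℤ (Fin.castAdd 7 t.2.1) s n + gen ℤ (Fin.natAdd 7 t.2.1) s n)

theorem eigenQuads_spec : ∀ x ∈ eigenQuads, ∀ n : Fin 128,
    vecOp (x.1 0) (vecOp (x.1 1) (vecOp (x.1 2) (vecOp (x.1 3) (fanoCoord 4)))) n =
      x.2 * fanoCoord 4 n := by
  simp only [vecOp, gen_eq_skipGen]
  decide +kernel

theorem eigenQuads_orthogonal : ∀ x ∈ eigenQuads, ∀ i j : Fin 4,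
    (i ≠ j → ∑ k, intVec (x.1 i) k * intVec (x.1 j) k = 0) ∧
      ∑ k, intVec (x.1 i) k * intVec (x.1 i) k ≠ 0 := by decide +kernel

/-- The image of `e_i + ε e_j` by `graphMap 1`. -/
def quadVec (t : Fin 7 × Fin 7 × ℤ) : V14 := graphMap 1 fun i => (intVec t i : ℂ)

theorem q_quadVec (x : V14) (t : Fin 7 × Fin 7 × ℤ) :
    q x (quadVec t) = ∑ k, (x.1 k + x.2 k) * (intVec t k : ℂ) := by
  rw [quadVec, graphMap_apply, q_apply]
  simp only [dotProduct, Units.val_one, Int.cast_one, one_smul, add_mul, Finset.sum_add_distrib]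

theorem q_quadVec_quadVec (t t' : Fin 7 × Fin 7 × ℤ) :
    q (quadVec t) (quadVec t') = 2 * ((∑ k, intVec t k * intVec t' k : ℤ) : ℂ) := by
  rw [q_quadVec, quadVec, graphMap_apply]
  push_cast
  rw [Finset.mul_sum]
  refine Finset.sum_congr rfl fun k _ => ?_
  simp only [one_smul]
  ring

theorem quadVec_eq (t : Fin 7 × Fin 7 × ℤ) : quadVec t =
    vBasis (Fin.castAdd 7 t.1) + vBasis (Fin.natAdd 7 t.1) +
      (t.2.2 : ℂ) • (vBasis (Fin.castAdd 7 t.2.1) + vBasis (Fin.natAdd 7 t.2.1)) := by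
  simp only [vBasis_castAdd, vBasis_natAdd, eVec, fVec, quadVec, graphMap_apply, Units.val_one,
    Int.cast_one, one_smul]
  ext i <;> simp [intVec, Pi.single_apply]

theorem coordMap_quadVec (t : Fin 7 × Fin 7 × ℤ) (z : Spinors) (s : Fin 128 → ℤ)
    (hz : coordMap z = fun n => (s n : ℂ)) :
    coordMap (cliff (quadVec t) z) = fun n => (vecOp t s n : ℂ) := by
  rw [coordMap_cliff, quadVec_eq, hz]
  simp only [map_add, map_smul, LinearMap.add_apply, LinearMap.smul_apply, op_vBasis, gen_cast]
  ext n
  simp only [Pi.add_apply, Pi.smul_apply, smul_eq_mul, vecOp]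
  split_ifs with h
  · simp [h]
  · push_cast
    ring

theorem biv_quadVec {x : (Fin 4 → Fin 7 × Fin 7 × ℤ) × ℤ} (hx : x ∈ eigenQuads) :
    biv (quadVec (x.1 0)) (quadVec (x.1 1)) (biv (quadVec (x.1 2)) (quadVec (x.1 3))
      (fanoSpinor 4)) = (x.2 : ℂ) • fanoSpinor 4 := by
  refine delta_ext fun n _ => ?_
  rw [biv_coe, biv_coe, coordMap_quadVec _ _ _ (coordMap_quadVec _ _ _ (coordMap_quadVec _ _ _
    (coordMap_quadVec _ _ _ (coordMap_fanoSpinor 4)))), Submodule.coe_smul, map_smul,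
    coordMap_fanoSpinor, Pi.smul_apply]
  beta_reduce
  rw [eigenQuads_spec x hx, Int.cast_mul, smul_eq_mul]

/-- The projection of `ℂ⁷` to the span of the vectors of a quadruple. -/
def projQuad (t : Fin 4 → Fin 7 × Fin 7 × ℤ) (y : E7) : E7 :=
  ∑ i, ((∑ k, y k * (intVec (t i) k : ℂ)) / ((∑ k, intVec (t i) k * intVec (t i) k : ℤ) : ℂ)) •
    fun k => (intVec (t i) k : ℂ)

theorem IsAssociatedPair.projQuad_mem {W W' : Submodule ℂ V14}
    (h : IsAssociatedPair (fanoSpinor 4) W W') {x : (Fin 4 → Fin 7 × Fin 7 × ℤ) × ℤ}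
    (hx : x ∈ eigenQuads) {v : V14} (hv : v ∈ W) :
    graphMap 1 (projQuad x.1 ((2 : ℂ)⁻¹ • (v.1 + v.2))) ∈ W := by
  have hQ : ∀ i, Q (quadVec (x.1 i)) ≠ 0 := fun i => by
    rw [Q_eq_q, q_quadVec_quadVec]
    exact mul_ne_zero two_ne_zero (by exact_mod_cast (eigenQuads_orthogonal x hx i i).2)
  have horth : ∀ i j, i ≠ j → q (quadVec (x.1 i)) (quadVec (x.1 j)) = 0 := fun i j hij => by
    rw [q_quadVec_quadVec, (eigenQuads_orthogonal x hx i j).1 hij, Int.cast_zero, mul_zero]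
  have h1 := h.projFour_mem (u := fun i => quadVec (x.1 i)) hQ horth (biv_quadVec hx) hv
  have h2 : projFour (fun i => quadVec (x.1 i)) v =
      graphMap 1 (projQuad x.1 ((2 : ℂ)⁻¹ • (v.1 + v.2))) := by
    rw [projFour, projQuad, map_sum]
    refine Finset.sum_congr rfl fun i _ => ?_
    rw [map_smul, ← quadVec]
    congr 1
    rw [Q_eq_q, q_quadVec_quadVec, q_quadVec]
    simp only [Pi.smul_apply, Pi.add_apply, smul_eq_mul, mul_assoc, ← Finset.mul_sum]
    rw [inv_mul_eq_div, div_div]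
  rwa [← h2]

theorem IsAssociatedPair.comap_projQuad_mem {W W' : Submodule ℂ V14}
    (h : IsAssociatedPair (fanoSpinor 4) W W') {x : (Fin 4 → Fin 7 × Fin 7 × ℤ) × ℤ}
    (hx : x ∈ eigenQuads) {y : E7} (hy : graphMap 1 y ∈ W) : graphMap 1 (projQuad x.1 y) ∈ W := by
  have h1 := h.projQuad_mem hx hy
  have h2 : (2 : ℂ)⁻¹ • ((graphMap 1 y).1 + (graphMap 1 y).2) = y := by
    rw [graphMap_apply]
    simp only [Units.val_one, Int.cast_one, one_smul, ← two_smul ℂ y]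
    rw [smul_smul, inv_mul_cancel₀ two_ne_zero, one_smul]
  rwa [h2] at h1

/-! ### The pair of subspaces at the representative of the open orbit -/

theorem graphMap_injective (ε : ℤˣ) : Function.Injective (graphMap ε) := fun _ _ h =>
  congrArg Prod.fst h

theorem finrank_range_graphMap (ε : ℤˣ) :
    Module.finrank ℂ (LinearMap.range (graphMap ε)) = 7 := by
  rw [LinearMap.finrank_range_of_inj (graphMap_injective ε)]
  simp

theorem mem_range_graphMap {ε : ℤˣ} {v : V14} :
    v ∈ LinearMap.range (graphMap ε) ↔ v.2 = ((ε : ℤ) : ℂ) • v.1 := by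
  constructor
  · rintro ⟨x, rfl⟩
    rfl
  · intro h
    exact ⟨v.1, Prod.ext rfl h.symm⟩

theorem q_graphMap_graphMap (ε : ℤˣ) (x y : E7) : q (graphMap ε x) (graphMap (-ε) y) = 0 := by
  rw [graphMap_apply, graphMap_apply, q_apply]
  simp

theorem eq_of_q_graphMap {ε : ℤˣ} {v : V14} (h : ∀ y, q v (graphMap ε y) = 0) :
    v ∈ LinearMap.range (graphMap (-ε)) := by
  rw [mem_range_graphMap]
  ext i
  have h1 := h (Pi.single i 1)
  rw [graphMap_apply, q_apply] at h1
  simp only [dotProduct_smul, dotProduct_single_one, smul_eq_mul] at h1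
  simp only [Units.val_neg, Int.cast_neg, Pi.smul_apply, smul_eq_mul]
  linear_combination h1

theorem isCompl_range_graphMap : IsCompl (LinearMap.range (graphMap 1))
    (LinearMap.range (graphMap (-1))) := by
  have hd : Disjoint (LinearMap.range (graphMap 1)) (LinearMap.range (graphMap (-1))) := by
    rw [Submodule.disjoint_def]
    intro v h1 h2
    rw [mem_range_graphMap] at h1 h2
    simp only [Units.val_one, Int.cast_one, one_smul, Units.val_neg, Int.cast_neg,
      neg_smul] at h1 h2
    rw [h1] at h2
    have h3 : v.1 = 0 := self_eq_neg.mp h2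
    exact Prod.ext h3 (by rw [h1, h3]; rfl)
  refine ⟨hd, codisjoint_iff.mpr (Submodule.eq_top_of_finrank_eq ?_)⟩
  have h := Submodule.finrank_sup_add_finrank_inf_eq (LinearMap.range (graphMap 1))
    (LinearMap.range (graphMap (-1)))
  rw [disjoint_iff.mp hd, finrank_bot, finrank_range_graphMap, finrank_range_graphMap] at h
  rw [add_zero] at h
  rw [h]
  simp

theorem projQuad_first (y : E7) : projQuad (eigenQuads[0]).1 y =
    ![0, 0, y 2, 0, y 4, y 5, y 6] := by
  ext k
  fin_cases k <;> simp [projQuad, eigenQuads, intVec, Fin.sum_univ_succ]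

theorem projQuad_second (y : E7) : projQuad (eigenQuads[1]).1 y =
    ![y 0, 0, 0, y 3, 0, y 5, y 6] := by
  ext k
  fin_cases k <;> simp [projQuad, eigenQuads, intVec, Fin.sum_univ_succ]

theorem projQuad_third (y : E7) : projQuad (eigenQuads[2]).1 y =
    ![y 0, y 1, 0, 0, y 4, 0, y 6] := by
  ext k
  fin_cases k <;> simp [projQuad, eigenQuads, intVec, Fin.sum_univ_succ]

theorem projQuad_fourth (y : E7) : projQuad (eigenQuads[3]).1 y =
    ![(y 0 + y 1) / 2, (y 0 + y 1) / 2, (y 2 + y 5) / 2, y 3, y 4, (y 2 + y 5) / 2, 0] := by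
  ext k
  fin_cases k <;> simp [projQuad, eigenQuads, intVec, Fin.sum_univ_succ] <;> ring

theorem projQuad_fifth (y : E7) : projQuad (eigenQuads[4]).1 y =
    ![y 0, (y 1 + y 2) / 2, (y 1 + y 2) / 2, (y 3 - y 6) / 2, y 4, 0, (y 6 - y 3) / 2] := by
  ext k
  fin_cases k <;> simp [projQuad, eigenQuads, intVec, Fin.sum_univ_succ] <;> ring

theorem projQuad_sixth (y : E7) : projQuad (eigenQuads[5]).1 y =
    ![(y 0 - y 4) / 2, (y 1 + y 6) / 2, y 2, 0, (y 4 - y 0) / 2, y 5, (y 1 + y 6) / 2] := by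
  ext k
  fin_cases k <;> simp [projQuad, eigenQuads, intVec, Fin.sum_univ_succ] <;> ring

/-- A subspace of `ℂ⁷` stable under the projections of `eigenQuads` contains the coordinate
components of its elements. -/
theorem single_mem_of_projQuad_mem {N : Submodule ℂ E7}
    (hN : ∀ x ∈ eigenQuads, ∀ y ∈ N, projQuad x.1 y ∈ N) {y : E7} (hy : y ∈ N) (i : Fin 7) :
    Pi.single i (y i) ∈ N := by
  have P1 : ∀ y ∈ N, ![0, 0, y 2, 0, y 4, y 5, y 6] ∈ N := fun y hy => by
    rw [← projQuad_first]
    exact hN _ (List.getElem_mem _) y hy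
  have P2 : ∀ y ∈ N, ![y 0, 0, 0, y 3, 0, y 5, y 6] ∈ N := fun y hy => by
    rw [← projQuad_second]
    exact hN _ (List.getElem_mem _) y hy
  have P3 : ∀ y ∈ N, ![y 0, y 1, 0, 0, y 4, 0, y 6] ∈ N := fun y hy => by
    rw [← projQuad_third]
    exact hN _ (List.getElem_mem _) y hy
  have h1 := P1 y hy
  have h2 := P2 y hy
  have h3 := P3 y hy
  -- The index sets {2, 4, 5, 6}, {0, 3, 5, 6} and {0, 1, 4, 6} separate the seven points:
  -- intersections isolate 6, then 5, 4 and 0, and subtraction isolates 2, 3 and 1.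
  have h12 := P1 _ h2
  have h13 := P1 _ h3
  have h23 := P2 _ h3
  have h6 := P1 _ h23
  have s6 : Pi.single 6 (y 6) ∈ N := by
    convert h6 using 1
    ext k
    fin_cases k <;> simp
  have s5 : Pi.single 5 (y 5) ∈ N := by
    convert sub_mem h12 s6 using 1
    ext k
    simp only [Pi.sub_apply]
    fin_cases k <;> simp
  have s4 : Pi.single 4 (y 4) ∈ N := by
    convert sub_mem h13 s6 using 1
    ext k
    simp only [Pi.sub_apply]
    fin_cases k <;> simp
  have s0 : Pi.single 0 (y 0) ∈ N := by
    convert sub_mem h23 s6 using 1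
    ext k
    simp only [Pi.sub_apply]
    fin_cases k <;> simp
  have s2 : Pi.single 2 (y 2) ∈ N := by
    convert sub_mem (sub_mem (sub_mem h1 s4) s5) s6 using 1
    ext k
    simp only [Pi.sub_apply]
    fin_cases k <;> simp
  have s3 : Pi.single 3 (y 3) ∈ N := by
    convert sub_mem (sub_mem (sub_mem h2 s0) s5) s6 using 1
    ext k
    simp only [Pi.sub_apply]
    fin_cases k <;> simp
  have s1 : Pi.single 1 (y 1) ∈ N := by
    convert sub_mem (sub_mem (sub_mem h3 s0) s4) s6 using 1
    ext k
    simp only [Pi.sub_apply]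
    fin_cases k <;> simp
  fin_cases i
  exacts [s0, s1, s2, s3, s4, s5, s6]

/-- A stable subspace is spanned by coordinate vectors. The remaining projections propagate
membership along the edges 0–1, 2–5, 1–2, 3–6, 0–4 and 1–6, which form a connected graph on the
seven indices. -/
theorem eq_top_of_projQuad_mem {N : Submodule ℂ E7}
    (hN : ∀ x ∈ eigenQuads, ∀ y ∈ N, projQuad x.1 y ∈ N) {y : E7} (hy : y ∈ N) (hy0 : y ≠ 0) :
    N = ⊤ := by
  have P4 : ∀ y ∈ N, ![(y 0 + y 1) / 2, (y 0 + y 1) / 2, (y 2 + y 5) / 2, y 3, y 4,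
      (y 2 + y 5) / 2, 0] ∈ N := fun y hy => by
    rw [← projQuad_fourth]
    exact hN _ (List.getElem_mem _) y hy
  have P5 : ∀ y ∈ N, ![y 0, (y 1 + y 2) / 2, (y 1 + y 2) / 2, (y 3 - y 6) / 2, y 4, 0,
      (y 6 - y 3) / 2] ∈ N := fun y hy => by
    rw [← projQuad_fifth]
    exact hN _ (List.getElem_mem _) y hy
  have P6 : ∀ y ∈ N, ![(y 0 - y 4) / 2, (y 1 + y 6) / 2, y 2, 0, (y 4 - y 0) / 2, y 5,
      (y 1 + y 6) / 2] ∈ N := fun y hy => by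
    rw [← projQuad_sixth]
    exact hN _ (List.getElem_mem _) y hy
  have hscale : ∀ (i : Fin 7) (c : ℂ), c ≠ 0 → Pi.single i c ∈ N →
      (Pi.single i 1 : E7) ∈ N := fun i c hc h => by
    have h1 := N.smul_mem c⁻¹ h
    rwa [← Pi.single_smul, smul_eq_mul, inv_mul_cancel₀ hc] at h1
  have hstep : ∀ x ∈ eigenQuads, ∀ i j : Fin 7, projQuad x.1 (Pi.single i 1) j ≠ 0 →
      (Pi.single i 1 : E7) ∈ N → (Pi.single j 1 : E7) ∈ N := fun x hx i j hij h =>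
    hscale j _ hij (single_mem_of_projQuad_mem hN (hN x hx _ h) j)
  have m3 : eigenQuads[3] ∈ eigenQuads := List.getElem_mem _
  have m4 : eigenQuads[4] ∈ eigenQuads := List.getElem_mem _
  have m5 : eigenQuads[5] ∈ eigenQuads := List.getElem_mem _
  have e01 := hstep _ m3 0 1 (by rw [projQuad_fourth]; simp)
  have e10 := hstep _ m3 1 0 (by rw [projQuad_fourth]; simp)
  have e25 := hstep _ m3 2 5 (by rw [projQuad_fourth]; simp)
  have e52 := hstep _ m3 5 2 (by rw [projQuad_fourth]; simp)
  have e12 := hstep _ m4 1 2 (by rw [projQuad_fifth]; simp)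
  have e21 := hstep _ m4 2 1 (by rw [projQuad_fifth]; simp)
  have e36 := hstep _ m4 3 6 (by rw [projQuad_fifth]; simp)
  have e63 := hstep _ m4 6 3 (by rw [projQuad_fifth]; simp)
  have e04 := hstep _ m5 0 4 (by rw [projQuad_sixth]; simp)
  have e40 := hstep _ m5 4 0 (by rw [projQuad_sixth]; simp)
  have e16 := hstep _ m5 1 6 (by rw [projQuad_sixth]; simp)
  have e61 := hstep _ m5 6 1 (by rw [projQuad_sixth]; simp)
  have hone : (Pi.single 1 1 : E7) ∈ N := by
    obtain ⟨i, hi⟩ := Function.ne_iff.mp hy0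
    have hi1 := hscale i _ hi (single_mem_of_projQuad_mem hN hy i)
    fin_cases i
    exacts [e01 hi1, hi1, e21 hi1, e61 (e36 hi1), e01 (e40 hi1), e21 (e52 hi1), e61 hi1]
  rw [← top_le_iff, ← (Pi.basisFun ℂ (Fin 7)).span_eq, Submodule.span_le]
  rintro _ ⟨i, rfl⟩
  rw [Pi.basisFun_apply]
  fin_cases i
  exacts [e10 hone, hone, e12 hone, e63 (e16 hone), e04 (e10 hone), e25 (e12 hone), e16 hone]

theorem eq_range_graphMap_of_le {W : Submodule ℂ V14} (hW : Module.finrank ℂ W = 7) {ε : ℤˣ}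
    (h : W ≤ LinearMap.range (graphMap ε)) : W = LinearMap.range (graphMap ε) :=
  Submodule.eq_of_le_of_finrank_eq h (by rw [hW, finrank_range_graphMap])

/-- The projections have image in the first graph. If `W` has a vector with nonzero component there,
some coordinate projection gives a nonzero vector of `W` in that graph, so `W` contains the whole
graph and equals it by dimension. Otherwise `W` lies in the second graph. Orthogonality determines
`W'`. -/
theorem IsAssociatedPair.eq_range_graphMap {W W' : Submodule ℂ V14}
    (h : IsAssociatedPair (fanoSpinor 4) W W') :
    (W = LinearMap.range (graphMap 1) ∧ W' = LinearMap.range (graphMap (-1))) ∨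
      (W = LinearMap.range (graphMap (-1)) ∧ W' = LinearMap.range (graphMap 1)) := by
  have hright : ∀ ε : ℤˣ, W = LinearMap.range (graphMap ε) →
      W' = LinearMap.range (graphMap (-ε)) := fun ε hW =>
    eq_range_graphMap_of_le h.finrank_right fun v hv => eq_of_q_graphMap fun y => by
      rw [q_comm]
      exact h.orthogonal _ (by rw [hW]; exact ⟨y, rfl⟩) v hv
  by_cases hex : ∃ v ∈ W, v.1 + v.2 ≠ 0
  · obtain ⟨v, hv, hv0⟩ := hex
    let N := W.comap (graphMap 1)
    have hN : ∀ x ∈ eigenQuads, ∀ y ∈ N, projQuad x.1 y ∈ N := fun x hx y hy =>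
      h.comap_projQuad_mem hx hy
    obtain ⟨i, hi⟩ := Function.ne_iff.mp hv0
    have hNtop : ∃ y ∈ N, y ≠ 0 := by
      have hcover : ∀ i : Fin 7, ∃ x ∈ eigenQuads, ∀ y : E7, projQuad x.1 y i = y i := by
        intro i
        have m0 : eigenQuads[0] ∈ eigenQuads := List.getElem_mem _
        have m1 : eigenQuads[1] ∈ eigenQuads := List.getElem_mem _
        have m2 : eigenQuads[2] ∈ eigenQuads := List.getElem_mem _
        fin_cases i
        exacts [⟨_, m1, fun y => by rw [projQuad_second]; rfl⟩,
          ⟨_, m2, fun y => by rw [projQuad_third]; rfl⟩,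
          ⟨_, m0, fun y => by rw [projQuad_first]; rfl⟩,
          ⟨_, m1, fun y => by rw [projQuad_second]; rfl⟩,
          ⟨_, m0, fun y => by rw [projQuad_first]; rfl⟩,
          ⟨_, m0, fun y => by rw [projQuad_first]; rfl⟩,
          ⟨_, m0, fun y => by rw [projQuad_first]; rfl⟩]
      obtain ⟨x, hx, hxi⟩ := hcover i
      refine ⟨_, h.projQuad_mem hx hv, fun h0 => hi ?_⟩
      have h1 := congrFun h0 i
      rw [hxi] at h1
      simpa using h1
    obtain ⟨y, hy, hy0⟩ := hNtop
    have htop : N = ⊤ := eq_top_of_projQuad_mem hN hy hy0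
    have hW : LinearMap.range (graphMap 1) = W := by
      refine Submodule.eq_of_le_of_finrank_eq ?_ (by rw [finrank_range_graphMap, h.finrank_left])
      rintro _ ⟨y, rfl⟩
      have hy : y ∈ N := by
        rw [htop]
        trivial
      exact hy
    exact Or.inl ⟨hW.symm, hright 1 hW.symm⟩
  · push Not at hex
    have hW : W = LinearMap.range (graphMap (-1)) :=
      eq_range_graphMap_of_le h.finrank_left fun v hv => by
        rw [mem_range_graphMap, eq_neg_of_add_eq_zero_right (hex v hv)]
        simp
    refine Or.inr ⟨hW, ?_⟩
    rw [hright (-1) hW, neg_neg]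

theorem M_graphMap (ε : ℤˣ) (x : E7) :
    M (fanoSpinor 4) (graphMap ε x) = (384 * ((ε : ℤ) : ℂ)) • graphMap ε x := by
  have h : ((ε : ℤ) : ℂ) * ((ε : ℤ) : ℂ) = 1 := by
    rcases Int.units_eq_one_or ε with rfl | rfl <;> norm_num
  rw [M_fanoSpinor_four, graphMap_apply, mul_smul]
  congr 1
  refine Prod.ext rfl ?_
  rw [Prod.smul_snd, smul_smul, h, one_smul]

theorem mem_range_graphMap_of_M {ε : ℤˣ} {v : V14}
    (h : M (fanoSpinor 4) v = (384 * ((ε : ℤ) : ℂ)) • v) : v ∈ LinearMap.range (graphMap ε) := by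
  rw [mem_range_graphMap]
  rw [M_fanoSpinor_four, mul_smul] at h
  have h1 := smul_right_injective V14 (show (384 : ℂ) ≠ 0 by norm_num) h
  exact congrArg Prod.fst h1

theorem isAssociatedPair_fanoSpinor_four : IsAssociatedPair (fanoSpinor 4)
    (LinearMap.range (graphMap 1)) (LinearMap.range (graphMap (-1))) where
  finrank_left := finrank_range_graphMap 1
  finrank_right := finrank_range_graphMap (-1)
  isCompl := isCompl_range_graphMap
  orthogonal := by
    rintro _ ⟨x, rfl⟩ _ ⟨y, rfl⟩
    exact q_graphMap_graphMap 1 x y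
  stable := by
    rintro g ⟨c, hc⟩
    -- Invariance and nonvanishing of the octic leave only c⁴ = ±1, and M is multiplied by c⁴. The
    -- element thus preserves or exchanges the eigenspaces of M.
    have h8 : c ^ 8 = 1 := by
      have h := octic_spinRep g (fanoSpinor 4)
      rw [hc, octic_smul, octic_fanoSpinor_four] at h
      exact mul_right_cancel₀ (by norm_num) (h.trans (one_mul _).symm)
    have h4 : ∃ ε : ℤˣ, c ^ 4 = ((ε : ℤ) : ℂ) := by
      rcases (sq_eq_one_iff (a := c ^ 4)).mp (by rw [← pow_mul]; exact h8) with h | h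
      · exact ⟨1, by simp [h]⟩
      · exact ⟨-1, by simp [h]⟩
    obtain ⟨ε, hε⟩ := h4
    have hεε : ((ε : ℤ) : ℂ) * ((ε : ℤ) : ℂ) = 1 := by
      rcases Int.units_eq_one_or ε with rfl | rfl <;> norm_num
    have hmove : ∀ η : ℤˣ, moveSubspace g (LinearMap.range (graphMap η)) =
        LinearMap.range (graphMap (ε * η)) := by
      intro η
      rw [moveSubspace_eq]
      refine eq_range_graphMap_of_le ?_ ?_
      · exact (LinearEquiv.finrank_map_eq (vecEquiv g) _).trans (finrank_range_graphMap η)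
      · rintro _ ⟨_, ⟨x, rfl⟩, rfl⟩
        refine mem_range_graphMap_of_M ?_
        have h1 := M_spinRep g (fanoSpinor 4) (graphMap η x)
        rw [hc, M_smul, hε, M_graphMap, map_smul, LinearMap.smul_apply] at h1
        calc _ = ((ε : ℤ) : ℂ) • ((ε : ℤ) : ℂ) • M (fanoSpinor 4) (vecMap g (graphMap η x)) := by
              rw [smul_smul, hεε, one_smul]
          _ = _ := by
              rw [h1, smul_smul]
              congr 1
              push_cast
              ring
    rcases Int.units_eq_one_or ε with rfl | rfl
    · exact Or.inl ⟨by rw [hmove, one_mul], by rw [hmove, one_mul]⟩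
    · exact Or.inr ⟨by rw [hmove, mul_one], by rw [hmove]; norm_num⟩

/-! ### Generic three-forms -/

theorem exteriorPower_map_map {V V' V'' : Type} [AddCommGroup V] [Module ℂ V] [AddCommGroup V']
    [Module ℂ V'] [AddCommGroup V''] [Module ℂ V''] (g : V' →ₗ[ℂ] V'') (f : V →ₗ[ℂ] V')
    (ω : ⋀[ℂ]^3 V) :
    exteriorPower.map 3 g (exteriorPower.map 3 f ω) = exteriorPower.map 3 (g ∘ₗ f) ω := by
  rw [← LinearMap.comp_apply, exteriorPower.map_comp]

theorem exteriorPower_map_equiv_symm {V V' : Type} [AddCommGroup V] [Module ℂ V] [AddCommGroup V']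
    [Module ℂ V'] (e : V ≃ₗ[ℂ] V') (ω : ⋀[ℂ]^3 V) :
    exteriorPower.map 3 (e.symm : V' →ₗ[ℂ] V) (exteriorPower.map 3 (e : V →ₗ[ℂ] V') ω) = ω := by
  rw [exteriorPower_map_map, LinearEquiv.symm_comp, exteriorPower.map_id, LinearMap.id_apply]

/-- Genericity is invariant under linear isomorphisms. -/
theorem IsGeneric.map {V V' : Type} [AddCommGroup V] [Module ℂ V] [AddCommGroup V']
    [Module ℂ V'] (e : V ≃ₗ[ℂ] V') {ω : ⋀[ℂ]^3 V} (h : IsGeneric ω) :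
    IsGeneric (exteriorPower.map 3 (e : V →ₗ[ℂ] V') ω) := by
  obtain ⟨I, hI, hU⟩ := h
  refine ⟨(fun f η => f (exteriorPower.map 3 (e.symm : V' →ₗ[ℂ] V) η)) '' I, ?_, ?_⟩
  · rintro _ ⟨f, hf, rfl⟩
    exact polyFun_comp (hI f hf) _
  · ext η
    have h1 : (∃ f ∈ I, f (exteriorPower.map 3 (e.symm : V' →ₗ[ℂ] V) η) ≠ 0) ↔
        ∃ g : V ≃ₗ[ℂ] V, exteriorPower.map 3 (e.symm : V' →ₗ[ℂ] V) η =
          exteriorPower.map 3 (g : V →ₗ[ℂ] V) ω := (Set.ext_iff.mp hU _).symm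
    have h2 : (∃ f ∈ (fun f η => f (exteriorPower.map 3 (e.symm : V' →ₗ[ℂ] V) η)) '' I, f η ≠ 0) ↔
        ∃ f ∈ I, f (exteriorPower.map 3 (e.symm : V' →ₗ[ℂ] V) η) ≠ 0 := Set.exists_mem_image
    rw [Set.mem_ofPred_eq, Set.mem_ofPred_eq, h2, h1]
    constructor
    · rintro ⟨g, rfl⟩
      refine ⟨e.trans (g.trans e.symm), ?_⟩
      rw [exteriorPower_map_map, exteriorPower_map_map]
      rfl
    · rintro ⟨g, hg⟩
      refine ⟨e.symm.trans (g.trans e), ?_⟩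
      have h3 := congrArg (exteriorPower.map 3 (e : V →ₗ[ℂ] V')) hg
      have h4 := exteriorPower_map_equiv_symm e.symm η
      rw [LinearEquiv.symm_symm] at h4
      rw [h4] at h3
      rw [h3, exteriorPower_map_map, exteriorPower_map_map]
      congr 2
      ext x
      simp

/-- The orbit of a three-form on `ℂ⁷`. -/
def glOrbit (ω : ⋀[ℂ]^3 E7) : Set (⋀[ℂ]^3 E7) :=
  {η | ∃ g : E7 ≃ₗ[ℂ] E7, η = exteriorPower.map 3 (g : E7 →ₗ[ℂ] E7) ω}

theorem mem_glOrbit_self (ω : ⋀[ℂ]^3 E7) : ω ∈ glOrbit ω :=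
  ⟨LinearEquiv.refl ℂ E7, by
    rw [LinearEquiv.refl_toLinearMap, exteriorPower.map_id, LinearMap.id_apply]⟩

/-- The effect on a three-form of an endomorphism of rank one. -/
def rankOneDeriv (φ : Module.Dual ℂ E7) (x : E7) (ω : ⋀[ℂ]^3 E7) : ⋀[ℂ]^3 E7 :=
  exteriorPower.map 3 (LinearMap.id + φ.smulRight x) ω - ω

/-- The triple wedge product. -/
def wedge3 (a b c : E7) : ⋀[ℂ]^3 E7 := exteriorPower.ιMulti ℂ 3 ![a, b, c]

theorem wedge3_add_smul (a b c x : E7) (r s t : ℂ) :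
    wedge3 (a + r • x) (b + s • x) (c + t • x) = wedge3 a b c + r • wedge3 x b c +
      s • wedge3 a x c + t • wedge3 a b x := by
  have u0 : ∀ x y b c : E7, Function.update ![y, b, c] 0 x = ![x, b, c] := fun x y b c => by
    ext i : 1
    fin_cases i <;> simp
  have u1 : ∀ x y b c : E7, Function.update ![b, y, c] 1 x = ![b, x, c] := fun x y b c => by
    ext i : 1
    fin_cases i <;> simp
  have u2 : ∀ x y b c : E7, Function.update ![b, c, y] 2 x = ![b, c, x] := fun x y b c => by
    ext i : 1
    fin_cases i <;> simp
  have h0 : ∀ (a a' b c : E7) (r : ℂ), wedge3 (a + r • a') b c =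
      wedge3 a b c + r • wedge3 a' b c := fun a a' b c r => by
    have h := (exteriorPower.ιMulti ℂ 3).map_update_add ![0, b, c] 0 a (r • a')
    rwa [AlternatingMap.map_update_smul, u0, u0, u0] at h
  have h1 : ∀ (a a' b c : E7) (r : ℂ), wedge3 b (a + r • a') c =
      wedge3 b a c + r • wedge3 b a' c := fun a a' b c r => by
    have h := (exteriorPower.ιMulti ℂ 3).map_update_add ![b, 0, c] 1 a (r • a')
    rwa [AlternatingMap.map_update_smul, u1, u1, u1] at h
  have h2 : ∀ (a a' b c : E7) (r : ℂ), wedge3 b c (a + r • a') =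
      wedge3 b c a + r • wedge3 b c a' := fun a a' b c r => by
    have h := (exteriorPower.ιMulti ℂ 3).map_update_add ![b, c, 0] 2 a (r • a')
    rwa [AlternatingMap.map_update_smul, u2, u2, u2] at h
  have z01 : ∀ x c : E7, wedge3 x x c = 0 := fun x c =>
    (exteriorPower.ιMulti ℂ 3).map_eq_zero_of_eq ![x, x, c] (i := 0) (j := 1) rfl (by decide)
  have z02 : ∀ x c : E7, wedge3 x c x = 0 := fun x c =>
    (exteriorPower.ιMulti ℂ 3).map_eq_zero_of_eq ![x, c, x] (i := 0) (j := 2) rfl (by decide)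
  have z12 : ∀ x c : E7, wedge3 c x x = 0 := fun x c =>
    (exteriorPower.ιMulti ℂ 3).map_eq_zero_of_eq ![c, x, x] (i := 1) (j := 2) rfl (by decide)
  rw [h0, h1, h2, h2, h1, h2, h2, z12, z01, z02, z01]
  module

theorem map_wedge3 (f : E7 →ₗ[ℂ] E7) (a b c : E7) :
    exteriorPower.map 3 f (wedge3 a b c) = wedge3 (f a) (f b) (f c) := by
  rw [wedge3, exteriorPower.map_apply_ιMulti, wedge3]
  congr 1
  ext i : 1
  fin_cases i <;> rfl

/-- For an endomorphism of rank one all terms of higher order in t contain x twice and vanish, so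
its path in GL₇ traces a line. -/
theorem map_id_add_smulRight (φ : Module.Dual ℂ E7) (x : E7) (t : ℂ) (ω : ⋀[ℂ]^3 E7) :
    exteriorPower.map 3 (LinearMap.id + t • φ.smulRight x) ω = ω + t • rankOneDeriv φ x ω := by
  suffices h : exteriorPower.map 3 (LinearMap.id + t • φ.smulRight x) =
      LinearMap.id + t • (exteriorPower.map 3 (LinearMap.id + φ.smulRight x) - LinearMap.id) from
    LinearMap.congr_fun h ω
  refine linearMap_ext_wedge3 fun a b c => ?_
  change exteriorPower.map 3 _ (wedge3 a b c) = wedge3 a b c +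
    t • (exteriorPower.map 3 _ (wedge3 a b c) - wedge3 a b c)
  rw [map_wedge3, map_wedge3]
  simp only [LinearMap.add_apply, LinearMap.id_apply, LinearMap.smul_apply,
    LinearMap.smulRight_apply, smul_smul, wedge3_add_smul]
  module

theorem rankOneDeriv_wedge3 (φ : Module.Dual ℂ E7) (x a b c : E7) :
    rankOneDeriv φ x (wedge3 a b c) =
      φ a • wedge3 x b c + φ b • wedge3 a x c + φ c • wedge3 a b x := by
  rw [rankOneDeriv, map_wedge3]
  simp only [LinearMap.add_apply, LinearMap.id_apply, LinearMap.smulRight_apply, wedge3_add_smul]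
  module

theorem rankOneDeriv_mem_lineDirections (φ : Module.Dual ℂ E7) (x : E7) (ω : ⋀[ℂ]^3 E7) :
    rankOneDeriv φ x ω ∈ lineDirections (glOrbit ω) ω := by
  have h : ∀ᶠ t in 𝓝 (0 : ℂ), 1 + t * φ x ≠ 0 :=
    (continuous_const.add (continuous_id.mul continuous_const)).continuousAt.eventually_ne
      (by simp)
  filter_upwards [h] with t ht
  let f : E7 →ₗ[ℂ] E7 := LinearMap.id + t • φ.smulRight x
  -- The inverse of a rank one perturbation of the identity, valid when 1 + t φ(x) ≠ 0.
  let g : E7 →ₗ[ℂ] E7 := LinearMap.id - (t / (1 + t * φ x)) • φ.smulRight x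
  have h1 : f ∘ₗ g = LinearMap.id := LinearMap.ext fun y => by
    simp only [f, g, LinearMap.comp_apply, LinearMap.add_apply, LinearMap.sub_apply,
      LinearMap.id_apply, LinearMap.smul_apply, LinearMap.smulRight_apply, map_sub, map_smul]
    match_scalars
    · ring
    · field_simp
      ring
  have h2 : g ∘ₗ f = LinearMap.id := LinearMap.ext fun y => by
    simp only [f, g, LinearMap.comp_apply, LinearMap.add_apply, LinearMap.sub_apply,
      LinearMap.id_apply, LinearMap.smul_apply, LinearMap.smulRight_apply, map_add, map_smul]
    match_scalars
    · ring
    · field_simp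
      ring
  exact ⟨LinearEquiv.ofLinearMap f g h1 h2, (map_id_add_smulRight φ x t ω).symm⟩

/-- For each triple, a combination of matrix units which takes `fanoForm` to a multiple of the
corresponding monomial. -/
def tripleTable : List ((Fin 7 × Fin 7 × Fin 7) × List (Fin 7 × Fin 7 × ℤ)) :=
  [((0, 1, 2), [(0, 4, 3), (1, 6, 3), (3, 2, -3)]),
   ((0, 1, 3), [(0, 0, -2), (1, 1, -2), (2, 2, 1), (3, 3, -2), (4, 4, 1), (5, 5, 1), (6, 6, 1)]),
   ((0, 1, 4), [(0, 2, -3), (1, 5, -3), (3, 4, -3)]),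
   ((0, 1, 5), [(0, 6, -3), (1, 4, 3), (3, 5, -3)]),
   ((0, 1, 6), [(0, 5, 3), (1, 2, -3), (3, 6, -3)]),
   ((0, 2, 3), [(0, 5, -3), (1, 2, -3), (3, 6, -3)]),
   ((0, 2, 4), [(0, 1, 3), (2, 5, -3), (6, 4, -3)]),
   ((0, 2, 5), [(0, 3, 3), (2, 4, 3), (6, 5, -3)]),
   ((0, 2, 6), [(0, 0, -2), (1, 1, 1), (2, 2, -2), (3, 3, 1), (4, 4, 1), (5, 5, 1), (6, 6, -2)]),
   ((0, 3, 4), [(0, 6, 3), (1, 4, 3), (3, 5, -3)]),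
   ((0, 3, 5), [(0, 2, -3), (1, 5, 3), (3, 4, 3)]),
   ((0, 3, 6), [(0, 4, -3), (1, 6, 3), (3, 2, -3)]),
   ((0, 4, 5), [(0, 0, 2), (1, 1, -1), (2, 2, -1), (3, 3, -1), (4, 4, 2), (5, 5, 2), (6, 6, -1)]),
   ((0, 4, 6), [(0, 3, 3), (2, 4, -3), (6, 5, 3)]),
   ((0, 5, 6), [(0, 1, -3), (2, 5, -3), (6, 4, -3)]),
   ((1, 2, 3), [(0, 2, 3), (1, 5, -3), (3, 4, 3)]),
   ((1, 2, 4), [(0, 0, -1), (1, 1, 2), (2, 2, 2), (3, 3, -1), (4, 4, 2), (5, 5, -1), (6, 6, -1)]),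
   ((1, 2, 5), [(1, 3, 3), (2, 6, 3), (4, 5, 3)]),
   ((1, 2, 6), [(0, 1, -3), (2, 5, -3), (6, 4, 3)]),
   ((1, 3, 4), [(0, 4, -3), (1, 6, 3), (3, 2, 3)]),
   ((1, 3, 5), [(0, 5, -3), (1, 2, -3), (3, 6, 3)]),
   ((1, 3, 6), [(0, 6, -3), (1, 4, -3), (3, 5, -3)]),
   ((1, 4, 5), [(0, 1, 3), (4, 6, 3), (5, 2, -3)]),
   ((1, 4, 6), [(1, 3, 3), (2, 6, -3), (4, 5, -3)]),
   ((1, 5, 6), [(0, 0, 1), (1, 1, -2), (2, 2, 1), (3, 3, 1), (4, 4, 1), (5, 5, -2), (6, 6, -2)]),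
   ((2, 3, 4), [(1, 3, -3), (2, 6, 3), (4, 5, -3)]),
   ((2, 3, 5), [(0, 0, 1), (1, 1, 1), (2, 2, -2), (3, 3, -2), (4, 4, 1), (5, 5, -2), (6, 6, 1)]),
   ((2, 3, 6), [(0, 3, 3), (2, 4, -3), (6, 5, -3)]),
   ((2, 4, 5), [(0, 2, 3), (4, 3, -3), (5, 1, 3)]),
   ((2, 4, 6), [(0, 4, 3), (2, 3, 3), (6, 1, 3)]),
   ((2, 5, 6), [(0, 5, 3), (2, 1, -3), (6, 3, 3)]),
   ((3, 4, 5), [(0, 3, 3), (4, 2, 3), (5, 6, 3)]),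
   ((3, 4, 6), [(0, 0, -1), (1, 1, -1), (2, 2, -1), (3, 3, 2), (4, 4, 2), (5, 5, -1), (6, 6, 2)]),
   ((3, 5, 6), [(1, 3, -3), (5, 4, 3), (6, 2, -3)]),
   ((4, 5, 6), [(0, 6, 3), (4, 1, -3), (5, 3, -3)])]
/-- The sign of `i, j, k` as a permutation of `a, b, c`, zero if it is not one. -/
def wedgeCoeff (a b c i j k : Fin 7) : ℤ :=
  if a = i then (if b = j then (if c = k then 1 else 0) else
    if b = k then (if c = j then -1 else 0) else 0) else
  if a = j then (if b = k then (if c = i then 1 else 0) else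
    if b = i then (if c = k then -1 else 0) else 0) else
  if a = k then (if b = i then (if c = j then 1 else 0) else
    if b = j then (if c = i then -1 else 0) else 0) else 0

theorem wedgeCoeff_eq : ∀ i j k : Fin 7, i < j → j < k → ∀ a b c : Fin 7, wedgeCoeff a b c i j k =
    detThree fun r s => if ![a, b, c] r = ![i, j, k] s then 1 else 0 := by
  intro i j k hij hjk a b c
  have h1 := hij.ne
  have h2 := hjk.ne
  have h3 := (hij.trans hjk).ne
  have h : ∀ x : Fin 7, x = i ∨ x = j ∨ x = k ∨ (x ≠ i ∧ x ≠ j ∧ x ≠ k) := by tauto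
  rcases h a with rfl | rfl | rfl | ⟨ha1, ha2, ha3⟩ <;>
  rcases h b with rfl | rfl | rfl | ⟨hb1, hb2, hb3⟩ <;>
  rcases h c with rfl | rfl | rfl | ⟨hc1, hc2, hc3⟩ <;>
  simp [wedgeCoeff, detThree, *, Ne.symm]

/-- The coefficients of the derivative of `fanoForm` by the matrix unit `(p, q)`. -/
def derivCoeff (p q i j k : Fin 7) : ℤ := ∑ l : Fin 7,
  if q = l then lineSign l * wedgeCoeff p (l + 1) (l + 3) i j k else
  if q = l + 1 then lineSign l * wedgeCoeff l p (l + 3) i j k else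
  if q = l + 3 then lineSign l * wedgeCoeff l (l + 1) p i j k else 0

/-- Certificates that 𝔤𝔩₇ takes the standard form to all of ∧³ℂ⁷, each reaching 6 times a monomial.
Coordinates on increasing triples suffice. -/
theorem tripleTable_spec : ∀ x ∈ tripleTable, ∀ i j k : Fin 7, i < j → j < k →
    (x.2.map fun y : Fin 7 × Fin 7 × ℤ => y.2.2 * derivCoeff y.1 y.2.1 i j k).sum =
      6 * wedgeCoeff x.1.1 x.1.2.1 x.1.2.2 i j k := by decide +kernel

theorem tripleTable_complete : ∀ a b c : Fin 7, a < b → b < c → ∃ x ∈ tripleTable,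
    x.1 = (a, b, c) := by decide +kernel

/-- The standard basis of `∧³ℂ⁷`. -/
def wedgeBasis : Module.Basis (Set.powersetCard (Fin 7) 3) ℂ (⋀[ℂ]^3 E7) :=
  (Pi.basisFun ℂ (Fin 7)).exteriorPower 3

theorem wedgeBasis_apply (s : Set.powersetCard (Fin 7) 3) : ∃ i j k : Fin 7, i < j ∧ j < k ∧
    wedgeBasis s = wedge3 (Pi.single i 1) (Pi.single j 1) (Pi.single k 1) ∧
    ∀ a b c : E7, wedgeBasis.repr (wedge3 a b c) s =
      (Matrix.of fun u v => (![a, b, c] u) (![i, j, k] v)).det := by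
  set f := Set.powersetCard.ofFinEmbEquiv.symm s with hf
  refine ⟨f 0, f 1, f 2, f.strictMono (by decide), f.strictMono (by decide), ?_, fun a b c => ?_⟩
  · rw [wedgeBasis, exteriorPower.basis_apply, exteriorPower.ιMulti_family, ← hf, wedge3]
    congr 1
    ext l : 1
    fin_cases l <;> simp
  · rw [wedgeBasis, exteriorPower.basis_repr_apply, wedge3, exteriorPower.ιMultiDual_apply_ιMulti]
    congr 2
    ext u v
    rw [← hf, Module.Basis.coord_apply, Pi.basisFun_repr]
    fin_cases v <;> rfl

theorem repr_wedge3_single {s : Set.powersetCard (Fin 7) 3} {i j k : Fin 7} (hij : i < j)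
    (hjk : j < k) (h : ∀ a b c : E7, wedgeBasis.repr (wedge3 a b c) s =
      (Matrix.of fun u v => (![a, b, c] u) (![i, j, k] v)).det) (a b c : Fin 7) :
    wedgeBasis.repr (wedge3 (Pi.single a 1) (Pi.single b 1) (Pi.single c 1)) s =
      (wedgeCoeff a b c i j k : ℂ) := by
  rw [h, wedgeCoeff_eq i j k hij hjk, ← det_cast_eq]
  congr 2
  ext u v
  have h1 : ![(Pi.single a 1 : E7), Pi.single b 1, Pi.single c 1] u = Pi.single (![a, b, c] u) 1 := by
    fin_cases u <;> rfl
  rw [h1, Pi.single_apply]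
  push_cast
  simp only [eq_comm]

theorem fanoForm_eq : fanoForm = ∑ l : Fin 7, (lineSign l : ℂ) •
    wedge3 (Pi.single l 1) (Pi.single (l + 1) 1) (Pi.single (l + 3) 1) := rfl

theorem repr_rankOneDeriv {s : Set.powersetCard (Fin 7) 3} {i j k : Fin 7} (hij : i < j)
    (hjk : j < k) (h : ∀ a b c : E7, wedgeBasis.repr (wedge3 a b c) s =
      (Matrix.of fun u v => (![a, b, c] u) (![i, j, k] v)).det) (p q : Fin 7) :
    wedgeBasis.repr (rankOneDeriv (LinearMap.proj q) (Pi.single p 1) fanoForm) s =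
      (derivCoeff p q i j k : ℂ) := by
  have hlin : ∀ (φ : Module.Dual ℂ E7) (x : E7), rankOneDeriv φ x fanoForm =
      ∑ l : Fin 7, (lineSign l : ℂ) • rankOneDeriv φ x
        (wedge3 (Pi.single l 1) (Pi.single (l + 1) 1) (Pi.single (l + 3) 1)) := fun φ x => by
    rw [rankOneDeriv, fanoForm_eq, map_sum, ← Finset.sum_sub_distrib]
    refine Finset.sum_congr rfl fun l _ => ?_
    rw [map_smul]
    exact (smul_sub _ _ _).symm
  rw [hlin, map_sum, Finsupp.finsetSum_apply, derivCoeff]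
  push_cast
  refine Finset.sum_congr rfl fun l _ => ?_
  have hne : ∀ l : Fin 7, l ≠ l + 1 ∧ l ≠ l + 3 ∧ l + 1 ≠ l + 3 := by decide
  obtain ⟨n1, n2, n3⟩ := hne l
  rw [map_smul, rankOneDeriv_wedge3]
  simp only [map_add, map_smul, Finsupp.smul_apply, Finsupp.add_apply,
    repr_wedge3_single hij hjk h, LinearMap.proj_apply, Pi.single_apply, smul_eq_mul]
  by_cases hq : q = l
  · subst hq
    simp [n1, n2]
  · by_cases hq1 : q = l + 1
    · subst hq1
      simp [n1.symm, n3]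
    · by_cases hq2 : q = l + 3
      · subst hq2
        simp [n2.symm, n3.symm]
      · simp [hq, hq1, hq2]

theorem wedgeBasis_mem_span (s : Set.powersetCard (Fin 7) 3) :
    wedgeBasis s ∈ Submodule.span ℂ (lineDirections (glOrbit fanoForm) fanoForm) := by
  obtain ⟨a, b, c, hab, hbc, hs, -⟩ := wedgeBasis_apply s
  obtain ⟨x, hx, hxs⟩ := tripleTable_complete a b c hab hbc
  have h1 : (6 : ℂ) • wedgeBasis s = (x.2.map fun y : Fin 7 × Fin 7 × ℤ => (y.2.2 : ℂ) •
      rankOneDeriv (LinearMap.proj y.2.1) (Pi.single y.1 1) fanoForm).sum := by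
    refine wedgeBasis.ext_elem fun s' => ?_
    obtain ⟨i, j, k, hij, hjk, -, h⟩ := wedgeBasis_apply s'
    rw [hs, map_smul, Finsupp.smul_apply, repr_wedge3_single hij hjk h]
    have h2 := congrArg (Int.cast : ℤ → ℂ) (tripleTable_spec x hx i j k hij hjk)
    rw [hxs] at h2
    push_cast at h2
    rw [smul_eq_mul, ← h2, ← Module.Basis.coord_apply, map_list_sum, List.map_map, List.map_map]
    congr 1
    refine List.map_congr_left fun y _ => ?_
    simp only [Function.comp_apply, map_smul, Module.Basis.coord_apply,
      repr_rankOneDeriv hij hjk h, smul_eq_mul, Int.cast_mul]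
  have h2 : wedgeBasis s = (6 : ℂ)⁻¹ • (6 : ℂ) • wedgeBasis s := by
    rw [smul_smul, inv_mul_cancel₀ (by norm_num), one_smul]
  rw [h2, h1]
  refine Submodule.smul_mem _ _ (list_sum_mem fun w hw => ?_)
  obtain ⟨y, -, rfl⟩ := List.mem_map.mp hw
  exact Submodule.smul_mem _ _ (Submodule.subset_span (rankOneDeriv_mem_lineDirections _ _ _))

theorem span_lineDirections_glOrbit {η : ⋀[ℂ]^3 E7} (hη : η ∈ glOrbit fanoForm) :
    Submodule.span ℂ (lineDirections (glOrbit fanoForm) η) = ⊤ := by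
  obtain ⟨g, rfl⟩ := hη
  have h0 : Submodule.span ℂ (lineDirections (glOrbit fanoForm) fanoForm) = ⊤ := by
    rw [← top_le_iff, ← wedgeBasis.span_eq, Submodule.span_le]
    rintro _ ⟨s, rfl⟩
    exact wedgeBasis_mem_span s
  have h1 : exteriorPower.map 3 (g : E7 →ₗ[ℂ] E7) '' lineDirections (glOrbit fanoForm) fanoForm ⊆
      lineDirections (glOrbit fanoForm) (exteriorPower.map 3 (g : E7 →ₗ[ℂ] E7) fanoForm) := by
    rintro _ ⟨w, hw, rfl⟩
    refine Filter.Eventually.mono hw fun t ht => ?_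
    obtain ⟨e, he⟩ := ht
    refine ⟨e.trans g, ?_⟩
    rw [← map_smul, ← map_add, he, exteriorPower_map_map]
    rfl
  refine top_le_iff.mp (le_trans ?_ (Submodule.span_mono h1))
  rw [← Submodule.map_span, h0]
  intro x _
  refine ⟨exteriorPower.map 3 (g.symm : E7 →ₗ[ℂ] E7) x, trivial, ?_⟩
  have h2 := exteriorPower_map_equiv_symm g.symm x
  rwa [LinearEquiv.symm_symm] at h2

theorem repr_map_mem_polyFun (ω : ⋀[ℂ]^3 E7) (s : Set.powersetCard (Fin 7) 3) :
    (fun u : Module.End ℂ E7 => wedgeBasis.repr (exteriorPower.map 3 u ω) s) ∈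
      polyFun (Module.End ℂ E7) := by
  obtain ⟨i, j, k, -, -, -, h⟩ := wedgeBasis_apply s
  have hent : ∀ (a : E7) (i : Fin 7), (fun u : Module.End ℂ E7 => u a i) ∈
      polyFun (Module.End ℂ E7) := fun a i =>
    linear_mem_polyFun ((LinearMap.proj i : E7 →ₗ[ℂ] ℂ) ∘ₗ LinearMap.applyₗ a)
  have hw : ∀ a b c : E7, (fun u : Module.End ℂ E7 =>
      wedgeBasis.repr (exteriorPower.map 3 u (wedge3 a b c)) s) ∈ polyFun (Module.End ℂ E7) := by
    intro a b c
    simp only [map_wedge3, h, Matrix.det_fin_three, Matrix.of_apply, Matrix.cons_val_zero,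
      Matrix.cons_val_one, Matrix.cons_val]
    have hm : ∀ (x y z : E7) (i j k : Fin 7), (fun u : Module.End ℂ E7 => u x i * u y j * u z k) ∈
        polyFun (Module.End ℂ E7) := fun x y z i j k =>
      (polyFun _).mul_mem ((polyFun _).mul_mem (hent x i) (hent y j)) (hent z k)
    exact (polyFun _).sub_mem ((polyFun _).add_mem ((polyFun _).add_mem ((polyFun _).sub_mem
      ((polyFun _).sub_mem (hm _ _ _ _ _ _) (hm _ _ _ _ _ _)) (hm _ _ _ _ _ _))
      (hm _ _ _ _ _ _)) (hm _ _ _ _ _ _)) (hm _ _ _ _ _ _)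
  have hexp : ∀ u : Module.End ℂ E7, wedgeBasis.repr (exteriorPower.map 3 u ω) s =
      ∑ r, wedgeBasis.repr ω r * wedgeBasis.repr (exteriorPower.map 3 u (wedgeBasis r)) s := by
    intro u
    conv_lhs => rw [← wedgeBasis.sum_repr ω]
    simp only [map_sum, map_smul, Finsupp.finsetSum_apply, Finsupp.smul_apply, smul_eq_mul]
  have hfun : (fun u : Module.End ℂ E7 => wedgeBasis.repr (exteriorPower.map 3 u ω) s) =
      ∑ r, wedgeBasis.repr ω r • fun u : Module.End ℂ E7 =>
        wedgeBasis.repr (exteriorPower.map 3 u (wedgeBasis r)) s := by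
    ext u
    rw [hexp, Finset.sum_apply]
    rfl
  rw [hfun]
  refine (polyFun _).sum_mem fun r _ => (polyFun _).smul_mem ?_ _
  obtain ⟨i', j', k', -, -, hr, -⟩ := wedgeBasis_apply r
  rw [hr]
  exact hw _ _ _

theorem det_mem_polyFun : (fun u : Module.End ℂ E7 => LinearMap.det u) ∈
    polyFun (Module.End ℂ E7) := by
  have h : (fun u : Module.End ℂ E7 => LinearMap.det u) = ∑ σ : Equiv.Perm (Fin 7),
      ((Equiv.Perm.sign σ : ℤ) : ℂ) • ∏ i, fun u : Module.End ℂ E7 => u (Pi.single i 1) (σ i) := by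
    ext u
    rw [← LinearMap.det_toMatrix', Matrix.det_apply', Finset.sum_apply]
    refine Finset.sum_congr rfl fun σ _ => ?_
    rw [Pi.smul_apply, Finset.prod_apply, smul_eq_mul]
    simp [LinearMap.toMatrix'_apply]
  rw [h]
  exact (polyFun _).sum_mem fun σ _ => (polyFun _).smul_mem ((polyFun _).prod_mem fun i _ =>
    linear_mem_polyFun ((LinearMap.proj (σ i) : E7 →ₗ[ℂ] ℂ) ∘ₗ LinearMap.applyₗ (Pi.single i 1))) _

/-- The orbit map of GL₇ is dominant by the tangent computation, so by
`exists_forall_exists_eval_eq` the orbit contains a nonempty principal open set. Its translates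
cover the orbit. -/
theorem isGeneric_fanoForm : IsGeneric fanoForm := by
  let B := Module.finBasis ℂ (Module.End ℂ E7)
  choose F hF using fun s => exists_eval_of_mem_polyFun B (repr_map_mem_polyFun fanoForm s)
  obtain ⟨D, hD⟩ := exists_eval_of_mem_polyFun B det_mem_polyFun
  obtain ⟨h, h0, hh⟩ := exists_forall_exists_eval_eq F D (by
    intro p hp
    refine eq_zero_of_forall_mem wedgeBasis ⟨_, mem_glOrbit_self fanoForm⟩
      (fun _ hη => span_lineDirections_glOrbit hη) p ?_
    rintro _ ⟨g, rfl⟩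
    have h1 := hp (B.repr (g : E7 →ₗ[ℂ] E7)) (by
      rw [← hD]
      exact (LinearEquiv.isUnit_det' g).ne_zero)
    rw [← h1]
    exact congrArg (fun y => MvPolynomial.eval y p) (funext fun s => hF s (g : E7 →ₗ[ℂ] E7)))
  have hopen : ∀ η : ⋀[ℂ]^3 E7, MvPolynomial.eval (wedgeBasis.repr η) h ≠ 0 →
      η ∈ glOrbit fanoForm := by
    intro η hη
    obtain ⟨u, hu, hu'⟩ := hh _ hη
    let v : Module.End ℂ E7 := B.equivFun.symm u
    have hv : ⇑(B.repr v) = u := by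
      have := B.equivFun.apply_symm_apply u
      rwa [Module.Basis.equivFun_apply] at this
    have hdet : LinearMap.det v ≠ 0 := by
      rwa [hD, hv]
    refine ⟨LinearEquiv.ofIsUnitDet (f := v) (v := Pi.basisFun ℂ (Fin 7))
      (v' := Pi.basisFun ℂ (Fin 7)) (by
        rw [LinearMap.det_toMatrix]
        exact isUnit_iff_ne_zero.mpr hdet), ?_⟩
    refine wedgeBasis.ext_elem fun s => ?_
    rw [← hu' s]
    rw [← hv, ← hF]
    rfl
  obtain ⟨x, hx⟩ : ∃ x, MvPolynomial.eval x h ≠ 0 := by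
    by_contra! hall
    exact h0 (MvPolynomial.funext fun x => by rw [hall, map_zero])
  have hx' : MvPolynomial.eval (wedgeBasis.repr (wedgeBasis.equivFun.symm x)) h ≠ 0 := by
    have := wedgeBasis.equivFun.apply_symm_apply x
    rw [Module.Basis.equivFun_apply] at this
    rwa [this]
  obtain ⟨g₀, hg₀⟩ := hopen _ hx'
  -- The family of all translates of `h`: an element of the orbit can be moved to the point where
  -- `h` is known to be nonzero, and a translate is nonzero only on the orbit.
  refine ⟨{f | ∃ e : E7 ≃ₗ[ℂ] E7, f = fun η => MvPolynomial.eval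
    (wedgeBasis.repr (exteriorPower.map 3 (e : E7 →ₗ[ℂ] E7) η)) h}, ?_, ?_⟩
  · rintro _ ⟨e, rfl⟩
    exact polyFun_comp (eval_mem_polyFun wedgeBasis h) (exteriorPower.map 3 (e : E7 →ₗ[ℂ] E7))
  · ext η
    constructor
    · rintro ⟨g, rfl⟩
      refine ⟨_, ⟨g.symm.trans g₀, rfl⟩, ?_⟩
      have h1 : ((g.symm.trans g₀ : E7 ≃ₗ[ℂ] E7) : E7 →ₗ[ℂ] E7) ∘ₗ (g : E7 →ₗ[ℂ] E7) = g₀ :=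
        LinearMap.ext fun y => congrArg g₀ (g.symm_apply_apply y)
      rwa [exteriorPower_map_map, h1, ← hg₀]
    · rintro ⟨_, ⟨e, rfl⟩, hf⟩
      obtain ⟨g, hg⟩ := hopen _ hf
      refine ⟨g.trans e.symm, ?_⟩
      have h1 := exteriorPower_map_equiv_symm e η
      rw [← h1, hg, exteriorPower_map_map]
      rfl

/-- A homothety of ratio r multiplies three-forms by r³, so a cube root of the scalar keeps the form
in the same orbit up to isomorphism. -/
theorem isGeneric_smul_fanoForm {a : ℂ} (ha : a ≠ 0) : IsGeneric (a • fanoForm) := by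
  obtain ⟨r, rfl⟩ := IsAlgClosed.exists_pow_nat_eq a three_pos
  have hr : r ≠ 0 := fun h => ha (by rw [h]; ring)
  have h := isGeneric_fanoForm.map (LinearEquiv.smulOfNeZero ℂ E7 r hr)
  have h1 : exteriorPower.map 3 ((LinearEquiv.smulOfNeZero ℂ E7 r hr : E7 ≃ₗ[ℂ] E7) : E7 →ₗ[ℂ] E7) =
      r ^ 3 • LinearMap.id := by
    refine linearMap_ext_wedge3 fun a b c => ?_
    rw [exteriorPower.map_apply_ιMulti]
    have h2 := (exteriorPower.ιMulti ℂ 3).map_smul_univ (fun _ => r) ![a, b, c]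
    rw [Finset.prod_const, Finset.card_univ, Fintype.card_fin] at h2
    exact h2
  rw [h1] at h
  exact h

/-! ### The open orbit -/

theorem vecMap_mul (g h : Spin14Group) (v : V14) : vecMap (g * h) v = vecMap g (vecMap h v) := by
  rw [vecMap_eq_iff, Submonoid.coe_mul, mul_assoc, (vecMap_eq_iff h v _).mp rfl, ← mul_assoc,
    (vecMap_eq_iff g (vecMap h v) _).mp rfl, mul_assoc]

theorem moveSubspace_mul (g h : Spin14Group) (W : Submodule ℂ V14) :
    moveSubspace (g * h) W = moveSubspace g (moveSubspace h W) := by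
  rw [moveSubspace_eq, moveSubspace_eq, moveSubspace_eq, ← Submodule.map_comp]
  congr 1
  exact LinearMap.ext (vecMap_mul g h)

theorem moveSubspace_one (W : Submodule ℂ V14) : moveSubspace 1 W = W := by
  have h : vecMap 1 = LinearMap.id := LinearMap.ext fun v => by
    rw [vecMap_eq_iff, Submonoid.coe_one, one_mul, mul_one, LinearMap.id_apply]
  rw [moveSubspace_eq, h, Submodule.map_id]

theorem finrank_moveSubspace (g : Spin14Group) (W : Submodule ℂ V14) :
    Module.finrank ℂ (moveSubspace g W) = Module.finrank ℂ W := by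
  rw [moveSubspace_eq]
  exact LinearEquiv.finrank_map_eq (vecEquiv g) W

theorem isCompl_moveSubspace (g : Spin14Group) {W W' : Submodule ℂ V14} (h : IsCompl W W') :
    IsCompl (moveSubspace g W) (moveSubspace g W') := by
  rw [moveSubspace_eq, moveSubspace_eq]
  exact (Submodule.orderIsoMapComap (vecEquiv g)).isCompl h

theorem q_moveSubspace (g : Spin14Group) {W W' : Submodule ℂ V14}
    (h : ∀ x ∈ W, ∀ y ∈ W', q x y = 0) :
    ∀ x ∈ moveSubspace g W, ∀ y ∈ moveSubspace g W', q x y = 0 := by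
  rw [moveSubspace_eq, moveSubspace_eq]
  rintro _ ⟨x, hx, rfl⟩ _ ⟨y, hy, rfl⟩
  rw [q_vecMap, h x hx y hy]

theorem IsAssociatedPair.transport {z : Delta14} {V V' : Submodule ℂ V14}
    (h : IsAssociatedPair z V V') (g : Spin14Group) {c : ℂ} (hc : c ≠ 0) :
    IsAssociatedPair (c • spinRep g z) (moveSubspace g V) (moveSubspace g V') where
  finrank_left := (finrank_moveSubspace g V).trans h.finrank_left
  finrank_right := (finrank_moveSubspace g V').trans h.finrank_right
  isCompl := isCompl_moveSubspace g h.isCompl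
  orthogonal := q_moveSubspace g h.orthogonal
  stable := by
    rintro k ⟨a, ha⟩
    have h1 : spinRep (g⁻¹ * k * g) z = a • z := by
      rw [map_smul, smul_comm a c] at ha
      have h2 := congrArg (spinRep g⁻¹) (smul_right_injective Delta14 hc ha)
      rw [map_smul, spinRep_inv_apply] at h2
      rw [map_mul, map_mul, Module.End.mul_apply, Module.End.mul_apply, h2]
    have h2 : ∀ W, moveSubspace k (moveSubspace g W) =
        moveSubspace g (moveSubspace (g⁻¹ * k * g) W) := fun W => by
      rw [← moveSubspace_mul, ← moveSubspace_mul, mul_assoc, mul_inv_cancel_left]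
    rw [h2, h2]
    rcases h.stable _ ⟨a, h1⟩ with ⟨h3, h4⟩ | ⟨h3, h4⟩
    · exact Or.inl ⟨by rw [h3], by rw [h4]⟩
    · exact Or.inr ⟨by rw [h3], by rw [h4]⟩

/-- The subspaces attached to a translate of the representative of the open orbit. -/
def graphSpace (g : Spin14Group) (ε : ℤˣ) : Submodule ℂ V14 :=
  moveSubspace g (LinearMap.range (graphMap ε))

theorem graphSpace_eq_range (g : Spin14Group) (ε : ℤˣ) :
    graphSpace g ε = LinearMap.range (vecMap g ∘ₗ graphMap ε) := by
  rw [graphSpace, moveSubspace_eq, LinearMap.range_comp]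

theorem isAssociatedPair_graphSpace (g : Spin14Group) {c : ℂ} (hc : c ≠ 0) :
    IsAssociatedPair (c • spinRep g (fanoSpinor 4)) (graphSpace g 1) (graphSpace g (-1)) :=
  isAssociatedPair_fanoSpinor_four.transport g hc

theorem IsAssociatedPair.eq_graphSpace {g : Spin14Group} {c : ℂ} (hc : c ≠ 0)
    {W W' : Submodule ℂ V14} (h : IsAssociatedPair (c • spinRep g (fanoSpinor 4)) W W') :
    ∃ ε : ℤˣ, W = graphSpace g ε ∧ W' = graphSpace g (-ε) := by
  have h1 := h.transport g⁻¹ (inv_ne_zero hc)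
  rw [map_smul, spinRep_inv_apply, smul_smul, inv_mul_cancel₀ hc, one_smul] at h1
  have h2 : ∀ {W U : Submodule ℂ V14}, moveSubspace g⁻¹ W = U → W = moveSubspace g U := by
    rintro W _ rfl
    rw [← moveSubspace_mul, mul_inv_cancel, moveSubspace_one]
  rcases h1.eq_range_graphMap with ⟨h3, h4⟩ | ⟨h3, h4⟩
  · exact ⟨1, h2 h3, h2 h4⟩
  · exact ⟨-1, h2 h3, by rw [neg_neg]; exact h2 h4⟩

theorem exists_isGeneric {i : E7 →ₗ[ℂ] V14} (hi : Function.Injective i) {V : Submodule ℂ V14}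
    (hV : V = LinearMap.range i) {a : ℂ} (ha : a ≠ 0) :
    ∃ Ω : ⋀[ℂ]^3 V, IsGeneric Ω ∧
      exteriorPower.map 3 V.subtype Ω = exteriorPower.map 3 i (a • fanoForm) := by
  subst hV
  refine ⟨_, (isGeneric_smul_fanoForm ha).map (LinearEquiv.ofInjective i hi), ?_⟩
  rw [exteriorPower_map_map]
  rfl

theorem Omega_openOrbit (g : Spin14Group) (c : ℂ) (ε : ℤˣ) :
    Omega (c • spinRep g (fanoSpinor 4)) =
      exteriorPower.map 3 (vecMap g ∘ₗ graphMap ε) ((c ^ 2 * (4 * ((ε : ℤ) : ℂ))) • fanoForm) +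
      exteriorPower.map 3 (vecMap g ∘ₗ graphMap (-ε))
        ((c ^ 2 * (-4 * ((ε : ℤ) : ℂ))) • fanoForm) := by
  rw [Omega_smul, Omega_spinRep, Omega_fanoSpinor_four, map_add, smul_add,
    exteriorPower_map_map, exteriorPower_map_map, ← map_smul, ← map_smul, smul_smul, smul_smul]
  rcases Int.units_eq_one_or ε with rfl | rfl
  · simp
    exact (neg_smul _ _).symm
  · rw [add_comm]
    simp
    exact (neg_smul _ _).symm

theorem M_openOrbit (g : Spin14Group) (c : ℂ) (ε : ℤˣ) {v : V14} (hv : v ∈ graphSpace g ε) :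
    M (c • spinRep g (fanoSpinor 4)) v = (c ^ 4 * (384 * ((ε : ℤ) : ℂ))) • v := by
  rw [graphSpace_eq_range] at hv
  obtain ⟨x, rfl⟩ := hv
  rw [M_smul, LinearMap.smul_apply, LinearMap.comp_apply, M_spinRep, M_graphMap, map_smul,
    smul_smul]

theorem eq_smul_projection_sub {V V' : Submodule ℂ V14} (h : IsCompl V V')
    {f : Module.End ℂ V14} {m : ℂ} (hV : ∀ v ∈ V, f v = (-m) • v) (hV' : ∀ v ∈ V', f v = m • v) :
    f = m • (V'.projection V h.symm - V.projection V' h) := by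
  refine LinearMap.ext fun x => ?_
  have h1 := Submodule.projection_add_projection_eq_self h x
  rw [LinearMap.smul_apply, LinearMap.sub_apply]
  conv_lhs => rw [← h1]
  rw [map_add, hV _ (Submodule.projection_apply_mem h x),
    hV' _ (Submodule.projection_apply_mem h.symm x)]
  module

theorem openOrbit_spec {z : Delta14} (hz : InOpenOrbit z) :
    (∃ V V' : Submodule ℂ V14, IsAssociatedPair z V V' ∧
      ∀ W W' : Submodule ℂ V14, IsAssociatedPair z W W' →
        (W = V ∧ W' = V') ∨ (W = V' ∧ W' = V)) ∧
    ∀ (V V' : Submodule ℂ V14) (h : IsAssociatedPair z V V'),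
      (∃ (Ω : ⋀[ℂ]^3 V) (Ω' : ⋀[ℂ]^3 V'), IsGeneric Ω ∧ IsGeneric Ω' ∧
        Omega z = exteriorPower.map 3 V.subtype Ω + exteriorPower.map 3 V'.subtype Ω') ∧
      ∃ m : ℂ, M z = m • (V'.projection V h.isCompl.symm - V.projection V' h.isCompl) ∧
        octic z = m ^ 2 := by
  obtain ⟨c, hc, g, rfl⟩ := mem_orbitCone_of_inOpenOrbit tangentSpace_fanoSpinor_four hz
  refine ⟨⟨_, _, isAssociatedPair_graphSpace g hc, fun W W' h => ?_⟩, fun V V' h => ?_⟩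
  · obtain ⟨ε, h1, h2⟩ := h.eq_graphSpace hc
    rcases Int.units_eq_one_or ε with rfl | rfl
    · exact Or.inl ⟨h1, h2⟩
    · rw [neg_neg] at h2
      exact Or.inr ⟨h1, h2⟩
  · obtain ⟨ε, h1, h2⟩ := h.eq_graphSpace hc
    have hε : ((ε : ℤ) : ℂ) ^ 2 = 1 := by
      rcases Int.units_eq_one_or ε with rfl | rfl <;> norm_num
    have hε0 : ((ε : ℤ) : ℂ) ≠ 0 := fun h0 => by
      rw [h0] at hε
      norm_num at hε
    constructor
    · have hi : ∀ η : ℤˣ, Function.Injective (vecMap g ∘ₗ graphMap η) := fun η =>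
        (vecEquiv g).injective.comp (graphMap_injective η)
      obtain ⟨Ω, hΩ, hΩe⟩ := exists_isGeneric (hi ε) (h1.trans (graphSpace_eq_range g ε))
        (a := c ^ 2 * (4 * ((ε : ℤ) : ℂ)))
        (mul_ne_zero (pow_ne_zero _ hc) (mul_ne_zero (by norm_num) hε0))
      obtain ⟨Ω', hΩ', hΩe'⟩ := exists_isGeneric (hi (-ε)) (h2.trans (graphSpace_eq_range g (-ε)))
        (a := c ^ 2 * (-4 * ((ε : ℤ) : ℂ)))
        (mul_ne_zero (pow_ne_zero _ hc) (mul_ne_zero (by norm_num) hε0))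
      exact ⟨Ω, Ω', hΩ, hΩ', by rw [hΩe, hΩe', Omega_openOrbit]⟩
    -- The eigenvalue of M on `V` is −m by the convention of the statement; ε records which graph
    -- `V` comes from.
    · refine ⟨-(c ^ 4 * (384 * ((ε : ℤ) : ℂ))), eq_smul_projection_sub _ (fun v hv => ?_)
        (fun v hv => ?_), ?_⟩
      · rw [neg_neg]
        exact M_openOrbit g c ε (h1 ▸ hv)
      · rw [M_openOrbit g c (-ε) (h2 ▸ hv), Units.val_neg, Int.cast_neg]
        congr 1
        ring
      · rw [octic_smul, octic_spinRep, octic_fanoSpinor_four]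
        linear_combination (-(c ^ 8 * 384 ^ 2)) * hε

/-! ### Factors of the octic -/

theorem exists_polynomial_line {W : Type} [AddCommGroup W] [Module ℂ W] {f : W → ℂ}
    (hf : f ∈ polyFun W) (z w : W) : ∃ P : Polynomial ℂ, ∀ t : ℂ, f (z + t • w) = P.eval t := by
  induction hf using Algebra.adjoin_induction with
  | mem f h =>
    obtain ⟨l, rfl⟩ := h
    exact ⟨Polynomial.C (l z) + Polynomial.C (l w) * Polynomial.X, fun t => by
      simp only [map_add, map_smul, Polynomial.eval_add, Polynomial.eval_mul, Polynomial.eval_C,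
        Polynomial.eval_X, smul_eq_mul]
      ring⟩
  | algebraMap r => exact ⟨Polynomial.C r, fun t => by simp⟩
  | add f g hf hg hf' hg' =>
    obtain ⟨P, hP⟩ := hf'
    obtain ⟨R, hR⟩ := hg'
    exact ⟨P + R, fun t => by simp [hP, hR]⟩
  | mul f g hf hg hf' hg' =>
    obtain ⟨P, hP⟩ := hf'
    obtain ⟨R, hR⟩ := hg'
    exact ⟨P * R, fun t => by simp [hP, hR]⟩

/-- Factors of a polynomial function are constant on the lines where it is constant. -/
theorem factor_line {W : Type} [AddCommGroup W] [Module ℂ W] {f g : W → ℂ} (hf : f ∈ polyFun W)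
    (hg : g ∈ polyFun W) {z w : W} {c : ℂ} (hc : c ≠ 0)
    (h : ∀ t : ℂ, f (z + t • w) * g (z + t • w) = c) (t : ℂ) : f (z + t • w) = f z := by
  obtain ⟨P, hP⟩ := exists_polynomial_line hf z w
  obtain ⟨R, hR⟩ := exists_polynomial_line hg z w
  have h1 : P * R = Polynomial.C c := Polynomial.funext fun t => by
    rw [Polynomial.eval_mul, ← hP, ← hR, h, Polynomial.eval_C]
  have h2 : IsUnit P := isUnit_of_mul_isUnit_left (y := R) (by
    rw [h1, Polynomial.isUnit_C]
    exact isUnit_iff_ne_zero.mpr hc)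
  obtain ⟨a, -, ha⟩ := Polynomial.isUnit_iff.mp h2
  have h3 : ∀ t, f (z + t • w) = a := fun t => by rw [hP, ← ha, Polynomial.eval_C]
  have h4 := h3 0
  rw [zero_smul, add_zero] at h4
  rw [h3, h4]

/-- A product of elementary matrices. -/
theorem elementary_product {W : Type} [AddCommGroup W] [Module ℂ W] {A B : Module.End ℂ W}
    (hA : ∀ z, A (A z) = 0) (hB : ∀ z, B (B z) = 0) (hABA : ∀ z, A (B (A z)) = A z)
    (hBAB : ∀ z, B (A (B z)) = B z) {s : ℂ} (hs : s ≠ 0) (z : W) :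
    (fun x => x + (-(s⁻¹ - 1) * s) • A x) ((fun x => x + (1 : ℂ) • B x)
      ((fun x => x + (s⁻¹ - 1) • A x) ((fun x => x + (-s) • B x) z))) =
      z + (s - 1) • A (B z) + (s⁻¹ - 1) • B (A z) := by
  -- Like the matrix units E₁₂ and E₂₁, A and B have complementary products AB and BA; the identity
  -- writes diag(s, s⁻¹) as a product of four elementary matrices.
  simp only [map_add, map_smul, hA, hB, hABA, hBAB, smul_zero, add_zero, smul_add]
  match_scalars <;> field_simp <;> ring

/-- An operator on `Δ₁₄` whose exponentials belong to `Spin₁₄`. -/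
def IsUnipotentGenerator (A : Module.End ℂ Delta14) : Prop :=
  ∀ t : ℂ, ∃ g : Spin14Group, ∀ z, spinRep g z = z + t • A z

theorem isUnipotentGenerator_biv {m k : Fin 14} (hmk : k ≠ m + 7) (c : ℂ) :
    IsUnipotentGenerator (c • biv (vBasis m) (vBasis k)) := fun t => by
  obtain ⟨g, hg⟩ := exists_spinRep_basis_unipotent hmk (t * c)
  exact ⟨g, fun z => by rw [hg, LinearMap.smul_apply, smul_smul]⟩

theorem factor_unipotent {f g : Delta14 → ℂ} (hf : f ∈ polyFun Delta14) (hg : g ∈ polyFun Delta14)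
    (hfg : f * g = octic) {A : Module.End ℂ Delta14} (hA : IsUnipotentGenerator A) {z : Delta14}
    (hz : octic z ≠ 0) (t : ℂ) : f (z + t • A z) = f z ∧ octic (z + t • A z) = octic z := by
  have h : ∀ t : ℂ, octic (z + t • A z) = octic z := fun t => by
    obtain ⟨g, hg⟩ := hA t
    rw [← hg, octic_spinRep]
  exact ⟨factor_line hf hg hz (fun t => by rw [← Pi.mul_apply, hfg, h]) t, h t⟩

/-- Invariance under unipotents passes to the torus element they generate. The octic is carried
along because each application requires it to be nonzero at the current point. -/
theorem factor_elementary {f g : Delta14 → ℂ} (hf : f ∈ polyFun Delta14)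
    (hg : g ∈ polyFun Delta14) (hfg : f * g = octic) {A B : Module.End ℂ Delta14}
    (hA : IsUnipotentGenerator A) (hB : IsUnipotentGenerator B)
    (hAA : ∀ z, A (A z) = 0) (hBB : ∀ z, B (B z) = 0) (hABA : ∀ z, A (B (A z)) = A z)
    (hBAB : ∀ z, B (A (B z)) = B z) {s : ℂ} (hs : s ≠ 0) {z : Delta14} (hz : octic z ≠ 0) :
    f (z + (s - 1) • A (B z) + (s⁻¹ - 1) • B (A z)) = f z ∧
      octic (z + (s - 1) • A (B z) + (s⁻¹ - 1) • B (A z)) = octic z := by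
  rw [← elementary_product hAA hBB hABA hBAB hs z]
  have h1 := factor_unipotent hf hg hfg hB hz (-s)
  have h2 := factor_unipotent hf hg hfg hA (by rw [h1.2]; exact hz) (s⁻¹ - 1)
  have h3 := factor_unipotent hf hg hfg hB (by rw [h2.2, h1.2]; exact hz) 1
  have h4 := factor_unipotent hf hg hfg hA (by rw [h3.2, h2.2, h1.2]; exact hz) (-(s⁻¹ - 1) * s)
  exact ⟨by rw [h4.1, h3.1, h2.1, h1.1], by rw [h4.2, h3.2, h2.2, h1.2]⟩

/-! ### Words in the basis vectors -/

/-- The coefficient of the action of a word in the basis vectors. -/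
def wordCoeff : List (Fin 14) → Fin 128 → ℤ
  | [], _ => 1
  | m :: L, n => skipMul (genCoeff m n) (wordCoeff L (flipBit m n))

/-- The bitmask moved to `n` by a word in the basis vectors. -/
def wordMask : List (Fin 14) → Fin 128 → Fin 128
  | [], n => n
  | m :: L, n => wordMask L (flipBit m n)

theorem foldr_gen (L : List (Fin 14)) (s : Sp) (n : Fin 128) :
    L.foldr (fun m s => gen ℂ m s) s n = wordCoeff L n * s (wordMask L n) := by
  induction L generalizing n with
  | nil => simp [wordCoeff, wordMask]
  | cons m L ih =>
    rw [List.foldr_cons, gen_apply, ih, wordCoeff, skipMul_eq, wordMask]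
    push_cast
    ring

/-- The four words attached to a pair `(i, i + 1)`. -/
def pairWord (i : Fin 7) (r : Fin 4) : Fin 14 × Fin 14 :=
  let a := Fin.castAdd 7 i
  let b := Fin.castAdd 7 (i + 1)
  ![(a, b), (b + 7, a + 7), (a, b + 7), (b, a + 7)] r

theorem pairWord_spec : ∀ i : Fin 7, ∀ r : Fin 4, (pairWord i r).2 ≠ (pairWord i r).1 + 7 := by
  decide

/-- The word opposite to a given one. -/
def oppositeWord (r : Fin 4) : Fin 4 := ![1, 0, 3, 2] r

theorem wordCoeff_sq : ∀ (i : Fin 7) (r : Fin 4) (n : Fin 128),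
    wordCoeff [(pairWord i r).1, (pairWord i r).2, (pairWord i r).1, (pairWord i r).2] n = 0 := by
  decide +kernel

theorem wordCoeff_triple : ∀ (i : Fin 7) (r : Fin 4) (n : Fin 128),
    wordCoeff [(pairWord i r).1, (pairWord i r).2, (pairWord i (oppositeWord r)).1,
      (pairWord i (oppositeWord r)).2, (pairWord i r).1, (pairWord i r).2] n =
      4 * wordCoeff [(pairWord i r).1, (pairWord i r).2] n ∧
    wordMask [(pairWord i r).1, (pairWord i r).2, (pairWord i (oppositeWord r)).1,
      (pairWord i (oppositeWord r)).2, (pairWord i r).1, (pairWord i r).2] n =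
      wordMask [(pairWord i r).1, (pairWord i r).2] n := by
  decide +kernel

/-- After division by 4, each double word is the projection to monomials with a prescribed
membership of `i` and `i + 1`: both, neither, only the first, only the second, for r = 0, 1, 2, 3.
-/
theorem wordCoeff_double : ∀ (i : Fin 7) (r : Fin 4) (n : Fin 128),
    wordCoeff [(pairWord i r).1, (pairWord i r).2, (pairWord i (oppositeWord r)).1,
      (pairWord i (oppositeWord r)).2] n =
      (if (n.val.testBit i.val = decide (r = 0 ∨ r = 2)) ∧
        (n.val.testBit (i + 1).val = decide (r = 0 ∨ r = 3)) then 4 else 0) ∧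
    wordMask [(pairWord i r).1, (pairWord i r).2, (pairWord i (oppositeWord r)).1,
      (pairWord i (oppositeWord r)).2] n = n := by
  decide +kernel

/-- The nilpotent operators attached to a pair `(i, i + 1)`. -/
def pairOp (i : Fin 7) (r : Fin 4) : Module.End ℂ Delta14 :=
  (2 : ℂ)⁻¹ • biv (vBasis (pairWord i r).1) (vBasis (pairWord i r).2)

theorem pairOp_apply (i : Fin 7) (r : Fin 4) (z : Delta14) : pairOp i r z =
    (2 : ℂ)⁻¹ • biv (vBasis (pairWord i r).1) (vBasis (pairWord i r).2) z := rfl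

theorem pairOp_sq (i : Fin 7) (r : Fin 4) (z : Delta14) : pairOp i r (pairOp i r z) = 0 := by
  rw [pairOp_apply, pairOp_apply, map_smul]
  have h : biv (vBasis (pairWord i r).1) (vBasis (pairWord i r).2)
      (biv (vBasis (pairWord i r).1) (vBasis (pairWord i r).2) z) = 0 := by
    refine delta_ext fun n _ => ?_
    rw [coordMap_biv, coordMap_biv]
    refine (foldr_gen [_, _, _, _] (coordMap z) n).trans ?_
    rw [wordCoeff_sq]
    simp
  rw [h, smul_zero, smul_zero]

theorem pairOp_triple (i : Fin 7) (r : Fin 4) (z : Delta14) :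
    pairOp i r (pairOp i (oppositeWord r) (pairOp i r z)) = pairOp i r z := by
  refine delta_ext fun n _ => ?_
  simp only [pairOp_apply, map_smul, Submodule.coe_smul, coordMap_biv, Pi.smul_apply]
  have h1 := foldr_gen [(pairWord i r).1, (pairWord i r).2, (pairWord i (oppositeWord r)).1,
      (pairWord i (oppositeWord r)).2, (pairWord i r).1, (pairWord i r).2] (coordMap z) n
  have h2 := foldr_gen [(pairWord i r).1, (pairWord i r).2] (coordMap z) n
  rw [(wordCoeff_triple i r n).1, (wordCoeff_triple i r n).2] at h1
  simp only [List.foldr_cons, List.foldr_nil] at h1 h2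
  rw [h1, h2]
  push_cast
  simp only [smul_eq_mul]
  ring

theorem coordMap_pairOp_double (i : Fin 7) (r : Fin 4) (z : Delta14) (n : Fin 128) :
    coordMap (pairOp i r (pairOp i (oppositeWord r) z)) n =
      if (n.val.testBit i.val = decide (r = 0 ∨ r = 2)) ∧
        (n.val.testBit (i + 1).val = decide (r = 0 ∨ r = 3)) then coordMap z n else 0 := by
  simp only [pairOp_apply, map_smul, Submodule.coe_smul, coordMap_biv, Pi.smul_apply]
  have h1 := foldr_gen [(pairWord i r).1, (pairWord i r).2, (pairWord i (oppositeWord r)).1,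
      (pairWord i (oppositeWord r)).2] (coordMap z) n
  rw [(wordCoeff_double i r n).1, (wordCoeff_double i r n).2] at h1
  simp only [List.foldr_cons, List.foldr_nil] at h1
  rw [h1]
  split_ifs <;> simp
  ring

theorem isUnipotentGenerator_pairOp (i : Fin 7) (r : Fin 4) : IsUnipotentGenerator (pairOp i r) :=
  isUnipotentGenerator_biv (pairWord_spec i r) _

theorem wordCoeff_dilate : ∀ (i : Fin 7) (n : Fin 128),
    wordCoeff [Fin.natAdd 7 i, Fin.castAdd 7 i] n = (if n.val.testBit i.val then 0 else 2) ∧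
      wordMask [Fin.natAdd 7 i, Fin.castAdd 7 i] n = n := by
  decide +kernel

theorem coordMap_dilate (i : Fin 7) (s : ℂ) (z : Delta14) (n : Fin 128) :
    coordMap (dilate i s z) n = (if n.val.testBit i.val then 1 else s) * coordMap z n := by
  rw [dilate_apply, Submodule.coe_add, Submodule.coe_smul, map_add, map_smul, coordMap_biv]
  have h1 := foldr_gen [Fin.natAdd 7 i, Fin.castAdd 7 i] (coordMap z) n
  rw [(wordCoeff_dilate i n).1, (wordCoeff_dilate i n).2] at h1
  simp only [List.foldr_cons, List.foldr_nil] at h1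
  rw [Pi.add_apply, Pi.smul_apply, h1]
  split_ifs
  · simp
  · push_cast
    rw [smul_eq_mul]
    ring

theorem coordMap_pairOp_add (i : Fin 7) (r : Fin 4) (a b : ℂ) (w : Delta14) (n : Fin 128) :
    coordMap (w + a • pairOp i r (pairOp i (oppositeWord r) w) +
        b • pairOp i (oppositeWord r) (pairOp i r w) : Delta14) n =
      (1 + (if (n.val.testBit i.val = decide (r = 0 ∨ r = 2)) ∧
          (n.val.testBit (i + 1).val = decide (r = 0 ∨ r = 3)) then a else 0) +
        (if (n.val.testBit i.val = decide (oppositeWord r = 0 ∨ oppositeWord r = 2)) ∧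
          (n.val.testBit (i + 1).val = decide (oppositeWord r = 0 ∨ oppositeWord r = 3))
          then b else 0)) * coordMap w n := by
  have h0 := coordMap_pairOp_double i r w n
  have h1 := coordMap_pairOp_double i (oppositeWord r) w n
  rw [(by decide : ∀ r, oppositeWord (oppositeWord r) = r) r] at h1
  rw [Submodule.coe_add, Submodule.coe_add, Submodule.coe_smul, Submodule.coe_smul, map_add,
    map_add, map_smul, map_smul, Pi.add_apply, Pi.add_apply, Pi.smul_apply, Pi.smul_apply, h0, h1,
    smul_eq_mul, smul_eq_mul, add_mul, add_mul, one_mul, ite_mul, ite_mul, mul_ite, mul_ite,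
    mul_zero, mul_zero, zero_mul]

/-- Starting from the homothety s, the first torus multiplies by s⁻¹ or s when both or neither of
`i`, `i + 1` belong to the subset, and the second does so when exactly `i` or exactly `i + 1` does.
The total factor is 1 if `i` is present and s² otherwise. -/
theorem dilate_sq (i : Fin 7) {s : ℂ} (hs : s ≠ 0) (z : Delta14) :
    ∃ w : Delta14, w = s • z + (s⁻¹ - 1) • pairOp i 0 (pairOp i 1 (s • z)) +
        ((s⁻¹)⁻¹ - 1) • pairOp i 1 (pairOp i 0 (s • z)) ∧
      dilate i (s ^ 2) z = w + (s⁻¹ - 1) • pairOp i 2 (pairOp i 3 w) +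
        ((s⁻¹)⁻¹ - 1) • pairOp i 3 (pairOp i 2 w) := by
  refine ⟨_, rfl, delta_ext fun n _ => ?_⟩
  have h := (coordMap_pairOp_add i 2 (s⁻¹ - 1) ((s⁻¹)⁻¹ - 1) _ n).trans
    (congrArg _ (coordMap_pairOp_add i 0 (s⁻¹ - 1) ((s⁻¹)⁻¹ - 1) (s • z) n))
  refine (coordMap_dilate i _ z n).trans (Eq.trans ?_ h.symm)
  rw [Submodule.coe_smul, map_smul, Pi.smul_apply, smul_eq_mul]
  cases n.val.testBit i.val <;> cases n.val.testBit (i + 1).val <;>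
    simp [oppositeWord] <;> field_simp

/-- A factor is not assumed homogeneous or invariant; writing the dilation with unipotents leaves
only the homothety. -/
theorem factor_dilate {f g : Delta14 → ℂ} (hf : f ∈ polyFun Delta14) (hg : g ∈ polyFun Delta14)
    (hfg : f * g = octic) (i : Fin 7) {s : ℂ} (hs : s ≠ 0) {z : Delta14} (hz : octic z ≠ 0) :
    f (dilate i (s ^ 2) z) = f (s • z) := by
  obtain ⟨w, hw, hd⟩ := dilate_sq i hs z
  have hsz : octic (s • z) ≠ 0 := by
    rw [octic_smul]
    exact mul_ne_zero (pow_ne_zero _ hs) hz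
  have h1 := factor_elementary hf hg hfg (isUnipotentGenerator_pairOp i 0)
    (isUnipotentGenerator_pairOp i 1) (pairOp_sq i 0) (pairOp_sq i 1) (pairOp_triple i 0)
    (pairOp_triple i 1) (inv_ne_zero hs) hsz
  rw [← hw] at h1
  have h2 := factor_elementary hf hg hfg (isUnipotentGenerator_pairOp i 2)
    (isUnipotentGenerator_pairOp i 3) (pairOp_sq i 2) (pairOp_sq i 3) (pairOp_triple i 2)
    (pairOp_triple i 3) (inv_ne_zero hs) (z := w) (by rw [h1.2]; exact hsz)
  rw [hd, h2.1, h1.1]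

/-! ### Irreducibility of the octic -/

/-- The spinor whose coordinates are multiplied by `s` for each missing element. -/
def dilateAll (s : ℂ) (z : Delta14) : Delta14 := (List.finRange 7).foldr (fun i => dilate i s) z

theorem octic_foldr_dilate (L : List (Fin 7)) {s : ℂ} (hs : s ≠ 0) (z : Delta14) :
    octic (L.foldr (fun i => dilate i s) z) = s ^ (4 * L.length) * octic z := by
  induction L with
  | nil => simp
  | cons i L ih =>
    rw [List.foldr_cons, octic_dilate i hs, ih, List.length_cons]
    ring

theorem octic_dilateAll {s : ℂ} (hs : s ≠ 0) (z : Delta14) :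
    octic (dilateAll s z) = s ^ 28 * octic z := octic_foldr_dilate _ hs z

theorem foldr_dilate_smul (L : List (Fin 7)) (s c : ℂ) (z : Delta14) :
    L.foldr (fun i => dilate i s) (c • z) = c • L.foldr (fun i => dilate i s) z := by
  induction L with
  | nil => rfl
  | cons i L ih => rw [List.foldr_cons, ih, map_smul, List.foldr_cons]

theorem coordMap_foldr_dilate (L : List (Fin 7)) (s : ℂ) (z : Delta14) (n : Fin 128) :
    coordMap (L.foldr (fun i => dilate i s) z : Delta14) n =
      s ^ L.countP (fun i => !n.val.testBit i.val) * coordMap z n := by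
  induction L with
  | nil => simp
  | cons i L ih =>
    rw [List.foldr_cons, coordMap_dilate, ih, List.countP_cons]
    cases n.val.testBit i.val <;> simp
    ring

/-- The scalar misses 7 elements and each complement of a line misses 3. The difference 4 is the
weight used to move the coefficient a. -/
theorem dilateAll_exponent : ∀ n : Fin 128, (List.finRange 7).countP (fun i => !n.val.testBit i.val) =
    if n = 0 then 7 else if quadMask.testBit n then 3 else 7 - bitCount n := by
  decide +kernel

theorem coordMap_dilateAll_fanoSpinor (s : ℂ) (a : ℤ) (n : Fin 128) :
    coordMap (dilateAll s (fanoSpinor a)) n =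
      (if n = 0 then s ^ 7 else s ^ 3) * coordMap (fanoSpinor a) n := by
  rw [dilateAll, coordMap_foldr_dilate, dilateAll_exponent, coordMap_fanoSpinor]
  simp only [fanoCoord_eq]
  split_ifs <;> simp

theorem dilateAll_fanoSpinor {s : ℂ} (hs : s ^ 4 = 1) (a : ℤ) :
    dilateAll s (fanoSpinor a) = s ^ 3 • fanoSpinor a := by
  refine delta_ext fun n _ => ?_
  rw [coordMap_dilateAll_fanoSpinor, Submodule.coe_smul, map_smul, Pi.smul_apply, smul_eq_mul]
  split_ifs
  · rw [show s ^ 7 = s ^ 4 * s ^ 3 by ring, hs, one_mul]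
  · rfl

theorem factor_foldr_dilate {f g : Delta14 → ℂ} (hf : f ∈ polyFun Delta14)
    (hg : g ∈ polyFun Delta14) (hfg : f * g = octic) (L : List (Fin 7)) {s : ℂ} (hs : s ≠ 0)
    {z : Delta14} (hz : octic z ≠ 0) :
    f (L.foldr (fun i => dilate i (s ^ 2)) z) = f (s ^ L.length • z) := by
  induction L generalizing z with
  | nil => simp
  | cons i L ih =>
    rw [List.foldr_cons, factor_dilate hf hg hfg i hs, ← foldr_dilate_smul, ih, smul_smul,
      List.length_cons, pow_succ]
    · rw [octic_smul]
      exact mul_ne_zero (pow_ne_zero _ hs) hz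
    · rw [octic_foldr_dilate _ (pow_ne_zero _ hs)]
      exact mul_ne_zero (pow_ne_zero _ (pow_ne_zero _ hs)) hz

/-- On the line through a point where the octic is not zero, its factors are monomials. -/
theorem factor_monomial {f g : Delta14 → ℂ} (hf : f ∈ polyFun Delta14)
    (hg : g ∈ polyFun Delta14) (hfg : f * g = octic) {z : Delta14} (hz : octic z ≠ 0) :
    ∃ d ≤ 8, ∀ t : ℂ, f (t • z) = t ^ d * f z := by
  obtain ⟨P, hP⟩ := exists_polynomial_line hf 0 z
  obtain ⟨R, hR⟩ := exists_polynomial_line hg 0 z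
  simp only [zero_add] at hP hR
  have h1 : P * (R * Polynomial.C (octic z)⁻¹) = Polynomial.X ^ 8 := Polynomial.funext fun t => by
    rw [Polynomial.eval_mul, Polynomial.eval_mul, ← hP, ← hR, ← mul_assoc, ← Pi.mul_apply, hfg,
      octic_smul, Polynomial.eval_C, mul_assoc, mul_inv_cancel₀ hz, mul_one, Polynomial.eval_pow,
      Polynomial.eval_X]
  -- On this line the octic is a nonzero multiple of t⁸, and the divisors of a power of X are
  -- monomials up to units.
  obtain ⟨d, hd, u, hu⟩ := (dvd_prime_pow Polynomial.prime_X 8).mp ⟨_, h1.symm⟩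
  obtain ⟨a, ha, hau⟩ := Polynomial.isUnit_iff.mp u.isUnit
  rw [← hau] at hu
  have h2 : ∀ t : ℂ, f (t • z) * a = t ^ d := fun t => by
    rw [hP, ← Polynomial.eval_C (a := a) (x := t), ← Polynomial.eval_mul, hu, Polynomial.eval_pow,
      Polynomial.eval_X]
  refine ⟨d, hd, fun t => mul_right_cancel₀ ha.ne_zero ?_⟩
  have h3 := h2 1
  rw [one_smul, one_pow] at h3
  rw [h2, mul_assoc, h3, mul_one]

/-- Take s with s⁴ = −1. The total dilation by s² multiplies `fanoSpinor 4` by s⁶, whereas a factor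
cannot distinguish it from the homothety s⁷. Hence s^d = 1 for the degree d ≤ 8 on the line, and s
has order 8. -/
theorem factor_fanoSpinor {f g : Delta14 → ℂ} (hf : f ∈ polyFun Delta14)
    (hg : g ∈ polyFun Delta14) (hfg : f * g = octic) :
    (∀ t : ℂ, f (t • fanoSpinor 4) = f (fanoSpinor 4)) ∨
      ∀ t : ℂ, f (t • fanoSpinor 4) = t ^ 8 * f (fanoSpinor 4) := by
  have hz : octic (fanoSpinor 4) ≠ 0 := by
    rw [octic_fanoSpinor_four]
    norm_num
  obtain ⟨d, hd, h⟩ := factor_monomial hf hg hfg hz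
  obtain ⟨s, hs⟩ := IsAlgClosed.exists_pow_nat_eq (-1 : ℂ) (n := 4) (by norm_num)
  have hs0 : s ≠ 0 := fun h => by
    rw [h] at hs
    norm_num at hs
  have hf0 : f (fanoSpinor 4) ≠ 0 := fun h0 => hz (by rw [← hfg, Pi.mul_apply, h0, zero_mul])
  have h1 := factor_foldr_dilate hf hg hfg (List.finRange 7) hs0 hz
  have h2 : (List.finRange 7).foldr (fun i => dilate i (s ^ 2)) (fanoSpinor 4) = _ :=
    dilateAll_fanoSpinor (s := s ^ 2) (by rw [← pow_mul, show s ^ (2 * 4) = (s ^ 4) ^ 2 by ring, hs]; norm_num) 4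
  rw [h2, h, h] at h1
  have h3 : s ^ d = 1 := by
    have h4 := mul_right_cancel₀ hf0 h1
    rw [← pow_mul, ← pow_mul, ← pow_mul, List.length_finRange] at h4
    refine mul_left_cancel₀ (pow_ne_zero (2 * (3 * d)) hs0) ?_
    rw [← pow_add, mul_one, h4]
    congr 1
    ring
  have h5 : orderOf s = 2 ^ (2 + 1) := orderOf_eq_prime_pow
    (by rw [show 2 ^ 2 = 4 from rfl, hs]; norm_num)
    (by rw [show 2 ^ (2 + 1) = 4 * 2 from rfl, pow_mul, hs]; norm_num)
  have h6 : 2 ^ (2 + 1) ∣ d := h5 ▸ orderOf_dvd_of_pow_eq_one h3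
  obtain rfl | rfl : d = 0 ∨ d = 8 := by omega
  · exact Or.inl fun t => by rw [h, pow_zero, one_mul]
  · exact Or.inr h

/-- If both factors vanished at 0, both would have degree 8 on the line of `fanoSpinor 4`, and their
product degree 16 instead of 8. -/
theorem factor_zero_ne_zero {f g : Delta14 → ℂ} (hf : f ∈ polyFun Delta14)
    (hg : g ∈ polyFun Delta14) (hfg : f * g = octic) : f 0 ≠ 0 ∨ g 0 ≠ 0 := by
  by_contra! h
  have hz : f (fanoSpinor 4) * g (fanoSpinor 4) ≠ 0 := by
    rw [← Pi.mul_apply, hfg, octic_fanoSpinor_four]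
    norm_num
  have h2 : f ((2 : ℂ) • fanoSpinor 4) * g ((2 : ℂ) • fanoSpinor 4) =
      2 ^ 8 * (f (fanoSpinor 4) * g (fanoSpinor 4)) := by
    rw [← Pi.mul_apply, hfg, octic_smul, ← hfg, Pi.mul_apply]
  rcases factor_fanoSpinor hf hg hfg with h1 | h1
  · have := h1 0
    rw [zero_smul, h.1] at this
    rw [← this, zero_mul] at hz
    exact hz rfl
  · rcases factor_fanoSpinor hg hf (by rw [mul_comm, hfg]) with h3 | h3
    · have := h3 0
      rw [zero_smul, h.2] at this
      rw [← this, mul_zero] at hz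
      exact hz rfl
    · rw [h1, h3, mul_mul_mul_comm] at h2
      have := mul_right_cancel₀ hz h2
      norm_num at this

/-- The factor precomposed with c times a spin element is again a factor of the octic after
rescaling its partner. It is nonzero at 0, so it is constant on the line of `fanoSpinor 4`; thus the
original factor takes its value at 0 on the whole open orbit. -/
theorem factor_const {f g : Delta14 → ℂ} (hf : f ∈ polyFun Delta14)
    (hg : g ∈ polyFun Delta14) (hfg : f * g = octic) (h0 : f 0 ≠ 0) (z : Delta14) : f z = f 0 := by
  have h : (fun z => f z - f 0) = 0 := by
    refine polyFun_eq_zero_of_orbitCone tangentSpace_fanoSpinor_four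
      (sub_mem hf ((polyFun Delta14).algebraMap_mem (f 0))) ?_
    rintro _ ⟨c, hc, a, rfl⟩
    let L : Delta14 →ₗ[ℂ] Delta14 := c • spinRep a
    have h1 : (fun x => f (L x)) * ((c ^ 8)⁻¹ • fun x => g (L x)) = octic := by
      ext x
      have h2 : f (L x) * g (L x) = c ^ 8 * octic x := by
        rw [← Pi.mul_apply, hfg, LinearMap.smul_apply, octic_smul, octic_spinRep]
      rw [Pi.mul_apply, Pi.smul_apply, smul_eq_mul, mul_left_comm, h2,
        inv_mul_cancel_left₀ (pow_ne_zero _ hc)]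
    have h3 : f (L (fanoSpinor 4)) = f 0 := by
      rcases factor_fanoSpinor (polyFun_comp hf L)
        ((polyFun Delta14).smul_mem (polyFun_comp hg L) _) h1 with h3 | h3
      · have := h3 0
        rw [zero_smul, map_zero] at this
        exact this.symm
      · have := h3 0
        rw [zero_smul, map_zero] at this
        exact absurd (this.trans (by simp)) h0
    exact sub_eq_zero.mpr h3
  exact sub_eq_zero.mp (congrFun h z)

theorem octic_zero : octic 0 = 0 := by
  have h := octic_smul 0 0
  rwa [zero_smul, zero_pow (by norm_num), zero_mul] at h

theorem irreducible_octic {ι : Type} [Fintype ι] (b : Module.Basis ι ℂ Delta14)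
    {p : MvPolynomial ι ℂ} (hp : ∀ z, octic z = MvPolynomial.eval (b.repr z) p) : Irreducible p := by
  have h4 : octic (fanoSpinor 4) ≠ 0 := by
    rw [octic_fanoSpinor_four]
    norm_num
  have hconst : ∀ A : MvPolynomial ι ℂ, ∀ c : ℂ, c ≠ 0 →
      (∀ z, MvPolynomial.eval (b.repr z) A = c) → IsUnit A := by
    intro A c hc h
    have hA : A = MvPolynomial.C c := MvPolynomial.funext fun x => by
      have := h (b.equivFun.symm x)
      rw [← Module.Basis.equivFun_apply, LinearEquiv.apply_symm_apply] at this
      rw [this, MvPolynomial.eval_C]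
    rw [hA]
    exact (isUnit_iff_ne_zero.mpr hc).map MvPolynomial.C
  refine ⟨fun hu => ?_, fun A B hAB => ?_⟩
  · have := hu.map (MvPolynomial.eval (b.repr 0))
    rw [← hp, octic_zero] at this
    exact not_isUnit_zero this
  · have hA := eval_mem_polyFun b A
    have hB := eval_mem_polyFun b B
    have h : (fun z => MvPolynomial.eval (b.repr z) A) * (fun z => MvPolynomial.eval (b.repr z) B) =
        octic := funext fun z => by rw [Pi.mul_apply, hp, hAB, map_mul]
    rcases factor_zero_ne_zero hA hB h with h0 | h0
    · exact Or.inl (hconst A _ h0 (factor_const hA hB h h0))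
    · exact Or.inr (hconst B _ h0 (factor_const hB hA (by rw [mul_comm, h]) h0))

/-! ### The differential of the octic -/

/-- The differential of the octic invariant. -/
def octicDifferential (z : Delta14) : Module.Dual ℂ Delta14 :=
  (exists_differential octic_mem_polyFun z).choose

theorem hasDerivAt_octic (z w : Delta14) :
    HasDerivAt (fun t : ℂ => octic (z + t • w)) (octicDifferential z w) 0 :=
  (exists_differential octic_mem_polyFun z).choose_spec w

theorem octicDifferential_smul_spinRep (g : Spin14Group) (c : ℂ) (z w : Delta14) :
    octicDifferential (c • spinRep g z) (c • spinRep g w) = c ^ 8 * octicDifferential z w := by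
  have h : (fun t : ℂ => octic (c • spinRep g z + t • c • spinRep g w)) =
      fun t : ℂ => c ^ 8 * octic (z + t • w) := funext fun t => by
    rw [smul_comm t c, ← smul_add, ← map_smul, ← map_add, octic_smul, octic_spinRep]
  refine (hasDerivAt_octic _ _).unique ?_
  rw [h]
  exact (hasDerivAt_octic z w).const_mul _

theorem octic_orbitCone {z w : Delta14} (hz : octic z = 0) (hw : w ∈ orbitCone z) : octic w = 0 := by
  obtain ⟨c, -, g, rfl⟩ := hw
  rw [octic_smul, octic_spinRep, hz, mul_zero]

/-- The octic vanishes along the orbit, hence its differential vanishes on tangent directions. -/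
theorem octicDifferential_of_mem_tangentSpace {z : Delta14} (hz : octic z = 0) {w : Delta14}
    (hw : w ∈ tangentSpace z) : octicDifferential z w = 0 := by
  have h : Submodule.span ℂ (lineDirections (orbitCone z) z) ≤
      LinearMap.ker (octicDifferential z) := by
    refine Submodule.span_le.mpr fun v hv => ?_
    refine (hasDerivAt_octic z v).unique ((hasDerivAt_const (0 : ℂ) (0 : ℂ)).congr_of_eventuallyEq ?_)
    filter_upwards [hv] with t ht
    exact octic_orbitCone hz ht
  exact h (tangentSpace_le_span_lineDirections (mem_orbitCone_self z) hw)

/-- The bitmask of the empty set. -/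
def emptyMask : EvenMask := ⟨0, rfl⟩

theorem octic_fanoSpinor_zero : octic (fanoSpinor 0) = 0 := by
  refine octic_of_M_sq (LinearMap.ext fun v => ?_)
  rw [Module.End.mul_apply, M_fanoSpinor_zero, M_fanoSpinor_zero]
  simp

theorem octic_fanoSpinor_zero_add (t : ℂ) :
    octic (fanoSpinor 0 + t • deltaBasis emptyMask) = 36864 * t := by
  rcases eq_or_ne t 0 with rfl | ht
  · rw [zero_smul, add_zero, octic_fanoSpinor_zero, mul_zero]
  -- Dilating `fanoSpinor 4` in all directions gives s³ times `fanoSpinor 0` plus the scalar 4s⁴ =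
  -- t. Comparing s²⁴ with s²⁸ · 384² leaves s⁴ · 384² = 36864 t.
  obtain ⟨s, hs⟩ := IsAlgClosed.exists_pow_nat_eq (t / 4) (n := 4) (by norm_num)
  have hs0 : s ≠ 0 := fun h => by
    rw [h] at hs
    exact ht (by linear_combination -4 * hs)
  have h : dilateAll s (fanoSpinor 4) = s ^ 3 • (fanoSpinor 0 + t • deltaBasis emptyMask) := by
    refine delta_ext fun n _ => ?_
    rw [coordMap_dilateAll_fanoSpinor, Submodule.coe_smul, Submodule.coe_add, Submodule.coe_smul,
      map_smul, map_add, map_smul, Pi.smul_apply, Pi.add_apply, Pi.smul_apply, coordMap_deltaBasis,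
      coordMap_fanoSpinor, coordMap_fanoSpinor]
    by_cases hn : n = 0
    · subst hn
      simp [fanoCoord_eq, emptyMask]
      linear_combination 4 * s ^ 3 * hs
    · rw [Pi.single_eq_of_ne (show n ≠ emptyMask.1 from hn), if_neg hn]
      simp [fanoCoord_eq, hn]
  have h2 := octic_dilateAll hs0 (fanoSpinor 4)
  rw [h, octic_smul, octic_fanoSpinor_four] at h2
  refine mul_left_cancel₀ (pow_ne_zero 8 (pow_ne_zero 3 hs0)) (h2.trans ?_)
  linear_combination (36864 * 4 * s ^ 24) * hs

/-- All monomials but the scalar are tangent to the orbit, and the scalar direction was just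
computed. In particular the hypersurface is smooth here and its tangent hyperplane is the tangent
space of the orbit. -/
theorem octicDifferential_fanoSpinor_zero (w : Delta14) :
    octicDifferential (fanoSpinor 0) w = 36864 * coordMap w 0 := by
  have h : octicDifferential (fanoSpinor 0) = (36864 : ℂ) • deltaBasis.coord emptyMask := by
    refine deltaBasis.ext fun k => ?_
    rw [LinearMap.smul_apply, Module.Basis.coord_apply, Module.Basis.repr_self]
    by_cases hk : k = emptyMask
    · subst hk
      refine (hasDerivAt_octic _ _).unique ?_
      simp only [octic_fanoSpinor_zero_add]
      simpa using (hasDerivAt_id (0 : ℂ)).const_mul (36864 : ℂ)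
    · rw [Finsupp.single_eq_of_ne (Ne.symm hk), smul_zero]
      exact octicDifferential_of_mem_tangentSpace octic_fanoSpinor_zero
        (deltaBasis_mem_tangentSpace_zero fun h => hk (Subtype.ext h))
  rw [h]
  rfl

theorem mem_tangentSpace_fanoSpinor_zero {w : Delta14}
    (hw : octicDifferential (fanoSpinor 0) w = 0) : w ∈ tangentSpace (fanoSpinor 0) := by
  rw [octicDifferential_fanoSpinor_zero] at hw
  rw [← deltaBasis.sum_repr w]
  refine sum_mem fun k _ => ?_
  by_cases hk : k.1 = 0
  · rw [deltaBasis_repr, hk, (mul_eq_zero_iff_left (by norm_num : (36864 : ℂ) ≠ 0)).mp hw, zero_smul]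
    exact zero_mem _
  · exact Submodule.smul_mem _ _ (deltaBasis_mem_tangentSpace_zero hk)

theorem mem_tangentSpace_of_octicDifferential {z : Delta14} (hz : z ∈ orbitCone (fanoSpinor 0))
    {w : Delta14} (hw : octicDifferential z w = 0) : w ∈ tangentSpace z := by
  obtain ⟨c, hc, g, rfl⟩ := hz
  have h : w = c • spinRep g (c⁻¹ • spinRep g⁻¹ w) := by
    rw [map_smul, spinRep_apply_inv, smul_smul, mul_inv_cancel₀ hc, one_smul]
  rw [h, octicDifferential_smul_spinRep] at hw
  have h2 := mem_tangentSpace_fanoSpinor_zero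
    ((mul_eq_zero_iff_left (pow_ne_zero 8 hc)).mp hw)
  rw [h]
  exact Submodule.smul_mem _ _ (tangentSpace_smul hc _
    (tangentSpace_spinRep g _ (Submodule.mem_map_of_mem h2)))

/-- The monomial basis, indexed with a distinguished element. -/
def optionBasis : Module.Basis (Option {k : EvenMask // k ≠ emptyMask}) ℂ Delta14 :=
  deltaBasis.reindex (Equiv.optionSubtypeNe emptyMask).symm

theorem optionBasis_none : optionBasis none = deltaBasis emptyMask := by
  rw [optionBasis, Module.Basis.reindex_apply, Equiv.symm_symm, Equiv.optionSubtypeNe_none]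

theorem eval_pderiv_octic {ι : Type} [Fintype ι] (b : Module.Basis ι ℂ Delta14)
    {p : MvPolynomial ι ℂ} (hp : ∀ z, octic z = MvPolynomial.eval (b.repr z) p) (z : Delta14) (i : ι) :
    MvPolynomial.eval (b.repr z) (MvPolynomial.pderiv i p) = octicDifferential z (b i) := by
  classical
  have h := hasDerivAt_eval_line p (b.repr z) (b.repr (b i))
  refine Eq.trans ?_ (h.unique ?_)
  · simp [Finsupp.single_apply]
  · have h2 : (fun t : ℂ => MvPolynomial.eval (⇑(b.repr z) + t • ⇑(b.repr (b i))) p) =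
        fun t : ℂ => octic (z + t • b i) := funext fun t => by
      rw [hp, map_add, map_smul, Finsupp.coe_add, Finsupp.coe_smul]
    rw [h2]
    exact hasDerivAt_octic z (b i)

/-- A polynomial vanishing on the orbit of `fanoSpinor 0` vanishes on the hypersurface. -/
theorem eq_zero_of_forall_orbitCone {f : Delta14 → ℂ} (hf : f ∈ polyFun Delta14)
    (h : ∀ w ∈ orbitCone (fanoSpinor 0), f w = 0) {z : Delta14} (hz : octic z = 0) : f z = 0 := by
  obtain ⟨p, hp⟩ := exists_eval_of_mem_polyFun optionBasis octic_mem_polyFun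
  obtain ⟨r, hr⟩ := exists_eval_of_mem_polyFun optionBasis hf
  have hdvd : p ∣ r := by
    refine dvd_of_forall_mem optionBasis (O := orbitCone (fanoSpinor 0))
      (irreducible_octic optionBasis hp)
      (fun w hw => by rw [← hp, octic_orbitCone octic_fanoSpinor_zero hw])
      ⟨_, mem_orbitCone_self _, ?_⟩ (fun w hw hw' => ?_) (fun w hw => by rw [← hr, h w hw])
    · rw [eval_pderiv_octic optionBasis hp, optionBasis_none, octicDifferential_fanoSpinor_zero,
        coordMap_deltaBasis]
      change (36864 : ℂ) * Pi.single (M := fun _ => ℂ) (0 : Fin 128) 1 0 ≠ 0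
      rw [Pi.single_eq_same]
      norm_num
    · rw [eval_pderiv_octic optionBasis hp] at hw'
      refine eq_top_iff.mpr fun x _ => ?_
      -- Subtracting this multiple of the distinguished basis vector brings any `x` into the kernel
      -- of the differential, which is tangent to the orbit.
      set a := octicDifferential w x / octicDifferential w (optionBasis none)
      have h1 : octicDifferential w (x - a • optionBasis none) = 0 := by
        rw [map_sub, map_smul, smul_eq_mul, div_mul_cancel₀ _ hw', sub_self]
      have h2 := Submodule.span_mono (Set.subset_insert (optionBasis none) _)
        (tangentSpace_le_span_lineDirections hw (mem_tangentSpace_of_octicDifferential hw h1))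
      have h3 := Submodule.subset_span (R := ℂ)
        (Set.mem_insert (optionBasis none) (lineDirections (orbitCone (fanoSpinor 0)) w))
      have h4 := add_mem h2 (Submodule.smul_mem _ a h3)
      rwa [sub_add_cancel] at h4
  obtain ⟨s, rfl⟩ := hdvd
  rw [hr, map_mul, ← hp, hz, zero_mul]

/-- Disjoint orbits are excluded as for the open orbit, except that a polynomial vanishing on the
orbit of `fanoSpinor 0` is only known to vanish on the hypersurface. That is enough, since `z` lies
on it. -/
theorem mem_orbitCone_of_inOpenOrbitOfHypersurface {z : Delta14}
    (hz : InOpenOrbitOfHypersurface octic z) : z ∈ orbitCone (fanoSpinor 0) := by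
  obtain ⟨-, hz, U, ⟨I, hI, rfl⟩, hU⟩ := hz
  have hself : z ∈ orbitCone z := mem_orbitCone_self z
  rw [hU] at hself
  obtain ⟨⟨f, hf, hfz⟩, -⟩ := hself
  by_contra hn
  refine hfz (eq_zero_of_forall_orbitCone (hI f hf) (fun w hw => ?_) hz)
  by_contra hfw
  have hwz : w ∈ orbitCone z := by
    rw [hU]
    exact ⟨⟨f, hf, hfw⟩, octic_orbitCone octic_fanoSpinor_zero hw⟩
  exact hn (orbitCone_trans hw (orbitCone_symm hwz))

/-! ### The pure spinor -/

/-- The subspace `E` of `V₁₄`. -/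
abbrev isotropicE : Submodule ℂ V14 := LinearMap.range (LinearMap.inl ℂ E7 E7)

theorem mem_isotropicE {v : V14} : v ∈ isotropicE ↔ v.2 = 0 :=
  ⟨fun ⟨x, hx⟩ => by rw [← hx]; rfl, fun h => ⟨v.1, Prod.ext rfl h.symm⟩⟩

/-- A generator of `∧⁷E`. -/
def topSpinor : Spinors := cliff (vBasis 0) (deltaBasis ⟨126, rfl⟩)

theorem cliff_mem_one (v : V14) (z : Delta14) : cliff v z ∈ halfSpin 1 := by
  have h := cliff_mem v z.2
  rwa [zero_add] at h

theorem topSpinor_mem : topSpinor ∈ halfSpin 1 := by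
  rw [topSpinor]
  exact cliff_mem_one _ _

theorem coordMap_topSpinor : coordMap topSpinor = fun n : Fin 128 => ((Pi.single 127 1 : Fin 128 → ℤ) n : ℂ) := by
  have h1 : ∀ n : Fin 128, gen ℤ 0 (Pi.single 126 1) n = (Pi.single 127 1 : Fin 128 → ℤ) n := by
    decide +kernel
  have h2 : (Pi.single 126 1 : Sp) = fun n => (((Pi.single 126 1 : Fin 128 → ℤ) n : ℤ) : ℂ) := by
    ext n
    simp [Pi.single_apply]
  rw [topSpinor, coordMap_cliff, op_vBasis, coordMap_deltaBasis, h2, gen_cast]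
  exact funext fun n => congrArg _ (h1 n)

theorem pairing_topSpinor (s : Spinors) : pairing s topSpinor = coordMap s 0 := by
  have h1 : ∀ n : Fin 128, pairSign n * (Pi.single 127 1 : Fin 128 → ℤ) n.rev = if n = 0 then 1 else 0 := by
    decide +kernel
  rw [pairing_eq, pairCoord, coordMap_topSpinor]
  have h2 : ∀ n : Fin 128, (pairSign n : ℂ) * coordMap s n *
      ((Pi.single 127 1 : Fin 128 → ℤ) n.rev : ℂ) = if n = 0 then coordMap s n else 0 := fun n => by
    rw [mul_right_comm, ← Int.cast_mul, h1]
    split_ifs <;> simp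
  simp only [h2, Finset.sum_ite_eq', Finset.mem_univ, if_true]

theorem topSpinor_ne_zero : topSpinor ≠ 0 := fun h => by
  have h1 := congrFun coordMap_topSpinor 127
  rw [h, map_zero] at h1
  simp at h1

/-- Vectors of E kill the top degree. Conversely, if v kills it too, anticommuting v with e_i gives
q(e_i, v) = 0 for all i, so v has no component in F. -/
theorem cliff_topSpinor {v : V14} : cliff v topSpinor = 0 ↔ v ∈ isotropicE := by
  have h1 : ∀ (i : Fin 7) (n : Fin 128), gen ℤ (Fin.castAdd 7 i) (Pi.single 127 1) n = 0 := by
    decide +kernel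
  have h2 : ∀ i : Fin 7, cliff (vBasis (Fin.castAdd 7 i)) topSpinor = 0 := fun i => by
    refine coordMap_injective ?_
    rw [coordMap_cliff, op_vBasis, coordMap_topSpinor, gen_cast, map_zero]
    ext n
    rw [h1, Int.cast_zero, Pi.zero_apply]
  constructor
  · intro hv
    rw [mem_isotropicE]
    ext i
    have h3 := cliff_anticomm (vBasis (Fin.castAdd 7 i)) v topSpinor
    rw [hv, h2, map_zero, map_zero, add_zero] at h3
    have h4 := (smul_eq_zero_iff_left topSpinor_ne_zero).mp h3.symm
    rw [vBasis_castAdd, q_apply, eVec] at h4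
    simpa using h4
  · rintro ⟨x, rfl⟩
    have h5 : LinearMap.inl ℂ E7 E7 x = ∑ i, x i • vBasis (Fin.castAdd 7 i) := by
      simp only [vBasis_castAdd, eVec]
      ext j
      · simp [Finset.sum_apply, Pi.single_apply, Prod.fst_sum]
      · simp [Finset.sum_apply, Prod.snd_sum]
    rw [h5, map_sum, LinearMap.sum_apply]
    exact Finset.sum_eq_zero fun i _ => by rw [map_smul, LinearMap.smul_apply, h2, smul_zero]

theorem finrank_isotropicE : Module.finrank ℂ isotropicE = 7 := by
  rw [LinearMap.finrank_range_of_inj LinearMap.inl_injective]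
  simp

theorem isAssociatedIsotropic_fanoSpinor_zero :
    IsAssociatedIsotropic octic (fanoSpinor 0) isotropicE where
  finrank := finrank_isotropicE
  isotropic := by
    rintro _ ⟨x, rfl⟩ _ ⟨y, rfl⟩
    rw [q_apply]
    simp
  tangent := by
    refine ⟨(36864 : ℂ) • topSpinor, Submodule.smul_mem _ _ topSpinor_mem,
      smul_ne_zero (by norm_num) topSpinor_ne_zero, fun w => ?_, fun v hv => ?_⟩
    · rw [(hasDerivAt_octic _ _).deriv, octicDifferential_fanoSpinor_zero, ← pairingBilin_apply,
        map_smul, pairingBilin_apply, pairing_topSpinor, smul_eq_mul]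
    · rw [map_smul, cliff_topSpinor.mpr hv, smul_zero]

/-- The differential determines δ by nondegeneracy of the pairing, and the annihilator of δ is E;
equality follows by dimension. -/
theorem IsAssociatedIsotropic.eq_isotropicE {V : Submodule ℂ V14}
    (h : IsAssociatedIsotropic octic (fanoSpinor 0) V) : V = isotropicE := by
  obtain ⟨δ, hδ, -, hd, hV⟩ := h.tangent
  have h1 : δ - (36864 : ℂ) • topSpinor = 0 := by
    refine eq_zero_of_pairing (sub_mem hδ (Submodule.smul_mem _ _ topSpinor_mem)) fun w => ?_
    rw [← pairingBilin_apply, map_sub, map_smul, pairingBilin_apply, pairingBilin_apply, ← hd,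
      (hasDerivAt_octic _ _).deriv, octicDifferential_fanoSpinor_zero, pairing_topSpinor,
      smul_eq_mul, sub_self]
  refine Submodule.eq_of_le_of_finrank_eq (fun v hv => cliff_topSpinor.mp ?_)
    (h.finrank.trans finrank_isotropicE.symm)
  have h2 := hV v hv
  rw [sub_eq_zero.mp h1, map_smul] at h2
  exact (smul_eq_zero_iff_right (by norm_num)).mp h2

theorem IsAssociatedIsotropic.transport {z : Delta14} {V : Submodule ℂ V14}
    (h : IsAssociatedIsotropic octic z V) (g : Spin14Group) {c : ℂ} (hc : c ≠ 0) :
    IsAssociatedIsotropic octic (c • spinRep g z) (moveSubspace g V) where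
  finrank := (finrank_moveSubspace g V).trans h.finrank
  isotropic := q_moveSubspace g h.isotropic
  tangent := by
    obtain ⟨δ, hδ, h0, hd, hV⟩ := h.tangent
    -- A homogeneous function of degree 8 has a differential homogeneous of degree 7.
    refine ⟨c ^ 7 • cliffordRep (g : CliffordAlgebra Q) δ,
      Submodule.smul_mem _ _ (cliffordRep_mem_odd g hδ), smul_ne_zero (pow_ne_zero _ hc) ?_,
      fun w => ?_, fun v hv => ?_⟩
    · intro h1
      have h2 := cliffordRep_inv_apply g δ
      rw [h1, map_zero] at h2
      exact h0 h2.symm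
    · obtain ⟨x, rfl⟩ : ∃ x, w = c • spinRep g x := ⟨c⁻¹ • spinRep g⁻¹ w, by
        rw [map_smul, spinRep_apply_inv, smul_smul, mul_inv_cancel₀ hc, one_smul]⟩
      rw [(hasDerivAt_octic _ _).deriv, octicDifferential_smul_spinRep,
        ← (hasDerivAt_octic _ _).deriv, hd, ← pairingBilin_apply (c • spinRep g x : Delta14),
        Submodule.coe_smul, spinRep_coe, map_smul, map_smul, LinearMap.smul_apply,
        pairingBilin_apply, pairing_spin, smul_eq_mul, smul_eq_mul]
      ring
    · rw [moveSubspace_eq] at hv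
      obtain ⟨u, hu, rfl⟩ := hv
      rw [map_smul, cliff_vecMap, hV u hu, map_zero, smul_zero]

/-! ### Transport along the orbit in the hypersurface -/

theorem map_wedgeTwoWedge_le (g : Spin14Group) (V : Submodule ℂ V14) :
    (wedgeTwoWedge V).map (exteriorPower.map 3 (vecMap g)) ≤ wedgeTwoWedge (moveSubspace g V) := by
  rw [wedgeTwoWedge, Submodule.map_span_le]
  rintro _ ⟨a, ha, b, hb, c, rfl⟩
  rw [moveSubspace_eq, exteriorPower.map_apply_ιMulti]
  refine Submodule.subset_span ⟨vecMap g a, Submodule.mem_map_of_mem ha, vecMap g b,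
    Submodule.mem_map_of_mem hb, vecMap g c, congrArg _ ?_⟩
  ext i : 1
  fin_cases i <;> rfl

theorem M_hypersurface (g : Spin14Group) (c : ℂ) (v : V14) :
    M (c • spinRep g (fanoSpinor 0)) (vecMap g v) =
      vecMap g (LinearMap.inl ℂ E7 E7 ((384 * c ^ 4) • v.2)) := by
  rw [M_smul, LinearMap.smul_apply, M_spinRep, M_fanoSpinor_zero, map_smul, smul_smul, ← map_smul,
    mul_comm, map_smul, map_smul, map_smul]
  rfl

theorem hypersurface_spec {z : Delta14} (hz : InOpenOrbitOfHypersurface octic z) :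
    (∃! V : Submodule ℂ V14, IsAssociatedIsotropic octic z V) ∧
      ∀ V : Submodule ℂ V14, IsAssociatedIsotropic octic z V →
        Omega z ∈ wedgeTwoWedge V ∧ M z * M z = 0 ∧
          LinearMap.range (M z) = V ∧ LinearMap.ker (M z) = V := by
  obtain ⟨c, hc, g, rfl⟩ := mem_orbitCone_of_inOpenOrbitOfHypersurface hz
  have huniq : ∀ V : Submodule ℂ V14,
      IsAssociatedIsotropic octic (c • spinRep g (fanoSpinor 0)) V → V = moveSubspace g isotropicE := by
    intro V h
    have h1 := h.transport g⁻¹ (inv_ne_zero hc)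
    rw [map_smul, spinRep_inv_apply, smul_smul, inv_mul_cancel₀ hc, one_smul] at h1
    rw [← h1.eq_isotropicE, ← moveSubspace_mul, mul_inv_cancel, moveSubspace_one]
  refine ⟨⟨_, isAssociatedIsotropic_fanoSpinor_zero.transport g hc, huniq⟩, fun V hV => ?_⟩
  have hM := M_hypersurface g c
  have hsurj : ∀ v, vecMap g (vecMap g⁻¹ v) = v := vecMap_apply_inv g
  have h384 : (384 * c ^ 4 : ℂ) ≠ 0 := mul_ne_zero (by norm_num) (pow_ne_zero _ hc)
  rw [huniq V hV]
  refine ⟨?_, LinearMap.ext fun v => ?_, le_antisymm ?_ ?_, le_antisymm ?_ ?_⟩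
  · rw [Omega_smul, Omega_spinRep]
    exact Submodule.smul_mem _ _ (map_wedgeTwoWedge_le g _
      (Submodule.mem_map_of_mem Omega_fanoSpinor_zero_mem))
  · rw [Module.End.mul_apply, ← hsurj v, hM, hM]
    simp only [LinearMap.inl_apply, smul_zero]
    exact map_zero _
  · rintro _ ⟨v, rfl⟩
    rw [← hsurj v, hM, moveSubspace_eq]
    exact Submodule.mem_map_of_mem (LinearMap.mem_range_self _ _)
  · rw [moveSubspace_eq]
    rintro _ ⟨_, ⟨x, rfl⟩, rfl⟩
    -- A preimage is taken in the translate of F, which M maps isomorphically onto the translate of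
    -- E.
    refine ⟨vecMap g (0, (384 * c ^ 4)⁻¹ • x), ?_⟩
    rw [hM, smul_smul, mul_inv_cancel₀ h384, one_smul]
  · intro v hv
    rw [LinearMap.mem_ker, ← hsurj v, hM] at hv
    have h1 := (vecEquiv g).map_eq_zero_iff.mp hv
    have h2 := (map_eq_zero_iff _ LinearMap.inl_injective).mp h1
    rw [moveSubspace_eq]
    exact ⟨vecMap g⁻¹ v, mem_isotropicE.mpr ((smul_eq_zero_iff_right h384).mp h2), hsurj v⟩
  · rw [moveSubspace_eq]
    rintro _ ⟨_, ⟨x, rfl⟩, rfl⟩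
    rw [LinearMap.mem_ker, hM]
    simp only [LinearMap.inl_apply, smul_zero]
    exact map_zero _

theorem octic_ne_zero : octic ≠ 0 := fun h => by
  have h1 := octic_fanoSpinor_four
  rw [h] at h1
  norm_num at h1

end Spin14

end

/-! ### The proposition -/

theorem mainTheorem5 :
    ∃ J : Spin14.Delta14 → ℂ,
      -- `J` is the octic invariant, unique up to scalar
      Spin14.IsInvariantOctic J ∧ J ≠ 0 ∧
      (∀ J' : Spin14.Delta14 → ℂ, Spin14.IsInvariantOctic J' → ∃ c : ℂ, J' = c • J) ∧
      -- points of the open orbit in `ℙ(Δ₁₄)`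
      (∀ z : Spin14.Delta14, Spin14.InOpenOrbit z →
        (∃ V V' : Submodule ℂ Spin14.V14, Spin14.IsAssociatedPair z V V' ∧
          ∀ W W' : Submodule ℂ Spin14.V14, Spin14.IsAssociatedPair z W W' →
            (W = V ∧ W' = V') ∨ (W = V' ∧ W' = V)) ∧
        ∀ (V V' : Submodule ℂ Spin14.V14) (h : Spin14.IsAssociatedPair z V V'),
          (∃ (Ω : ⋀[ℂ]^3 V) (Ω' : ⋀[ℂ]^3 V'), Spin14.IsGeneric Ω ∧ Spin14.IsGeneric Ω' ∧
            Spin14.Omega z =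
              exteriorPower.map 3 V.subtype Ω + exteriorPower.map 3 V'.subtype Ω') ∧
          ∃ m : ℂ,
            Spin14.M z = m • (V'.projection V h.isCompl.symm - V.projection V' h.isCompl) ∧
            J z = m ^ 2) ∧
      -- points of the open orbit in the hypersurface `J = 0`
      (∀ z : Spin14.Delta14, Spin14.InOpenOrbitOfHypersurface J z →
        (∃! V : Submodule ℂ Spin14.V14, Spin14.IsAssociatedIsotropic J z V) ∧
        ∀ V : Submodule ℂ Spin14.V14, Spin14.IsAssociatedIsotropic J z V →
          Spin14.Omega z ∈ Spin14.wedgeTwoWedge V ∧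
          Spin14.M z * Spin14.M z = 0 ∧
          LinearMap.range (Spin14.M z) = V ∧ LinearMap.ker (Spin14.M z) = V) := by
  open Spin14 in
  refine ⟨octic, isInvariantOctic_octic, octic_ne_zero, fun J' hJ' => ⟨_,
    eq_smul_of_isInvariantOctic tangentSpace_fanoSpinor_four isInvariantOctic_octic hJ' ?_⟩,
    fun z hz => openOrbit_spec hz, fun z hz => hypersurface_spec hz⟩
  rw [Spin14.octic_fanoSpinor_four]
  norm_num
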